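/- Let $M,N,n$ be nonnegative integers with $N\ge M$ and $n\ge M$. Let $G$ be a random $M\times M$ complex matrix whose entries have joint density, with respect to Lebesgue measure $\prod_{i,j} d\,\mathrm{Re}\,G_{ij}\,d\,\mathrm{Im}\,G_{ij}$, $$\frac1{\mathcal N}\,\frac{(\det G^\dagger G)^{N-M}}{\det(\mathbb I+G^\dagger G)^{n+N}},\qquad \mathcal N=\pi^{M^2}\prod_{j=0}^{M-1}\frac{\Gamma(N-M+1+j)\,\Gamma(n-M+1+j)}{\Gamma(n+N-M+1+j)\,\Gamma(1+j)}$$ (this is a probability density). Then the joint density of the (unordered) eigenvalues $z_1,\dots,z_M\in\mathbb C$ of $G$, with respect to $\prod_j dx_j\,dy_j$ where $z_j=x_j+iy_j$, is $$\frac1{\mathcal C}\prod_{j=1}^M\frac{|z_j|^{2(N-M)}}{(1+|z_j|^2)^{n+N-M+1}}\prod_{1\le j<k\le M}|z_k-z_j|^2,\qquad \mathcal C=M!\,\pi^M\prod_{j=0}^{M-1}\frac{\Gamma(N-M+1+j)\,\Gamma(n-M+1+j)}{\Gamma(n+N-M+1)} .$$ This realises the spherical annulus plasma at $\beta=2$ in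 the following sense. Let $R>0$ and $Q,q\ge0$ with $QM=N-M$ and $qM=n-M$. For a point of the sphere of radius $R$ with polar angle $\theta\in[0,\pi]$ from the north pole and azimuth $\phi\in[0,2\pi]$ put $u=\cos(\theta/2)e^{i\phi/2}$, $v=-i\sin(\theta/2)e^{-i\phi/2}$, so that the chordal distance between two points is $2R|u'v-uv'|$. Let $$w=\prod_{l=1}^M|v_l|^{2QM}|u_l|^{2qM}\prod_{1\le j<k\le M}|u_kv_j-u_jv_k|^2 .$$ (i) Consider the annulus $\theta_Q\le\theta\le\pi-\theta_q$, where the polar caps $\theta<\theta_Q$ and $\theta>\pi-\theta_q$ have the fractions $Q/(1+q+Q)$ and $q/(1+q+Q)$ of the area of the sphere. Let $U$ be the total energy (particle-particle, particle-background and background-background) of $M$ unit charges in the annulus and a uniform neutralizing background of charge density $-\frac{M}{4\pi R^2}(1+Q+q)$ on the annulus, all charges interacting through the pair potential $-\log(2R|u'v-uv'|)$. Then there is a constant $K>0$, independent of the positions, such that $w=K e^{-2U}$ for all configurations of $M$ distinct points in the annulus. (ii) When $w$ is taken as a weight on the whole sphere (that is, with the restriction to the annulus relaxed), the measure $\frac{1}{\mathcal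 C\,(4R^2)^M}\,w\,dS_1\cdots dS_M$, with $dS=R^2\sin\theta\,d\theta\,d\phi$, is mapped by the stereographic projection $z=2Re^{i\phi}\tan(\theta/2)$, rescaled to $\tilde z=z/(2R)$, to the measure on $\mathbb C^M$ with the above eigenvalue density. -/

import Mathlib

open MeasureTheory ProbabilityTheory
open scoped Matrix Real

noncomputable section

namespace SphericalAnnulus

/-! ### The random matrix ensemble -/

/-- Lebesgue measure on complex `M × M` matrices, i.e. the product over all entries of
`d(Re G_{ij}) d(Im G_{ij})`; a matrix is given here by its array of entries. -/
abbrev matrixVolume (M : ℕ) : Measure (Fin M → Fin M → ℂ) := volume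

/-- The normalization constant of the element density. -/
def elementNorm (M N n : ℕ) : ℝ :=
  π ^ (M ^ 2) * ∏ j ∈ Finset.range M,
    (Real.Gamma ((N : ℝ) - M + 1 + j) * Real.Gamma ((n : ℝ) - M + 1 + j)) /
      (Real.Gamma ((n : ℝ) + N - M + 1 + j) * Real.Gamma (1 + (j : ℝ)))

/-- The element density `(1/𝒩) (det G†G)^{N-M} / det(1 + G†G)^{n+N}`. Both determinants are
real and nonnegative, so that taking real parts only changes the type. -/
def elementDensity (M N n : ℕ) (G : Matrix (Fin M) (Fin M) ℂ) : ℝ :=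
  1 / elementNorm M N n *
    (((Gᴴ * G).det.re) ^ (N - M) / ((1 + Gᴴ * G).det.re) ^ (n + N))

/-- The law of the entries of a random matrix with element density `elementDensity M N n`. -/
def elementLaw (M N n : ℕ) : Measure (Fin M → Fin M → ℂ) :=
  (matrixVolume M).withDensity fun G => ENNReal.ofReal (elementDensity M N n (Matrix.of G))

/-! ### Unordered eigenvalues and their joint density -/

/-- The unordered tuple (multiset of size `M`) underlying an ordered tuple. -/
def unordered {M : ℕ} (z : Fin M → ℂ) : Sym ℂ M :=
  ⟨Finset.univ.val.map z, by simp⟩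

/-- The quotient σ-algebra: a set of unordered tuples is measurable iff the set of all its
orderings is a Borel subset of `ℂ^M`. -/
instance instMeasurableSpaceSym (M : ℕ) : MeasurableSpace (Sym ℂ M) :=
  MeasurableSpace.map unordered inferInstance

/-- The eigenvalues of a complex matrix, with algebraic multiplicities, as an unordered tuple. -/
def eigenvalues {M : ℕ} (A : Matrix (Fin M) (Fin M) ℂ) : Sym ℂ M :=
  ⟨A.charpoly.roots, by
    rw [IsAlgClosed.card_roots_eq_natDegree, Matrix.charpoly_natDegree_eq_dim, Fintype.card_fin]⟩

/-- `ρ` is the (symmetric, i.e. with no ordering imposed) joint eigenvalue density, with respect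
to `∏ dx_j dy_j`, of the random matrix `G`: the unordered tuple of eigenvalues of `G` has the same
law as the unordered tuple underlying a random vector of `ℂ^M` with density `ρ`. -/
def HasEigenvaluePDF {Ω : Type*} [MeasurableSpace Ω] {M : ℕ}
    (G : Ω → Matrix (Fin M) (Fin M) ℂ) (ρ : (Fin M → ℂ) → ℝ) (P : Measure Ω) : Prop :=
  Measurable ρ ∧ (∀ z, 0 ≤ ρ z) ∧ (∀ (σ : Equiv.Perm (Fin M)) (z : Fin M → ℂ), ρ (z ∘ σ) = ρ z) ∧
    HasLaw (fun ω => eigenvalues (G ω))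
      ((volume.withDensity fun z : Fin M → ℂ => ENNReal.ofReal (ρ z)).map unordered) P

/-- The normalization constant of the eigenvalue density. -/
def eigenvalueNorm (M N n : ℕ) : ℝ :=
  (M.factorial : ℝ) * π ^ M * ∏ j ∈ Finset.range M,
    (Real.Gamma ((N : ℝ) - M + 1 + j) * Real.Gamma ((n : ℝ) - M + 1 + j)) /
      Real.Gamma ((n : ℝ) + N - M + 1)

/-- The claimed joint eigenvalue density (for `M ≤ N` the truncated subtractions are exact). -/
def eigenvalueDensity (M N n : ℕ) (z : Fin M → ℂ) : ℝ :=
  1 / eigenvalueNorm M N n *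
    (∏ j, ‖z j‖ ^ (2 * (N - M)) / (1 + ‖z j‖ ^ 2) ^ (n + N - M + 1)) *
      ∏ k, ∏ j ∈ Finset.Iio k, ‖z k - z j‖ ^ 2

/-! ### The one-component plasma on a spherical annulus

A point of the sphere of radius `R` is given by its angles `(θ, φ)`, where `0 ≤ θ ≤ π` is measured
from the north pole and `0 ≤ φ ≤ 2π`. -/

/-- The Cayley-Klein parameter `u`. -/
def ckU (p : ℝ × ℝ) : ℂ := Real.cos (p.1 / 2) * Complex.exp (Complex.I * p.2 / 2)

/-- The Cayley-Klein parameter `v`. -/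
def ckV (p : ℝ × ℝ) : ℂ := -Complex.I * Real.sin (p.1 / 2) * Complex.exp (-Complex.I * p.2 / 2)

/-- The Euclidean (chordal) distance `2R |u'v - uv'|` between two points of the sphere. -/
def chordalDist (R : ℝ) (p p' : ℝ × ℝ) : ℝ := 2 * R * ‖ckU p' * ckV p - ckU p * ckV p'‖

/-- The point of `ℝ³` with the given angles. -/
def spherePoint (R : ℝ) (p : ℝ × ℝ) : EuclideanSpace ℝ (Fin 3) :=
  !₂[R * (Real.sin p.1 * Real.cos p.2), R * (Real.sin p.1 * Real.sin p.2), R * Real.cos p.1]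

/-- `chordalDist` is indeed the Euclidean distance between points of the sphere. -/
theorem dist_spherePoint {R : ℝ} (hR : 0 ≤ R) (p p' : ℝ × ℝ) :
    dist (spherePoint R p) (spherePoint R p') = chordalDist R p p' := by
  have e1 : ∀ t : ℝ, Complex.exp (Complex.I * t / 2) =
      ⟨Real.cos (t / 2), Real.sin (t / 2)⟩ := by
    intro t
    have h : Complex.I * t / 2 = ((t / 2 : ℝ) : ℂ) * Complex.I := by push_cast; ring
    rw [h]
    apply Complex.ext
    · rw [Complex.exp_ofReal_mul_I_re]
    · rw [Complex.exp_ofReal_mul_I_im]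
  have e2 : ∀ t : ℝ, Complex.exp (-Complex.I * t / 2) =
      ⟨Real.cos (t / 2), -Real.sin (t / 2)⟩ := by
    intro t
    have h : -Complex.I * t / 2 = ((-(t / 2) : ℝ) : ℂ) * Complex.I := by push_cast; ring
    rw [h]
    apply Complex.ext
    · rw [Complex.exp_ofReal_mul_I_re, Real.cos_neg]
    · rw [Complex.exp_ofReal_mul_I_im, Real.sin_neg]
  have c2 : ∀ t : ℝ, Real.cos t = 2 * Real.cos (t / 2) ^ 2 - 1 := by
    intro t; rw [← Real.cos_two_mul]; ring_nf
  have s2 : ∀ t : ℝ, Real.sin t = 2 * Real.sin (t / 2) * Real.cos (t / 2) := by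
    intro t; rw [← Real.sin_two_mul]; ring_nf
  obtain ⟨a, b⟩ := p
  obtain ⟨c, d⟩ := p'
  refine (sq_eq_sq₀ dist_nonneg (by unfold chordalDist; positivity)).mp ?_
  rw [EuclideanSpace.dist_eq, Real.sq_sqrt (by positivity), chordalDist, mul_pow,
    Complex.sq_norm, Complex.normSq_apply]
  simp only [Fin.sum_univ_three, spherePoint, ckU, ckV, e1, e2, Real.dist_eq, sq_abs]
  simp [-Complex.ofReal_cos, -Complex.ofReal_sin]
  rw [c2 a, c2 b, c2 c, c2 d, s2 a, s2 b, s2 c, s2 d]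
  have ha := Real.sin_sq_add_cos_sq (a / 2)
  have hb := Real.sin_sq_add_cos_sq (b / 2)
  have hc := Real.sin_sq_add_cos_sq (c / 2)
  have hd := Real.sin_sq_add_cos_sq (d / 2)
  generalize Real.sin (a / 2) = sa at *
  generalize Real.sin (b / 2) = sb at *
  generalize Real.sin (c / 2) = sc at *
  generalize Real.sin (d / 2) = sd at *
  generalize Real.cos (a / 2) = ca at *
  generalize Real.cos (b / 2) = cb at *
  generalize Real.cos (c / 2) = cc at *
  generalize Real.cos (d / 2) = cd at *
  grind

/-- The pair potential, i.e. the solution of the charge neutral Poisson equation. -/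
def pairPotential (R : ℝ) (p p' : ℝ × ℝ) : ℝ := -Real.log (chordalDist R p p')

/-- The angle `θ` for which the cap of opening angle `θ` about a pole, which has area
`2πR²(1 - cos θ)`, makes up the fraction `f` of the sphere. -/
def capAngle (f : ℝ) : ℝ := Real.arccos (1 - 2 * f)

/-- The polar angle `θ_Q` of the northern boundary of the annulus: the cap above it is the
fraction `Q/(1+q+Q)` of the sphere. -/
def thetaNorth (Q q : ℝ) : ℝ := capAngle (Q / (1 + q + Q))

/-- The polar angle `π - θ_q` of the southern boundary of the annulus: the cap below it is the
fraction `q/(1+q+Q)` of the sphere. -/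
def thetaSouth (Q q : ℝ) : ℝ := π - capAngle (q / (1 + q + Q))

/-- The surface integral over the annulus, `dS = R² sin θ dθ dφ`. -/
def annulusIntegral (R Q q : ℝ) (f : ℝ × ℝ → ℝ) : ℝ :=
  ∫ θ in (thetaNorth Q q)..(thetaSouth Q q), ∫ φ in (0 : ℝ)..(2 * π),
    f (θ, φ) * (R ^ 2 * Real.sin θ)

/-- The background charge density in the annulus is `-ρ_b`, which neutralizes `K` unit charges. -/
def rhoB (K : ℕ) (R Q q : ℝ) : ℝ := K / (4 * π * R ^ 2) * (1 + Q + q)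

/-- The potential energy of a unit charge at `p` in the field of the background. -/
def backgroundPotential (K : ℕ) (R Q q : ℝ) (p : ℝ × ℝ) : ℝ :=
  annulusIntegral R Q q fun p' => -rhoB K R Q q * pairPotential R p p'

/-- The total potential energy of `K` unit charges in the annulus: particle-particle,
particle-background and background-background interactions. -/
def plasmaEnergy (K : ℕ) (R Q q : ℝ) (p : Fin K → ℝ × ℝ) : ℝ :=
  (∑ k, ∑ j ∈ Finset.Iio k, pairPotential R (p k) (p j)) +
    (∑ j, backgroundPotential K R Q q (p j)) +
    1 / 2 * annulusIntegral R Q q fun p' => -rhoB K R Q q * backgroundPotential K R Q q p'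

/-- The Boltzmann factor at inverse temperature `β`. -/
def boltzmannFactor (β : ℝ) (K : ℕ) (R Q q : ℝ) (p : Fin K → ℝ × ℝ) : ℝ :=
  Real.exp (-β * plasmaEnergy K R Q q p)

/-- The function of the particle positions
`∏ |v_l|^{βQK} |u_l|^{βqK} ∏_{j<k} |u_k v_j - u_j v_k|^β`, defined on the whole sphere. -/
def plasmaWeight (β : ℝ) (K : ℕ) (Q q : ℝ) (p : Fin K → ℝ × ℝ) : ℝ :=
  (∏ l, ‖ckV (p l)‖ ^ (β * Q * K) * ‖ckU (p l)‖ ^ (β * q * K)) *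
    ∏ k, ∏ j ∈ Finset.Iio k, ‖ckU (p k) * ckV (p j) - ckU (p j) * ckV (p k)‖ ^ β

/-- The surface measure `R² sin θ dθ dφ` of the sphere of radius `R`, in the angles. -/
def sphereArea (R : ℝ) : Measure (ℝ × ℝ) :=
  (volume.restrict (Set.Icc 0 π ×ˢ Set.Icc 0 (2 * π))).withDensity fun p =>
    ENNReal.ofReal (R ^ 2 * Real.sin p.1)

/-- The stereographic projection `z = 2R e^{iφ} tan(θ/2)`. -/
def stereographic (R : ℝ) (p : ℝ × ℝ) : ℂ :=
  2 * R * Complex.exp (Complex.I * p.2) * Real.tan (p.1 / 2)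

end SphericalAnnulus

end

/-!
Write `a = N - M` and `t = n + N - M`. The element density is a multiple of
`|det G|^{2a} / det(1 + G†G)^{M+t}` and the eigenvalue density is a multiple of
`∏ |z_j|^{2a} / (1 + |z_j|²)^{t+1} · ∏_{j<k} |z_k - z_j|²`.

**Eigenvalue law.** The passage to the eigenvalues is by induction on the size of the matrix and
splits off one eigenvalue at a time (`lintegral_gramWeight_eigenvalues`), which avoids the manifold
of unitary matrices in the usual Schur decomposition. A generic matrix `G` of size `m + 1` has
`m + 1` eigenvectors of the form `(1, w)`. With the unipotent matrix `L` whose first column is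
`(1, w)` one has `G = L [[λ, b], [0, D]] L⁻¹`. For fixed first row and fixed remaining block of `G`,
the first column of `G` is a function of `w` with derivative `λ - D`, so the area formula with
multiplicity (`lintegral_abs_det_mul_comp`) gives the deflation formula (`lintegral_deflation`)
`(m + 1) dG = |det(λ - D)|² dw dλ db dD`. The genericity that it needs is that the characteristic
polynomial has simple roots and that no eigenvector has vanishing first coordinate; both hold off
the zero set of a nonzero polynomial.

The weight `det(1 + G†G)` depends on `L` only through `L†L`, which has an explicit block Cholesky
factor (`choleskyFactor`); this turns `[[λ, b], [0, D]]` into a block triangular matrix with row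
affine in `b` and a block conjugate to `D` (`gramDet_shear_conj`). The integrals over the row `b`
and then over `w` are of the form `∫ (A + |x|²)^{-s} dx` (`lintegral_pi_resolvent`). What remains is
the weight of `D` with the same `t` and one dimension less, times the factor
`|λ|^{2a} / (1 + |λ|²)^{t+1}`. The Jacobian `|det(λ - D)|²` is a function of the eigenvalues of `D`
and joins the test function, where it builds up the Vandermonde product. Test functions live on the
quotient of `ℂ^M` by permutations; that the eigenvalues are a measurable function of the matrix
(`measurable_eigenvalues`) holds because the elementary symmetric functions identify the quotient
σ-algebra with the Borel sets of `ℂ^M`.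

The constants come from Andréief's identity (`andreief`), since monomials are orthogonal for the
rotation invariant one-particle weight, with norms given by beta integrals (`lintegral_eigWeight`).

**Plasma.** By Jensen's formula the average of `-log` of the chordal distance over a circle of
latitude depends only on the larger of `cos (θ'/2) sin (θ/2)` and `cos (θ/2) sin (θ'/2)`. After
integration over the annulus, the background acts on a particle, up to an additive constant, like
charges `Q M` and `q M` at the poles (`exists_backgroundPotential_eq`), which are the one-particle
factors of the plasma weight (`exists_plasmaWeight_eq`). Under stereographic projection `v = -i z̄ u` and
`|u|² = 1/(1 + |z|²)` in the rescaled coordinate, so that the plasma weight becomes the eigenvalue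
weight (`plasmaWeight_eq`) once the area element `4R²/(1 + |z|²)²` is taken into account
(`map_sphereToPlane`).
-/

noncomputable section

namespace SphericalAnnulus

/-! ### Beta-type integrals over complex space -/

theorem lintegral_complex_radial (f : ℝ → ENNReal) (hf : Measurable f) :
    ∫⁻ z : ℂ, f ‖z‖ = ENNReal.ofReal (2 * π) * ∫⁻ r in Set.Ioi (0 : ℝ), ENNReal.ofReal r * f r := by
  rw [← Complex.lintegral_comp_polarCoord_symm, polarCoord_target,
    Measure.volume_eq_prod, ← Measure.prod_restrict]
  have h : ∀ p : ℝ × ℝ, p ∈ Set.Ioi (0 : ℝ) ×ˢ Set.Ioo (-π) π →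
      ENNReal.ofReal p.1 • f ‖Complex.polarCoord.symm p‖ = ENNReal.ofReal p.1 * f p.1 := by
    intro p hp
    rw [Complex.norm_polarCoord_symm, abs_of_pos hp.1, smul_eq_mul]
  rw [Measure.prod_restrict, setLIntegral_congr_fun (measurableSet_Ioi.prod measurableSet_Ioo) h,
    ← Measure.prod_restrict, lintegral_prod _ (by fun_prop)]
  simp only [lintegral_const, Measure.restrict_apply MeasurableSet.univ, Set.univ_inter,
    Real.volume_Ioo]
  rw [lintegral_mul_const _ (by fun_prop), mul_comm]
  congr 2
  ring

theorem integral_radial_resolvent {A : ℝ} (hA : 0 < A) (k : ℕ) :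
    IntegrableOn (fun r : ℝ => r / (A + r ^ 2) ^ (k + 2)) (Set.Ioi 0) ∧
      ∫ r in Set.Ioi (0 : ℝ), r / (A + r ^ 2) ^ (k + 2) = 1 / (2 * (k + 1) * A ^ (k + 1)) := by
  have hd : ∀ r : ℝ, HasDerivAt (fun r : ℝ => -(1 / (2 * (k + 1)) * ((A + r ^ 2) ^ (k + 1))⁻¹))
      (r / (A + r ^ 2) ^ (k + 2)) r := by
    intro r
    have h0 : A + r ^ 2 ≠ 0 := by positivity
    have h1 : HasDerivAt (fun r : ℝ => A + r ^ 2) (2 * r) r := by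
      simpa using (hasDerivAt_pow 2 r).const_add A
    refine (((h1.fun_pow (k + 1)).fun_inv (pow_ne_zero _ h0)).const_mul
      (1 / (2 * (k + 1) : ℝ))).fun_neg.congr_deriv ?_
    rw [Nat.add_sub_cancel]
    push_cast
    field_simp
    ring
  have ht : Filter.Tendsto (fun r : ℝ => -(1 / (2 * (k + 1)) * ((A + r ^ 2) ^ (k + 1))⁻¹))
      Filter.atTop (nhds 0) := by
    have h1 : Filter.Tendsto (fun r : ℝ => (A + r ^ 2) ^ (k + 1)) Filter.atTop Filter.atTop :=
      (Filter.tendsto_pow_atTop (by omega)).comp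
        (Filter.tendsto_atTop_add_const_left _ _ (Filter.tendsto_pow_atTop (by omega)))
    simpa using (h1.inv_tendsto_atTop.const_mul (1 / (2 * (k + 1) : ℝ))).neg
  have hn : ∀ r ∈ Set.Ioi (0 : ℝ), 0 ≤ r / (A + r ^ 2) ^ (k + 2) := by
    intro r hr
    have : 0 < r := hr
    positivity
  refine ⟨integrableOn_Ioi_deriv_of_nonneg' (fun r _ => hd r) hn ht, ?_⟩
  rw [integral_Ioi_of_hasDerivAt_of_nonneg' (fun r _ => hd r) hn ht]
  field_simp
  ring_nf

/-- The beta integral in polar form, by integration by parts in the first exponent. -/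
theorem integral_radial_beta (k l : ℕ) :
    IntegrableOn (fun r : ℝ => r * (r ^ (2 * k) / (1 + r ^ 2) ^ (k + l + 2))) (Set.Ioi 0) ∧
      ∫ r in Set.Ioi (0 : ℝ), r * (r ^ (2 * k) / (1 + r ^ 2) ^ (k + l + 2)) =
        (k.factorial : ℝ) * l.factorial / (2 * ((k + l + 1).factorial : ℝ)) := by
  induction k with
  | zero =>
    have := integral_radial_resolvent one_pos l
    simp only [mul_zero, pow_zero, zero_add, mul_one_div]
    refine ⟨this.1, this.2.trans ?_⟩
    rw [Nat.factorial_succ]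
    push_cast
    have : (l.factorial : ℝ) ≠ 0 := by positivity
    field_simp
    simp
  | succ k ih =>
    obtain ⟨ih1, ih2⟩ := ih
    set f := fun r : ℝ => r * (r ^ (2 * k) / (1 + r ^ 2) ^ (k + l + 2)) with hf
    set g := fun r : ℝ => r * (r ^ (2 * (k + 1)) / (1 + r ^ 2) ^ (k + 1 + l + 2)) with hg
    have hgi : IntegrableOn g (Set.Ioi 0) := by
      refine Integrable.mono' ih1 (by
        apply Measurable.aestronglyMeasurable; fun_prop) ?_
      filter_upwards [ae_restrict_mem measurableSet_Ioi] with r hr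
      have hr : 0 < r := hr
      rw [Real.norm_of_nonneg (by positivity)]
      have e : g r = f r * (r ^ 2 / (1 + r ^ 2)) := by
        simp only [hf, hg]
        field_simp
        ring
      rw [e]
      refine mul_le_of_le_one_right (by positivity) ?_
      rw [div_le_one (by positivity)]
      linarith
    refine ⟨hgi, ?_⟩
    have hd : ∀ r : ℝ, HasDerivAt (fun r : ℝ => r ^ (2 * k + 2) * ((1 + r ^ 2) ^ (k + l + 2))⁻¹)
        ((2 * (k + 1)) * f r - (2 * (k + l + 2)) * g r) r := by
      intro r
      have h0 : 1 + r ^ 2 ≠ 0 := by positivity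
      have h1 : HasDerivAt (fun r : ℝ => 1 + r ^ 2) (2 * r) r := by
        simpa using (hasDerivAt_pow 2 r).const_add 1
      refine ((hasDerivAt_pow (2 * k + 2) r).fun_mul
        ((h1.fun_pow (k + l + 2)).fun_inv (pow_ne_zero _ h0))).congr_deriv ?_
      rw [hf, hg]
      rw [show k + l + 2 - 1 = k + l + 1 by omega, show 2 * k + 2 - 1 = 2 * k + 1 by omega,
        show k + 1 + l + 2 = k + l + 3 by omega]
      push_cast
      field_simp
      ring
    have ht : Filter.Tendsto (fun r : ℝ => r ^ (2 * k + 2) * ((1 + r ^ 2) ^ (k + l + 2))⁻¹)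
        Filter.atTop (nhds 0) := by
      have h1 : Filter.Tendsto (fun r : ℝ => (1 + r ^ 2)⁻¹) Filter.atTop (nhds 0) :=
        (Filter.tendsto_atTop_add_const_left _ _
          (Filter.tendsto_pow_atTop (by omega))).inv_tendsto_atTop
      refine squeeze_zero (fun r => mul_nonneg (Even.pow_nonneg ⟨k + 1, by ring⟩ r)
        (by positivity)) (fun r => ?_) h1
      rw [← div_eq_mul_inv, div_le_iff₀ (by positivity), ← div_eq_inv_mul,
        le_div_iff₀ (by positivity)]
      calc r ^ (2 * k + 2) * (1 + r ^ 2) = (r ^ 2) ^ (k + 1) * (1 + r ^ 2) := by ring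
        _ ≤ (1 + r ^ 2) ^ (k + 1) * (1 + r ^ 2) := by gcongr; linarith
        _ = (1 + r ^ 2) ^ (k + 2) := by ring
        _ ≤ _ := by
          gcongr
          · nlinarith [sq_nonneg r]
          · omega
    have := integral_Ioi_of_hasDerivAt_of_tendsto' (a := 0) (fun r _ => hd r)
      ((ih1.const_mul _).sub (hgi.const_mul _)) ht
    rw [integral_sub (ih1.const_mul _) (hgi.const_mul _), integral_const_mul, integral_const_mul,
      show (∫ r in Set.Ioi (0 : ℝ), f r) = _ from ih2] at this
    rw [show k + 1 + l + 1 = (k + l + 1) + 1 by omega, Nat.factorial_succ k,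
      Nat.factorial_succ (k + l + 1)]
    push_cast
    have h2 : ((k + l + 1).factorial : ℝ) ≠ 0 := by positivity
    simp at this
    have h3 : ((k : ℝ) + l + 2) ≠ 0 := by positivity
    have h4 : (2 * ((k : ℝ) + l + 2)) * ∫ r in Set.Ioi (0 : ℝ), g r =
      (2 * ((k : ℝ) + l + 2)) * ((k + 1) * k.factorial * l.factorial /
        (2 * ((k + l + 1 + 1) * (k + l + 1).factorial))) := by
      rw [← sub_eq_zero.mp this]
      field_simp
      ring
    exact mul_left_cancel₀ (by positivity) h4

theorem lintegral_complex_resolvent {A : ℝ} (hA : 0 < A) (k : ℕ) :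
    ∫⁻ z : ℂ, ENNReal.ofReal (1 / (A + ‖z‖ ^ 2) ^ (k + 2)) =
      ENNReal.ofReal (π / ((k + 1) * A ^ (k + 1))) := by
  rw [lintegral_complex_radial (fun r => ENNReal.ofReal (1 / (A + r ^ 2) ^ (k + 2))) (by fun_prop)]
  obtain ⟨h1, h2⟩ := integral_radial_resolvent hA k
  rw [setLIntegral_congr_fun (g := fun r => ENNReal.ofReal (r / (A + r ^ 2) ^ (k + 2)))
    measurableSet_Ioi, ← ofReal_integral_eq_lintegral_ofReal h1, h2,
    ← ENNReal.ofReal_mul (by positivity)]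
  · congr 1
    field_simp
  · filter_upwards [ae_restrict_mem measurableSet_Ioi] with r hr
    have hr : 0 < r := hr
    positivity
  · intro r hr
    have hr : 0 < r := hr
    simp only
    rw [← ENNReal.ofReal_mul hr.le]
    congr 1
    ring

theorem lintegral_complex_beta (k l : ℕ) :
    ∫⁻ z : ℂ, ENNReal.ofReal (‖z‖ ^ (2 * k) / (1 + ‖z‖ ^ 2) ^ (k + l + 2)) =
      ENNReal.ofReal (π * (k.factorial * l.factorial / (k + l + 1).factorial)) := by
  rw [lintegral_complex_radial
    (fun r => ENNReal.ofReal (r ^ (2 * k) / (1 + r ^ 2) ^ (k + l + 2))) (by fun_prop)]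
  obtain ⟨h1, h2⟩ := integral_radial_beta k l
  rw [setLIntegral_congr_fun
    (g := fun r => ENNReal.ofReal (r * (r ^ (2 * k) / (1 + r ^ 2) ^ (k + l + 2))))
    measurableSet_Ioi, ← ofReal_integral_eq_lintegral_ofReal h1, h2,
    ← ENNReal.ofReal_mul (by positivity)]
  · congr 1
    field_simp
  · filter_upwards [ae_restrict_mem measurableSet_Ioi] with r hr
    have hr : 0 < r := hr
    positivity
  · intro r hr
    have hr : 0 < r := hr
    simp only
    rw [← ENNReal.ofReal_mul hr.le]

/-- Tonelli on a power of a measure space, splitting off the first coordinate. -/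
theorem lintegral_fin_cons {X : Type*} [MeasureSpace X] [SigmaFinite (volume : Measure X)] {m : ℕ}
    (f : (Fin (m + 1) → X) → ENNReal) (hf : Measurable f) :
    ∫⁻ x, f x = ∫⁻ z : X, ∫⁻ y : Fin m → X, f (Fin.cons z y) := by
  have h := (volume_preserving_piFinSuccAbove (fun _ : Fin (m + 1) => X) 0).symm
  rw [← h.lintegral_comp hf, Measure.volume_eq_prod, lintegral_prod _ (by fun_prop)]
  simp [MeasurableEquiv.piFinSuccAbove, Fin.insertNthEquiv, Fin.insertNth_zero']

/-- The integral over `ℂ^m` of a negative power of `A + |x|²`, one coordinate at a time. -/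
theorem lintegral_pi_resolvent {A : ℝ} (hA : 0 < A) (m t : ℕ) :
    ∫⁻ x : Fin m → ℂ, ENNReal.ofReal (1 / (A + ∑ i, ‖x i‖ ^ 2) ^ (m + t + 1)) =
      ENNReal.ofReal (π ^ m * t.factorial / (m + t).factorial / A ^ (t + 1)) := by
  induction m generalizing t with
  | zero =>
    have h : (t.factorial : ℝ) ≠ 0 := by positivity
    simp [h, volume_pi]
  | succ m ih =>
    rw [lintegral_fin_cons _ (by fun_prop), lintegral_lintegral_swap (by
      apply Measurable.aemeasurable
      simp only [Fin.sum_univ_succ, Fin.cons_zero, Fin.cons_succ, Function.uncurry_def]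
      fun_prop)]
    have h : ∀ y : Fin m → ℂ, ∫⁻ z : ℂ, ENNReal.ofReal (1 / (A + ∑ i, ‖(Fin.cons z y :
        Fin (m + 1) → ℂ) i‖ ^ 2) ^ (m + 1 + t + 1)) =
        ENNReal.ofReal (π / (m + t + 1)) *
          ENNReal.ofReal (1 / (A + ∑ i, ‖y i‖ ^ 2) ^ (m + t + 1)) := by
      intro y
      have := lintegral_complex_resolvent (A := A + ∑ i, ‖y i‖ ^ 2) (by positivity) (m + t)
      rw [← ENNReal.ofReal_mul (by positivity)]
      convert this using 3
      · rw [Fin.sum_univ_succ]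
        simp only [Fin.cons_zero, Fin.cons_succ]
        congr 2
        ring
      · push_cast
        field_simp
    simp_rw [h]
    rw [lintegral_const_mul _ (by fun_prop), ih, ← ENNReal.ofReal_mul (by positivity)]
    congr 1
    rw [show m + 1 + t = (m + t) + 1 by omega, Nat.factorial_succ]
    push_cast
    have : ((m + t).factorial : ℝ) ≠ 0 := by positivity
    field_simp
    ring

/-! ### The area formula with multiplicity -/

section Area

variable {E : Type*} [NormedAddCommGroup E] [NormedSpace ℝ E] [FiniteDimensional ℝ E]
  [MeasurableSpace E] [BorelSpace E] (μ : Measure E) [μ.IsAddHaarMeasure]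

/-- The set of regular points of a `C¹` map is a countable disjoint union of measurable sets on
each of which the map is injective. -/
theorem exists_measurable_partition_injOn {f : E → E} {f' : E → E →L[ℝ] E}
    (hf : ∀ x, HasStrictFDerivAt f (f' x) x) (hf' : Continuous f') :
    ∃ A : ℕ → Set E, (∀ i, MeasurableSet (A i)) ∧ Pairwise (Function.onFun Disjoint A) ∧
      (∀ i, Set.InjOn f (A i)) ∧ ⋃ i, A i = {x | (f' x).det ≠ 0} := by
  set S : Set E := {x | (f' x).det ≠ 0} with hS
  have hSo : IsOpen S := isOpen_ne_fun
    (ContinuousLinearMap.continuous_det.comp hf') continuous_const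
  have hU : ∀ x, ∃ U : Set E, IsOpen U ∧ Set.InjOn f U ∧ (x ∈ S → x ∈ U) := by
    intro x
    by_cases hx : x ∈ S
    · have h := hf x
      rw [← ContinuousLinearMap.coe_toContinuousLinearEquivOfDetNeZero (f' x) hx] at h
      exact ⟨(h.toOpenPartialHomeomorph f).source, (h.toOpenPartialHomeomorph f).open_source,
        (h.toOpenPartialHomeomorph f).injOn, fun _ => h.mem_toOpenPartialHomeomorph_source⟩
    · exact ⟨∅, isOpen_empty, Set.injOn_empty f, fun h => absurd h hx⟩
  choose U hUo hUi hUx using hU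
  obtain ⟨t, -, htc, hts⟩ := TopologicalSpace.countable_cover_nhdsWithin (s := S) (f := U)
    fun x hx => mem_nhdsWithin_of_mem_nhds ((hUo x).mem_nhds (hUx x hx))
  obtain ⟨g, hg⟩ := Set.countable_iff_exists_subset_range.mp htc
  refine ⟨fun i => S ∩ disjointed (U ∘ g) i, fun i => hSo.measurableSet.inter
    (MeasurableSet.disjointed (fun j => (hUo (g j)).measurableSet) i), fun i j hij => ?_,
    fun i => (hUi (g i)).mono (Set.inter_subset_right.trans (disjointed_subset _ i)), ?_⟩
  · exact (disjoint_disjointed (U ∘ g) hij).mono Set.inter_subset_right Set.inter_subset_right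
  · rw [← Set.inter_iUnion, iUnion_disjointed, Set.inter_eq_left]
    intro x hx
    obtain ⟨y, hy, hxy⟩ := Set.mem_iUnion₂.mp (hts hx)
    obtain ⟨i, rfl⟩ := hg hy
    exact Set.mem_iUnion.mpr ⟨i, hxy⟩

/-- The area formula for a `C¹` map between spaces of equal dimension: integrating against the
Jacobian counts each value with the number of its regular preimages. -/
theorem lintegral_abs_det_mul_comp {f : E → E} {f' : E → E →L[ℝ] E}
    (hf : ∀ x, HasStrictFDerivAt f (f' x) x) (hf' : Continuous f') {Φ : E → ENNReal}
    (hΦ : Measurable Φ) :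
    ∫⁻ x, ENNReal.ofReal |(f' x).det| * Φ (f x) ∂μ =
      ∫⁻ y, ({x | f x = y ∧ (f' x).det ≠ 0}.encard : ENNReal) * Φ y ∂μ := by
  obtain ⟨A, hAm, hAd, hAi, hAS⟩ := exists_measurable_partition_injOn hf hf'
  have hfc : Continuous f := continuous_iff_continuousAt.mpr fun x => (hf x).continuousAt
  have him : ∀ i, MeasurableSet (f '' A i) := fun i =>
    (hAm i).image_of_continuousOn_injOn hfc.continuousOn (hAi i)
  have hSm : MeasurableSet {x | (f' x).det ≠ 0} := hAS ▸ MeasurableSet.iUnion hAm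
  have h1 : ∫⁻ x, ENNReal.ofReal |(f' x).det| * Φ (f x) ∂μ =
      ∫⁻ x in ⋃ i, A i, ENNReal.ofReal |(f' x).det| * Φ (f x) ∂μ := by
    rw [hAS, ← lintegral_indicator hSm]
    refine lintegral_congr fun x => ?_
    by_cases hx : (f' x).det = 0 <;> simp [Set.indicator, hx]
  have h2 : ∀ y, ({x | f x = y ∧ (f' x).det ≠ 0}.encard : ENNReal) * Φ y =
      ∑' i, (f '' A i).indicator Φ y := by
    intro y
    have hset : {x | f x = y ∧ (f' x).det ≠ 0} = ⋃ i, (A i ∩ f ⁻¹' {y}) := by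
      rw [← Set.iUnion_inter, hAS]
      ext x
      simp [and_comm]
    have hm : ∀ i, MeasurableSet (A i ∩ f ⁻¹' {y}) := fun i =>
      (hAm i).inter (hfc.measurable (measurableSet_singleton y))
    rw [hset, ← Measure.count_apply (MeasurableSet.iUnion hm), measure_iUnion _ hm,
      ← ENNReal.tsum_mul_right]
    · refine tsum_congr fun i => ?_
      by_cases hy : y ∈ f '' A i
      · obtain ⟨x, hx, rfl⟩ := hy
        have : A i ∩ f ⁻¹' {f x} = {x} := by
          ext z
          refine ⟨fun hz => hAi i hz.1 hx hz.2, ?_⟩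
          rintro rfl
          exact ⟨hx, rfl⟩
        rw [this, Measure.count_singleton, one_mul,
          Set.indicator_of_mem (Set.mem_image_of_mem f hx)]
      · have : A i ∩ f ⁻¹' {y} = ∅ := by
          ext z
          simp only [Set.mem_inter_iff, Set.mem_preimage, Set.mem_singleton_iff,
            Set.mem_empty_iff_false, iff_false, not_and]
          exact fun hz hzy => hy ⟨z, hz, hzy⟩
        rw [this, measure_empty, zero_mul, Set.indicator_of_notMem hy]
    · exact fun i j hij => (hAd hij).mono Set.inter_subset_left Set.inter_subset_left
  rw [h1, lintegral_iUnion hAm hAd]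
  simp_rw [h2]
  rw [lintegral_tsum fun i => (hΦ.indicator (him i)).aemeasurable]
  refine tsum_congr fun i => ?_
  rw [lintegral_indicator (him i), lintegral_image_eq_lintegral_abs_det_fderiv_mul μ (hAm i)
    (fun x _ => (hf x).hasFDerivAt.hasFDerivWithinAt) (hAi i)]

/-- A continuous function that has countably many zeros on every ray from some point has a null
zero set: the dilates of the zero set about that point have proportional measures, while their
average over the dilation factor vanishes. -/
theorem measure_zeros_eq_zero {F : Type*} [TopologicalSpace F] [T1Space F] [Zero F] {f : E → F}
    (hf : Continuous f) (x₀ : E) (h : ∀ x, {t : ℝ | f (x₀ + t • x) = 0}.Countable) :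
    μ {x | f x = 0} = 0 := by
  have hZ : IsClosed {x | f x = 0} := isClosed_singleton.preimage hf
  have hm : MeasurableSet {p : ℝ × E | f (x₀ + p.1 • p.2) = 0} :=
    (isClosed_singleton.preimage (f := fun p : ℝ × E => f (x₀ + p.1 • p.2))
      (by fun_prop)).measurableSet
  have h0 : (volume.prod μ) {p : ℝ × E | f (x₀ + p.1 • p.2) = 0} = 0 := by
    rw [Measure.prod_apply_symm hm]
    simp only [Set.preimage_ofPred_eq]
    simp [fun x => (h x).measure_zero volume]
  rw [Measure.prod_apply hm, lintegral_eq_zero_iff (measurable_measure_prodMk_left hm)] at h0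
  obtain ⟨t, ht, ht1⟩ := (h0.and (Measure.ae_ne volume (0 : ℝ))).exists
  have hpre : Prod.mk t ⁻¹' {p : ℝ × E | f (x₀ + p.1 • p.2) = 0} =
      (fun x => t • x) ⁻¹' ((fun x => x₀ + x) ⁻¹' {x | f x = 0}) := rfl
  simp only [Pi.zero_apply] at ht
  rw [hpre, Measure.addHaar_preimage_smul μ ht1, measure_preimage_add] at ht
  simpa [ht1] using ht

end Area

/-! ### Generic matrices -/

/-- Lebesgue measure on complex arrays is a Haar measure; the iterated product is not unfolded by
instance search. -/
instance isAddHaarMeasure_volume_pi_pi {ι κ : Type*} [Fintype ι] [Fintype κ] :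
    (volume : Measure (ι → κ → ℂ)).IsAddHaarMeasure :=
  Measure.pi.isAddHaarMeasure fun _ => volume

section Generic

variable {ι : Type} [Fintype ι]

/-- The zero set of a nonzero polynomial in the matrix entries is a null set. -/
theorem ae_eval_mvPolynomial_ne_zero (p : MvPolynomial (ι × ι) ℂ) (x₀ : ι → ι → ℂ)
    (h₀ : MvPolynomial.eval (fun i => x₀ i.1 i.2) p ≠ 0) :
    ∀ᵐ x : ι → ι → ℂ, MvPolynomial.eval (fun i => x i.1 i.2) p ≠ 0 := by
  rw [ae_iff]
  simp only [not_not]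
  refine measure_zeros_eq_zero volume
    ((MvPolynomial.continuous_eval p).comp (by fun_prop)) x₀ fun x => ?_
  set q : Polynomial ℂ := MvPolynomial.eval₂ Polynomial.C
    (fun i : ι × ι => Polynomial.C (x₀ i.1 i.2) + Polynomial.X * Polynomial.C (x i.1 i.2)) p with hq
  have hqe : ∀ t : ℂ, q.eval t =
      MvPolynomial.eval (fun i : ι × ι => x₀ i.1 i.2 + t * x i.1 i.2) p := by
    intro t
    rw [hq, ← Polynomial.coe_evalRingHom, MvPolynomial.eval₂_comp_left, MvPolynomial.eval]
    simp only [MvPolynomial.coe_eval₂Hom]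
    congr 1
    · ext z; simp
    · ext i; simp; ring
  have hq0 : q ≠ 0 := by
    intro h
    apply h₀
    have := hqe 0
    rw [h] at this
    simpa using this.symm
  have hfin : {t : ℂ | q.IsRoot t}.Finite := Polynomial.finite_setOfPred_isRoot hq0
  refine ((hfin.preimage Complex.ofReal_injective.injOn).subset fun t ht => ?_).countable
  simp only [Set.mem_preimage, Set.mem_ofPred_eq, Polynomial.IsRoot.def] at ht ⊢
  rw [hqe, ← ht]
  simp

/-- A natural function of square matrices over commutative rings is a polynomial in the entries,
hence nonzero at almost every complex matrix once it is nonzero at one. -/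
theorem ae_natural_ne_zero (F : ∀ (R : Type) [CommRing R], Matrix ι ι R → R)
    (hF : ∀ (R S : Type) [CommRing R] [CommRing S] (φ : R →+* S) (A : Matrix ι ι R),
      F S (A.map φ) = φ (F R A)) (A₀ : Matrix ι ι ℂ) (h₀ : F ℂ A₀ ≠ 0) :
    ∀ᵐ x : ι → ι → ℂ, F ℂ (Matrix.of x) ≠ 0 := by
  have key : ∀ x : ι → ι → ℂ, F ℂ (Matrix.of x) =
      MvPolynomial.eval (fun i => x i.1 i.2) (F _ (Matrix.mvPolynomialX ι ι ℂ)) := by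
    intro x
    rw [← hF]
    congr 1
    ext i j
    simp [Matrix.mvPolynomialX]
  simp_rw [key]
  refine ae_eval_mvPolynomial_ne_zero _ (fun i j => A₀ i j) ?_
  rw [← key (fun i j => A₀ i j)]
  exact h₀

variable [DecidableEq ι]

/-- The matrix `q(A)` is invertible iff `q` has no zero among the eigenvalues of `A`. -/
theorem det_aeval_ne_zero_iff (A : Matrix ι ι ℂ) (q : Polynomial ℂ) :
    (Polynomial.aeval A q).det ≠ 0 ↔ ∀ μ, A.charpoly.IsRoot μ → q.eval μ ≠ 0 := by
  cases isEmpty_or_nonempty ι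
  · simp [Matrix.charpoly]
  · have h : (Polynomial.aeval A q).det = 0 ↔ (0 : ℂ) ∈ spectrum ℂ (Polynomial.aeval A q) := by
      rw [spectrum.zero_mem_iff, Matrix.isUnit_iff_isUnit_det, isUnit_iff_ne_zero, not_not]
    have hne : (spectrum ℂ A).Nonempty := by
      obtain ⟨μ, hμ⟩ := IsAlgClosed.exists_root A.charpoly (by
        rw [Matrix.charpoly_degree_eq_dim]
        exact_mod_cast Fintype.card_ne_zero)
      exact ⟨μ, Matrix.mem_spectrum_iff_isRoot_charpoly.mpr hμ⟩
    rw [Ne, h, spectrum.map_polynomial_aeval_of_nonempty A q hne]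
    simp [Matrix.mem_spectrum_iff_isRoot_charpoly]

/-- Almost every matrix `A` has simple eigenvalues: these are the matrices at which the derivative
`χ'` of the characteristic polynomial satisfies `det χ'(A) ≠ 0`, a polynomial condition on the
entries. -/
theorem ae_charpoly_roots_nodup : ∀ᵐ x : ι → ι → ℂ, (Matrix.of x).charpoly.roots.Nodup := by
  obtain ⟨d, hd⟩ : ∃ d : ι → ℂ, Function.Injective d :=
    ⟨_, (Nat.cast_injective (R := ℂ)).comp
      (Fin.val_injective.comp (Fintype.equivFin ι).injective)⟩
  have h := ae_natural_ne_zero (ι := ι)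
    (fun R _ A => (Polynomial.aeval A (Polynomial.derivative A.charpoly)).det)
    (fun R S _ _ φ A => by
      have h := Polynomial.map_aeval_eq_aeval_map (φ := φ) (ψ := φ.mapMatrix)
        (S := Matrix ι ι R) (U := Matrix ι ι S) (by
          ext r i j
          simp [Matrix.algebraMap_matrix_apply, apply_ite φ])
        (Polynomial.derivative A.charpoly) A
      simp only [RingHom.mapMatrix_apply] at h
      rw [Matrix.charpoly_map, Polynomial.derivative_map, ← h, RingHom.map_det,
        RingHom.mapMatrix_apply])
    (Matrix.diagonal d) (by
      rw [det_aeval_ne_zero_iff]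
      intro μ hμ hμ'
      have hs := Polynomial.separable_prod_X_sub_C_iff.mpr hd
      rw [← Matrix.charpoly_diagonal] at hs
      exact hs.eval₂_derivative_ne_zero (RingHom.id ℂ) hμ hμ')
  filter_upwards [h] with x hx
  rw [det_aeval_ne_zero_iff] at hx
  rw [Multiset.nodup_iff_count_le_one]
  intro μ
  rw [Polynomial.count_roots]
  by_contra! hlt
  have h1 := (Polynomial.one_lt_rootMultiplicity_iff_isRoot
    (Matrix.charpoly_monic (Matrix.of x)).ne_zero).mp hlt
  exact hx μ h1.1 h1.2

end Generic

/-- Almost every matrix has no eigenvector whose first coordinate vanishes, since the first row of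
its powers almost surely span the space. -/
theorem ae_eigenvector_zero_eq_zero (m : ℕ) : ∀ᵐ x : Fin (m + 1) → Fin (m + 1) → ℂ,
    ∀ (v : Fin (m + 1) → ℂ) (μ : ℂ), Matrix.of x *ᵥ v = μ • v → v 0 = 0 → v = 0 := by
  -- For the shift matrix the first rows of the powers are the standard basis.
  set S : Matrix (Fin (m + 1)) (Fin (m + 1)) ℂ :=
    Matrix.of fun i j => if (j : ℕ) = i + 1 then 1 else 0 with hS
  have hrow : ∀ k : ℕ, k < m + 1 → ∀ j : Fin (m + 1),
      (S ^ k) 0 j = if (j : ℕ) = k then 1 else 0 := by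
    intro k
    induction k with
    | zero =>
      intro _ j
      rw [pow_zero, Matrix.one_apply]
      simp only [Fin.ext_iff, Fin.val_zero, eq_comm]
    | succ k ih =>
      intro hk j
      rw [pow_succ, Matrix.mul_apply, Finset.sum_eq_single (⟨k, by omega⟩ : Fin (m + 1))]
      · rw [ih (by omega)]
        simp [hS]
      · intro b _ hb
        rw [ih (by omega), if_neg (fun h => hb (Fin.ext h)), zero_mul]
      · simp
  have h := ae_natural_ne_zero (ι := Fin (m + 1))
    (fun R _ A => (Matrix.of fun i j : Fin (m + 1) => (A ^ (i : ℕ)) 0 j).det)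
    (fun R S _ _ φ A => by
      rw [RingHom.map_det]
      congr 1
      ext i j
      simp only [Matrix.of_apply, RingHom.mapMatrix_apply, Matrix.map_apply]
      rw [← Matrix.map_pow, Matrix.map_apply])
    S (by
      have : (Matrix.of fun i j : Fin (m + 1) => (S ^ (i : ℕ)) 0 j) = 1 := by
        ext i j
        rw [Matrix.of_apply, hrow i i.2, Matrix.one_apply]
        simp only [Fin.ext_iff, eq_comm]
      rw [this, Matrix.det_one]
      exact one_ne_zero)
  filter_upwards [h] with x hx v μ hv hv0
  by_contra hne
  -- Such an eigenvector would be annihilated by the first rows of all powers.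
  refine hx (Matrix.exists_mulVec_eq_zero_iff.mp ⟨v, hne, ?_⟩)
  have hpow : ∀ k : ℕ, Matrix.of x ^ k *ᵥ v = μ ^ k • v := by
    intro k
    induction k with
    | zero => simp
    | succ k ih => rw [pow_succ, ← Matrix.mulVec_mulVec, hv, Matrix.mulVec_smul, ih, smul_smul,
        pow_succ']
  ext i
  have := congrFun (hpow i) 0
  simp only [Pi.smul_apply, hv0, smul_zero] at this
  exact this

/-! ### Deflation: splitting off an eigenvalue -/

section Bordered

variable {n : Type*}

/-- The block matrix with corner `a`, first row `b`, first column `d` and remaining block `D`. -/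
def bordered (a : ℂ) (b d : n → ℂ) (D : Matrix n n ℂ) : Matrix (Unit ⊕ n) (Unit ⊕ n) ℂ :=
  Matrix.fromBlocks (Matrix.of fun _ _ => a) (Matrix.replicateRow Unit b)
    (Matrix.replicateCol Unit d) D

theorem one_eq_bordered [DecidableEq n] :
    (1 : Matrix (Unit ⊕ n) (Unit ⊕ n) ℂ) = bordered 1 0 0 1 := by
  rw [bordered, ← Matrix.fromBlocks_one]
  congr 1

variable [Fintype n]

theorem bordered_mulVec (a : ℂ) (b d : n → ℂ) (D : Matrix n n ℂ) (x : ℂ) (v : n → ℂ) :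
    bordered a b d D *ᵥ Sum.elim (fun _ => x) v =
      Sum.elim (fun _ => a * x + b ⬝ᵥ v) (x • d + D *ᵥ v) := by
  rw [bordered, Matrix.fromBlocks_mulVec]
  ext (i | i)
  · simp [Matrix.mulVec, dotProduct]
  · simp [Matrix.mulVec, dotProduct, mul_comm]

theorem bordered_mul (a a' : ℂ) (b d b' d' : n → ℂ) (D D' : Matrix n n ℂ) :
    bordered a b d D * bordered a' b' d' D' =
      bordered (a * a' + b ⬝ᵥ d') (a • b' + b ᵥ* D') (a' • d + D *ᵥ d')
        (Matrix.vecMulVec d b' + D * D') := by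
  rw [bordered, bordered, bordered, Matrix.fromBlocks_multiply]
  congr 1
  · ext i j; simp [Matrix.mul_apply, dotProduct]
  · ext i j; simp [Matrix.mul_apply, Matrix.vecMul, dotProduct]
  · ext i j; simp [Matrix.mul_apply, Matrix.mulVec, dotProduct, mul_comm]
  · ext i j; simp [Matrix.mul_apply, Matrix.vecMulVec_apply]

/-- The column `d` that makes `(1, w)` an eigenvector of `bordered a b d D`. -/
def eigenColumn (a : ℂ) (b : n → ℂ) (D : Matrix n n ℂ) (w : n → ℂ) : n → ℂ :=
  (a + b ⬝ᵥ w) • w - D *ᵥ w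

theorem bordered_mulVec_eigen_iff (a : ℂ) (b d : n → ℂ) (D : Matrix n n ℂ) (w : n → ℂ) (μ : ℂ) :
    bordered a b d D *ᵥ Sum.elim (fun _ => 1) w = μ • Sum.elim (fun _ => 1) w ↔
      a + b ⬝ᵥ w = μ ∧ eigenColumn a b D w = d := by
  rw [bordered_mulVec]
  constructor
  · intro h
    have h1 : a + b ⬝ᵥ w = μ := by simpa using congrFun h (Sum.inl ())
    refine ⟨h1, ?_⟩
    ext i
    have h2 := congrFun h (Sum.inr i)
    simp only [Sum.elim_inr, one_smul, Pi.add_apply, Pi.smul_apply] at h2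
    rw [eigenColumn, h1, Pi.sub_apply, Pi.smul_apply, ← h2]
    ring
  · rintro ⟨rfl, rfl⟩
    ext (i | i) <;> simp [eigenColumn]

variable [DecidableEq n]

theorem det_bordered_zero_col (a : ℂ) (b : n → ℂ) (D : Matrix n n ℂ) :
    (bordered a b 0 D).det = a * D.det := by
  rw [bordered, show Matrix.replicateCol Unit (0 : n → ℂ) = 0 by ext; simp,
    Matrix.det_fromBlocks_zero₂₁]
  simp

theorem det_bordered_zero_row (a : ℂ) (d : n → ℂ) (D : Matrix n n ℂ) :
    (bordered a 0 d D).det = a * D.det := by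
  rw [bordered, show Matrix.replicateRow Unit (0 : n → ℂ) = 0 by ext; simp,
    Matrix.det_fromBlocks_zero₁₂]
  simp

theorem charpoly_bordered_zero_col (a : ℂ) (b : n → ℂ) (D : Matrix n n ℂ) :
    (bordered a b 0 D).charpoly = (Polynomial.X - Polynomial.C a) * D.charpoly := by
  rw [bordered, show Matrix.replicateCol Unit (0 : n → ℂ) = 0 by ext; simp,
    Matrix.charpoly_fromBlocks_zero₂₁]
  congr 1
  simp [Matrix.charpoly]

/-- The elementary lower triangular matrix whose first column is `(1, w)`. -/
def shear (w : n → ℂ) : Matrix (Unit ⊕ n) (Unit ⊕ n) ℂ := bordered 1 0 w 1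

theorem det_shear (w : n → ℂ) : (shear w).det = 1 := by
  rw [shear, det_bordered_zero_row, Matrix.det_one, mul_one]

theorem shear_mul_shear_neg (w : n → ℂ) : shear w * shear (-w) = 1 := by
  rw [shear, shear, bordered_mul, one_eq_bordered]
  congr 1 <;> simp

/-- If `(1, w)` is an eigenvector, conjugation by `shear w` is block triangular. -/
theorem bordered_eigenColumn (a : ℂ) (b w : n → ℂ) (D : Matrix n n ℂ) :
    bordered a b (eigenColumn a b D w) D =
      shear w * bordered (a + b ⬝ᵥ w) b 0 (D - Matrix.vecMulVec w b) * shear (-w) := by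
  rw [shear, shear, bordered_mul, bordered_mul]
  congr 1
  · simp
  · simp
  · simp [eigenColumn, Matrix.mulVec_neg, sub_eq_add_neg]
  · simp

theorem charpoly_shear_conj (w : n → ℂ) (A : Matrix (Unit ⊕ n) (Unit ⊕ n) ℂ) :
    (shear w * A * shear (-w)).charpoly = A.charpoly := by
  have h : shear (-w) * shear w = 1 := by simpa using shear_mul_shear_neg (-w)
  rw [← Matrix.charpoly_units_conj ⟨shear w, shear (-w), shear_mul_shear_neg w, h⟩ A]
  simp only [Matrix.inv_eq_right_inv (shear_mul_shear_neg w)]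

/-- For a generic matrix the affine eigenvectors `(1, w)` correspond to the eigenvalues. Here
`w ↦ a + b ⬝ᵥ w` is the eigenvalue, and the nonvanishing determinant says that it is not an
eigenvalue of the deflated block, which is automatic when the eigenvalues are simple. -/
theorem encard_eigenColumn_fiber (a : ℂ) (b d : n → ℂ) (D : Matrix n n ℂ)
    (h1 : (bordered a b d D).charpoly.roots.Nodup)
    (h2 : ∀ (v : Unit ⊕ n → ℂ) (μ : ℂ),
      bordered a b d D *ᵥ v = μ • v → v (Sum.inl ()) = 0 → v = 0) :
    {w | eigenColumn a b D w = d ∧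
      ((a + b ⬝ᵥ w) • (1 : Matrix n n ℂ) - (D - Matrix.vecMulVec w b)).det ≠ 0}.encard =
      Fintype.card n + 1 := by
  set G := bordered a b d D with hG
  have hcp : ∀ w, eigenColumn a b D w = d → G.charpoly =
      (Polynomial.X - Polynomial.C (a + b ⬝ᵥ w)) * (D - Matrix.vecMulVec w b).charpoly := by
    rintro w rfl
    rw [hG, bordered_eigenColumn, charpoly_shear_conj, charpoly_bordered_zero_col]
  have hinj : Set.InjOn (fun w => a + b ⬝ᵥ w) {w | eigenColumn a b D w = d ∧
      ((a + b ⬝ᵥ w) • (1 : Matrix n n ℂ) - (D - Matrix.vecMulVec w b)).det ≠ 0} := by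
    intro w hw w' hw' hww
    have e1 := (bordered_mulVec_eigen_iff a b d D w _).mpr ⟨rfl, hw.1⟩
    have e2 := (bordered_mulVec_eigen_iff a b d D w' _).mpr ⟨hww.symm, hw'.1⟩
    have := h2 (Sum.elim (fun _ => 1) w - Sum.elim (fun _ => 1) w') _
      (by rw [Matrix.mulVec_sub, e1, e2, smul_sub]) (by simp)
    ext i
    simpa [sub_eq_zero] using congrFun this (Sum.inr i)
  have himg : (fun w => a + b ⬝ᵥ w) '' {w | eigenColumn a b D w = d ∧
      ((a + b ⬝ᵥ w) • (1 : Matrix n n ℂ) - (D - Matrix.vecMulVec w b)).det ≠ 0} =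
      (G.charpoly.roots.toFinset : Set ℂ) := by
    have hne := (Matrix.charpoly_monic G).ne_zero
    ext μ
    simp only [Set.mem_image, Finset.mem_coe, Multiset.mem_toFinset, Polynomial.mem_roots hne]
    constructor
    · rintro ⟨w, hw, rfl⟩
      rw [hcp w hw.1]
      simp
    · intro hμ
      obtain ⟨v, hv0, hv⟩ : ∃ v, v ≠ 0 ∧ G *ᵥ v = μ • v := by
        rw [Polynomial.IsRoot.def, Matrix.eval_charpoly] at hμ
        obtain ⟨v, hv0, hv⟩ := Matrix.exists_mulVec_eq_zero_iff.mpr hμ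
        refine ⟨v, hv0, ?_⟩
        rw [Matrix.sub_mulVec, sub_eq_zero] at hv
        rw [← hv]
        simp
      have hv1 : v (Sum.inl ()) ≠ 0 := fun h => hv0 (h2 v μ hv h)
      set w : n → ℂ := fun i => (v (Sum.inl ()))⁻¹ * v (Sum.inr i) with hw
      have hvw : (v (Sum.inl ()))⁻¹ • v = Sum.elim (fun _ => 1) w := by
        ext (i | i)
        · simp [hv1]
        · simp [hw]
      have hGw : G *ᵥ Sum.elim (fun _ => 1) w = μ • Sum.elim (fun _ => 1) w := by
        rw [← hvw, Matrix.mulVec_smul, hv, smul_comm]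
      obtain ⟨e1, e2⟩ := (bordered_mulVec_eigen_iff a b d D w μ).mp hGw
      refine ⟨w, ⟨e2, ?_⟩, e1⟩
      have hroots := hcp w e2
      rw [hroots, Polynomial.roots_mul (hroots ▸ hne), Polynomial.roots_X_sub_C] at h1
      have h3 := (Multiset.nodup_cons.mp h1).1
      rw [Polynomial.mem_roots (Matrix.charpoly_monic _).ne_zero, Polynomial.IsRoot.def,
        Matrix.eval_charpoly] at h3
      rwa [Matrix.scalar_apply, ← Matrix.smul_one_eq_diagonal] at h3
  rw [← hinj.encard_image, himg, Set.encard_coe_eq_coe_finsetCard,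
    Multiset.toFinset_card_of_nodup h1, IsAlgClosed.card_roots_eq_natDegree,
    Matrix.charpoly_natDegree_eq_dim, Fintype.card_sum]
  push_cast
  rw [Fintype.card_unit, add_comm]
  rfl

end Bordered

/-- `bordered` with the index set `Fin (m + 1)`. -/
def finBordered {m : ℕ} (a : ℂ) (b d : Fin m → ℂ) (D : Fin m → Fin m → ℂ) :
    Fin (m + 1) → Fin (m + 1) → ℂ :=
  Fin.cons (Fin.cons a b) fun i => Fin.cons (d i) (D i)

/-- The bijection of index sets relating `finBordered` and `bordered`. -/
def finSuccEquivSum (m : ℕ) : Fin (m + 1) ≃ Unit ⊕ Fin m where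
  toFun := Fin.cons (Sum.inl ()) Sum.inr
  invFun := Sum.elim (fun _ => 0) Fin.succ
  left_inv i := by cases i using Fin.cases <;> simp
  right_inv i := by rcases i with i | i <;> simp

theorem of_finBordered {m : ℕ} (a : ℂ) (b d : Fin m → ℂ) (D : Fin m → Fin m → ℂ) :
    Matrix.of (finBordered a b d D) =
      Matrix.reindex (finSuccEquivSum m).symm (finSuccEquivSum m).symm
        (bordered a b d (Matrix.of D)) := by
  ext i j
  cases i using Fin.cases <;> cases j using Fin.cases <;>
    simp [finBordered, bordered, finSuccEquivSum]

theorem measurePreserving_finCons (X : Type*) [MeasureSpace X] [SigmaFinite (volume : Measure X)]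
    (m : ℕ) : MeasurePreserving
      (fun p : X × (Fin m → X) => (Fin.cons p.1 p.2 : Fin (m + 1) → X)) volume volume := by
  have e : (fun p : X × (Fin m → X) => (Fin.cons p.1 p.2 : Fin (m + 1) → X)) =
      (MeasurableEquiv.piFinSuccAbove (fun _ : Fin (m + 1) => X) 0).symm := by
    ext p
    simp [MeasurableEquiv.piFinSuccAbove, Fin.insertNthEquiv]
  rw [e]
  exact (volume_preserving_piFinSuccAbove (fun _ : Fin (m + 1) => X) 0).symm

/-- The rearrangement of factors that groups the first row and the remaining rows of a bordered
matrix. -/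
theorem measurePreserving_shuffle (A B C D : Type*) [MeasureSpace A] [MeasureSpace B]
    [MeasureSpace C] [MeasureSpace D] [SFinite (volume : Measure A)] [SFinite (volume : Measure B)]
    [SFinite (volume : Measure C)] [SFinite (volume : Measure D)] :
    MeasurePreserving (fun q : (A × (B × C)) × D => ((q.1.2.1, q.1.1), (q.2, q.1.2.2)))
      volume volume := by
  have s1 := volume_preserving_prodAssoc (α₁ := A) (β₁ := B × C) (γ₁ := D)
  have s2 := volume_preserving_prodAssoc (α₁ := B) (β₁ := C) (γ₁ := D)
  have s3 : MeasurePreserving (Prod.swap : C × D → D × C) volume volume :=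
    Measure.measurePreserving_swap
  have s4 := (volume_preserving_prodAssoc (α₁ := A) (β₁ := B) (γ₁ := D × C)).symm
  have s5 : MeasurePreserving (Prod.swap : A × B → B × A) volume volume :=
    Measure.measurePreserving_swap
  have i1 := MeasurePreserving.id (volume : Measure A)
  have i2 := MeasurePreserving.id (volume : Measure B)
  have i3 := MeasurePreserving.id (volume : Measure (D × C))
  have e2 : MeasurePreserving (Prod.map id Prod.swap : B × (C × D) → B × (D × C))
    volume volume := i2.prod s3
  have e4 : MeasurePreserving (Prod.map Prod.swap id : (A × B) × (D × C) → _)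
    volume volume := s5.prod i3
  exact e4.comp (s4.comp ((i1.prod e2).comp ((i1.prod s2).comp s1)))

theorem measurePreserving_finBordered (m : ℕ) : MeasurePreserving
    (fun q : ((Fin m → ℂ) × (ℂ × (Fin m → Fin m → ℂ))) × (Fin m → ℂ) =>
      finBordered q.1.2.1 q.1.1 q.2 q.1.2.2) volume volume := by
  have h1 := measurePreserving_finCons (Fin (m + 1) → ℂ) m
  have h2 := measurePreserving_finCons ℂ m
  have h3 := (volume_measurePreserving_arrowProdEquivProdArrow ℂ (Fin m → ℂ) (Fin m)).symm
  have h4 := volume_preserving_pi (fun _ : Fin m => h2)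
  have h5 := h1.comp (h2.prod (h4.comp h3))
  exact h5.comp (measurePreserving_shuffle (Fin m → ℂ) ℂ (Fin m → Fin m → ℂ) (Fin m → ℂ))

/-- Almost every bordered matrix has simple eigenvalues and no eigenvector with vanishing first
coordinate. -/
theorem ae_generic_bordered (m : ℕ) :
    ∀ᵐ q : ((Fin m → ℂ) × (ℂ × (Fin m → Fin m → ℂ))) × (Fin m → ℂ),
      (bordered q.1.2.1 q.1.1 q.2 (Matrix.of q.1.2.2)).charpoly.roots.Nodup ∧
      ∀ (v : Unit ⊕ Fin m → ℂ) (μ : ℂ),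
        bordered q.1.2.1 q.1.1 q.2 (Matrix.of q.1.2.2) *ᵥ v = μ • v →
          v (Sum.inl ()) = 0 → v = 0 := by
  have h1 := (measurePreserving_finBordered m).quasiMeasurePreserving.ae
    (ae_charpoly_roots_nodup (ι := Fin (m + 1)))
  have h2 := (measurePreserving_finBordered m).quasiMeasurePreserving.ae
    (ae_eigenvector_zero_eq_zero m)
  filter_upwards [h1, h2] with q hq1 hq2
  rw [of_finBordered] at hq1 hq2
  rw [Matrix.charpoly_reindex] at hq1
  refine ⟨hq1, fun v μ hv hv0 => ?_⟩
  have := hq2 (v ∘ finSuccEquivSum m) μ (by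
    rw [Matrix.reindex_apply, Matrix.submatrix_mulVec_equiv]
    simp only [Equiv.symm_symm]
    rw [Function.comp_assoc, Equiv.self_comp_symm, Function.comp_id, hv]
    rfl) hv0
  ext i
  simpa using congrFun this ((finSuccEquivSum m).symm i)

section

variable {n : Type*} [Fintype n] [DecidableEq n]

/-- The real determinant of a complex linear map is the squared modulus of the complex one. -/
theorem det_restrictScalars_toLin' (A : Matrix n n ℂ) :
    LinearMap.det ((Matrix.toLin' A).restrictScalars ℝ) = ‖A.det‖ ^ 2 := by
  rw [LinearMap.det_restrictScalars, LinearMap.det_toLin', Algebra.norm_complex_apply,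
    Complex.normSq_eq_norm_sq]

/-- The derivative of `eigenColumn`, as a complex matrix. -/
def eigenColumnDeriv (a : ℂ) (b : n → ℂ) (D : Matrix n n ℂ) (w : n → ℂ) : Matrix n n ℂ :=
  (a + b ⬝ᵥ w) • 1 - (D - Matrix.vecMulVec w b)

theorem hasStrictFDerivAt_eigenColumn (a : ℂ) (b : n → ℂ) (D : Matrix n n ℂ) (w : n → ℂ) :
    HasStrictFDerivAt (eigenColumn a b D)
      (LinearMap.toContinuousLinearMap
        ((Matrix.toLin' (eigenColumnDeriv a b D w)).restrictScalars ℝ)) w := by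
  have hb : HasStrictFDerivAt (𝕜 := ℝ) (fun w : n → ℂ => a + b ⬝ᵥ w)
      (LinearMap.toContinuousLinearMap
        ((dotProductBilin ℂ ℂ b).restrictScalars ℝ)) w :=
    (LinearMap.toContinuousLinearMap
        ((dotProductBilin ℂ ℂ b).restrictScalars ℝ)).hasStrictFDerivAt.const_add a
  have hD : HasStrictFDerivAt (𝕜 := ℝ) (fun w : n → ℂ => D *ᵥ w)
      (LinearMap.toContinuousLinearMap
        ((Matrix.toLin' D).restrictScalars ℝ)) w :=
    (LinearMap.toContinuousLinearMap
        ((Matrix.toLin' D).restrictScalars ℝ)).hasStrictFDerivAt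
  refine ((hb.smul (hasStrictFDerivAt_id w)).sub hD).congr_fderiv ?_
  ext x i
  simp [eigenColumnDeriv, Matrix.vecMulVec_mulVec]
  ring

end

/-- The array of entries, indexed by `Fin (m + 1)`, of a matrix indexed by `Unit ⊕ Fin m`. -/
def flatten {m : ℕ} (A : Matrix (Unit ⊕ Fin m) (Unit ⊕ Fin m) ℂ) : Fin (m + 1) → Fin (m + 1) → ℂ :=
  fun i j => A (finSuccEquivSum m i) (finSuccEquivSum m j)

theorem of_flatten {m : ℕ} (A : Matrix (Unit ⊕ Fin m) (Unit ⊕ Fin m) ℂ) :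
    Matrix.of (flatten A) =
      Matrix.reindex (finSuccEquivSum m).symm (finSuccEquivSum m).symm A := rfl

theorem finBordered_eq_flatten {m : ℕ} (a : ℂ) (b d : Fin m → ℂ) (D : Fin m → Fin m → ℂ) :
    finBordered a b d D = flatten (bordered a b d (Matrix.of D)) :=
  of_finBordered a b d D

theorem continuous_flatten {m : ℕ} : Continuous (flatten (m := m)) := by
  unfold flatten
  fun_prop

theorem Continuous.bordered {X n : Type*} [TopologicalSpace X] {a : X → ℂ} {b d : X → n → ℂ}
    {D : X → Matrix n n ℂ} (ha : Continuous a) (hb : Continuous b) (hd : Continuous d)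
    (hD : Continuous D) : Continuous fun x => bordered (a x) (b x) (d x) (D x) := by
  unfold SphericalAnnulus.bordered
  exact Continuous.matrix_fromBlocks (continuous_matrix fun _ _ => ha)
    (continuous_matrix fun _ j => (continuous_apply j).comp hb)
    (continuous_matrix fun i _ => (continuous_apply i).comp hd) hD

theorem continuous_matrix_of {X n : Type*} [TopologicalSpace X] {D : X → n → n → ℂ}
    (hD : Continuous D) : Continuous fun x => Matrix.of (D x) := hD

/-- The matrix with eigenvalue `x.1` and eigenvector `(1, w)`, whose compression to the quotient by
that eigenvector is `x.2`. -/
def inflate {m : ℕ} (w : Fin m → ℂ) (x : ℂ × (Fin m → Fin m → ℂ)) (b : Fin m → ℂ) :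
    Fin (m + 1) → Fin (m + 1) → ℂ :=
  flatten (shear w * bordered x.1 b 0 (Matrix.of x.2) * shear (-w))

theorem continuous_inflate {m : ℕ} :
    Continuous fun q : (Fin m → ℂ) × (ℂ × (Fin m → Fin m → ℂ)) × (Fin m → ℂ) =>
      inflate q.1 q.2.1 q.2.2 := by
  unfold inflate shear
  refine continuous_flatten.comp (((Continuous.bordered continuous_const continuous_const
    (by fun_prop) continuous_const).matrix_mul (Continuous.bordered (by fun_prop) (by fun_prop)
    continuous_const (continuous_matrix_of (by fun_prop)))).matrix_mul
    (Continuous.bordered continuous_const continuous_const (by fun_prop) continuous_const))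

/-- The Jacobian of the deflation, `|det(λ - D)|²` for an eigenvalue `λ` and deflated block `D`. -/
def deflationJacobian {m : ℕ} (x : ℂ × (Fin m → Fin m → ℂ)) : ENNReal :=
  ENNReal.ofReal (‖(x.1 • (1 : Matrix (Fin m) (Fin m) ℂ) - Matrix.of x.2).det‖ ^ 2)

theorem measurable_deflationJacobian {m : ℕ} : Measurable (deflationJacobian (m := m)) := by
  unfold deflationJacobian
  refine ENNReal.measurable_ofReal.comp (Continuous.measurable ?_)
  have : Continuous fun x : ℂ × (Fin m → Fin m → ℂ) =>
      x.1 • (1 : Matrix (Fin m) (Fin m) ℂ) - Matrix.of x.2 :=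
    (continuous_fst.smul continuous_const).sub (continuous_matrix_of continuous_snd)
  exact (this.matrix_det.norm).pow 2

theorem measurable_deflation_integrand {m : ℕ}
    {Φ : (Fin (m + 1) → Fin (m + 1) → ℂ) → ENNReal} (hΦ : Measurable Φ) :
    Measurable fun q : (Fin m → ℂ) × (ℂ × (Fin m → Fin m → ℂ)) × (Fin m → ℂ) =>
      deflationJacobian q.2.1 * Φ (inflate q.1 q.2.1 q.2.2) :=
  (measurable_deflationJacobian.comp (by fun_prop)).mul (hΦ.comp continuous_inflate.measurable)

/-- The coordinates of `bordered a b d D`, with `d = eigenColumn a b D w`, in terms of `x = (a, D)`: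
this matrix equals `inflate w (deflate w b x) b`. For fixed `w` and `b` it is a translation. -/
def deflate {m : ℕ} (w b : Fin m → ℂ) (x : ℂ × (Fin m → Fin m → ℂ)) : ℂ × (Fin m → Fin m → ℂ) :=
  x + (b ⬝ᵥ w, fun i j => -(w i * b j))

theorem deflate_eq {m : ℕ} (w b : Fin m → ℂ) (a : ℂ) (D : Fin m → Fin m → ℂ) :
    Matrix.of (deflate w b (a, D)).2 = Matrix.of D - Matrix.vecMulVec w b := by
  ext i j
  simp [deflate, Matrix.vecMulVec_apply, sub_eq_add_neg]

theorem continuous_toContinuousLinearMap_toLin' (n : Type*) [Fintype n] [DecidableEq n] :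
    Continuous fun A : Matrix n n ℂ =>
      LinearMap.toContinuousLinearMap ((Matrix.toLin' A).restrictScalars ℝ) := by
  let L : Matrix n n ℂ →ₗ[ℝ] ((n → ℂ) →L[ℝ] (n → ℂ)) :=
    { toFun := fun A => LinearMap.toContinuousLinearMap ((Matrix.toLin' A).restrictScalars ℝ)
      map_add' := fun A B => by ext x i; simp
      map_smul' := fun c A => by ext x i; simp [Matrix.smul_mulVec] }
  exact L.continuous_of_finiteDimensional

/-- The area formula for the map from the eigenvector `(1, w)` to the first column, with the other
entries of the matrix fixed. -/
theorem lintegral_bordered_eigenColumn {m : ℕ} (a : ℂ) (b : Fin m → ℂ) (D : Fin m → Fin m → ℂ)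
    {Φ : (Fin (m + 1) → Fin (m + 1) → ℂ) → ENNReal} (hΦ : Measurable Φ)
    (hg : ∀ᵐ d : Fin m → ℂ, (bordered a b d (Matrix.of D)).charpoly.roots.Nodup ∧
      ∀ (v : Unit ⊕ Fin m → ℂ) (μ : ℂ),
        bordered a b d (Matrix.of D) *ᵥ v = μ • v → v (Sum.inl ()) = 0 → v = 0) :
    (m + 1) * ∫⁻ d, Φ (finBordered a b d D) =
      ∫⁻ w, deflationJacobian (deflate w b (a, D)) * Φ (inflate w (deflate w b (a, D)) b) := by
  have hm : Measurable fun d => Φ (finBordered a b d D) := by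
    simp_rw [finBordered_eq_flatten]
    exact hΦ.comp (continuous_flatten.comp (Continuous.bordered continuous_const continuous_const
      continuous_id continuous_const)).measurable
  rw [← lintegral_const_mul _ hm]
  have h1 : ∀ᵐ d : Fin m → ℂ, (m + 1) * Φ (finBordered a b d D) =
      ({w | eigenColumn a b (Matrix.of D) w = d ∧ (LinearMap.toContinuousLinearMap
        ((Matrix.toLin' (eigenColumnDeriv a b (Matrix.of D) w)).restrictScalars ℝ)).det ≠
          0}.encard : ENNReal) * Φ (finBordered a b d D) := by
    filter_upwards [hg] with d hd
    have := encard_eigenColumn_fiber a b d (Matrix.of D) hd.1 hd.2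
    rw [Fintype.card_fin] at this
    congr 1
    rw [← ENat.toENNReal_coe m, ← ENat.toENNReal_one, ← ENat.toENNReal_add, ← this]
    congr 2
    ext w
    simp only [Set.mem_ofPred_eq, ContinuousLinearMap.det, LinearMap.coe_toContinuousLinearMap,
      det_restrictScalars_toLin', eigenColumnDeriv]
    simp
  rw [lintegral_congr_ae h1, ← lintegral_abs_det_mul_comp volume
    (hasStrictFDerivAt_eigenColumn a b (Matrix.of D)) _ hm]
  · refine lintegral_congr fun w => ?_
    rw [finBordered_eq_flatten, bordered_eigenColumn]
    simp only [ContinuousLinearMap.det, LinearMap.coe_toContinuousLinearMap,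
      det_restrictScalars_toLin', eigenColumnDeriv]
    rw [abs_of_nonneg (by positivity), deflationJacobian, inflate, deflate_eq]
    rfl
  · have : Continuous fun w => eigenColumnDeriv a b (Matrix.of D) w := by
      unfold eigenColumnDeriv
      fun_prop
    exact (continuous_toContinuousLinearMap_toLin' (Fin m)).comp this

theorem continuous_deflate {m : ℕ} :
    Continuous fun q : ((Fin m → ℂ) × (ℂ × (Fin m → Fin m → ℂ))) × (Fin m → ℂ) =>
      deflate q.2 q.1.1 q.1.2 := by
  unfold deflate
  fun_prop

theorem measurable_deflate {m : ℕ} :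
    Measurable fun q : ((Fin m → ℂ) × (ℂ × (Fin m → Fin m → ℂ))) × (Fin m → ℂ) =>
      deflate q.2 q.1.1 q.1.2 :=
  continuous_deflate.measurable

theorem measurable_deflate_prodMk {m : ℕ} :
    Measurable fun q : ((Fin m → ℂ) × (ℂ × (Fin m → Fin m → ℂ))) × (Fin m → ℂ) =>
      (q.2, deflate q.2 q.1.1 q.1.2, q.1.1) :=
  measurable_snd.prodMk (measurable_deflate.prodMk (measurable_fst.comp measurable_fst))

theorem measurable_deflate_integrand {m : ℕ}
    {Φ : (Fin (m + 1) → Fin (m + 1) → ℂ) → ENNReal} (hΦ : Measurable Φ) :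
    Measurable fun q : ((Fin m → ℂ) × (ℂ × (Fin m → Fin m → ℂ))) × (Fin m → ℂ) =>
      deflationJacobian (deflate q.2 q.1.1 q.1.2) *
        Φ (inflate q.2 (deflate q.2 q.1.1 q.1.2) q.1.1) := by
  have h := (measurable_deflation_integrand hΦ).comp measurable_deflate_prodMk
  exact h

theorem measurable_section_left {A B C : Type*} [MeasurableSpace A] [MeasurableSpace B]
    [MeasurableSpace C] {f : A × B → C} (hf : Measurable f) (a : A) :
    Measurable fun b => f (a, b) :=
  hf.comp measurable_prodMk_left

theorem measurable_section_right {A B C : Type*} [MeasurableSpace A] [MeasurableSpace B]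
    [MeasurableSpace C] {f : A × B → C} (hf : Measurable f) (b : B) :
    Measurable fun a => f (a, b) :=
  hf.comp measurable_prodMk_right

theorem lintegral_deflate {m : ℕ} (w : Fin m → ℂ)
    {Ψ : ℂ × (Fin m → Fin m → ℂ) → (Fin m → ℂ) → ENNReal} (h : Measurable (Function.uncurry Ψ))
    (h' : Measurable fun p : (Fin m → ℂ) × (ℂ × (Fin m → Fin m → ℂ)) =>
      Ψ (deflate w p.1 p.2) p.1) :
    ∫⁻ p : (Fin m → ℂ) × (ℂ × (Fin m → Fin m → ℂ)), Ψ (deflate w p.1 p.2) p.1 =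
      ∫⁻ x, ∫⁻ b, Ψ x b := by
  rw [Measure.volume_eq_prod (Fin m → ℂ) (ℂ × (Fin m → Fin m → ℂ)),
    lintegral_prod _ h'.aemeasurable, lintegral_lintegral_swap h.aemeasurable]
  refine lintegral_congr fun b => ?_
  have : (volume : Measure (ℂ × (Fin m → Fin m → ℂ))).IsAddRightInvariant := by
    have := Measure.IsAddHaarMeasure.toIsAddLeftInvariant
      (μ := (volume : Measure (Fin m → Fin m → ℂ)))
    rw [Measure.volume_eq_prod]
    infer_instance
  exact lintegral_add_right_eq_self (μ := (volume : Measure (ℂ × (Fin m → Fin m → ℂ))))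
    (fun x => Ψ x b) (b ⬝ᵥ w, fun i j => -(w i * b j))

/-- The deflation formula: integration over matrices of size `m + 1` in the coordinates consisting
of an eigenvalue, the matching eigenvector `(1, w)`, and the block triangular form. Each generic
matrix occurs once for every one of its `m + 1` eigenvalues. -/
theorem lintegral_deflation (m : ℕ) {Φ : (Fin (m + 1) → Fin (m + 1) → ℂ) → ENNReal}
    (hΦ : Measurable Φ) :
    (m + 1) * ∫⁻ G, Φ G = ∫⁻ w : Fin m → ℂ, ∫⁻ x : ℂ × (Fin m → Fin m → ℂ), ∫⁻ b : Fin m → ℂ,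
      deflationJacobian x * Φ (inflate w x b) := by
  have hmp := measurePreserving_finBordered m
  have hm : Measurable fun q : ((Fin m → ℂ) × (ℂ × (Fin m → Fin m → ℂ))) × (Fin m → ℂ) =>
    Φ (finBordered q.1.2.1 q.1.1 q.2 q.1.2.2) := hΦ.comp hmp.measurable
  have hs := measurable_deflate_integrand hΦ
  rw [← hmp.lintegral_comp hΦ, Measure.volume_eq_prod, lintegral_prod _ hm.aemeasurable,
    ← lintegral_const_mul _ hm.lintegral_prod_right']
  have h1 : ∀ᵐ p : (Fin m → ℂ) × (ℂ × (Fin m → Fin m → ℂ)), (m + 1) *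
      ∫⁻ d : Fin m → ℂ, Φ (finBordered p.2.1 p.1 d p.2.2) = ∫⁻ w,
        deflationJacobian (deflate w p.1 p.2) * Φ (inflate w (deflate w p.1 p.2) p.1) := by
    filter_upwards [Measure.ae_ae_of_ae_prod (ae_generic_bordered m)] with p hp
    exact lintegral_bordered_eigenColumn p.2.1 p.1 p.2.2 hΦ hp
  rw [lintegral_congr_ae h1, lintegral_lintegral_swap hs.aemeasurable]
  refine lintegral_congr fun w => ?_
  exact lintegral_deflate (Ψ := fun x b => deflationJacobian x * Φ (inflate w x b)) w
    (measurable_section_left (measurable_deflation_integrand hΦ) w) (measurable_section_right hs w)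

/-! ### The Gram weight in the deflated coordinates -/

section Gram

open scoped ComplexOrder

variable {n : Type*}

theorem conjTranspose_bordered (a : ℂ) (b d : n → ℂ) (D : Matrix n n ℂ) :
    (bordered a b d D)ᴴ = bordered (star a) (star d) (star b) Dᴴ := by
  rw [bordered, Matrix.fromBlocks_conjTranspose]
  rfl

variable [Fintype n]

/-- The norm of `(1, w)`. -/
def affineNorm (w : n → ℂ) : ℝ := √(1 + ∑ i, ‖w i‖ ^ 2)

theorem affineNorm_sq (w : n → ℂ) : affineNorm w ^ 2 = 1 + ∑ i, ‖w i‖ ^ 2 :=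
  Real.sq_sqrt (by positivity)

theorem affineNorm_pos (w : n → ℂ) : 0 < affineNorm w := Real.sqrt_pos.mpr (by positivity)

theorem star_dotProduct_self (w : n → ℂ) : star w ⬝ᵥ w = ((affineNorm w ^ 2 - 1 : ℝ) : ℂ) := by
  rw [affineNorm_sq, dotProduct]
  push_cast
  rw [add_sub_cancel_left]
  refine Finset.sum_congr rfl fun i _ => ?_
  rw [Pi.star_apply, Complex.star_def, mul_comm, Complex.mul_conj, Complex.normSq_eq_norm_sq]
  push_cast
  rfl

variable [DecidableEq n]

/-- The real number `det (1 + AᴴA)`. -/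
def gramDet (A : Matrix n n ℂ) : ℝ := (1 + Aᴴ * A).det.re

theorem posDef_one_add_gram (A : Matrix n n ℂ) : (1 + Aᴴ * A).PosDef :=
  Matrix.PosDef.one.add_posSemidef (Matrix.posSemidef_conjTranspose_mul_self A)

theorem ofReal_gramDet (A : Matrix n n ℂ) : (gramDet A : ℂ) = (1 + Aᴴ * A).det := by
  have h := (Complex.pos_iff.mp (posDef_one_add_gram A).det_pos).2
  exact Complex.ext (by simp [gramDet]) (by simpa using h)

theorem gramDet_pos (A : Matrix n n ℂ) : 0 < gramDet A :=
  (Complex.pos_iff.mp (posDef_one_add_gram A).det_pos).1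

theorem re_det_gram (A : Matrix n n ℂ) : (Aᴴ * A).det.re = ‖A.det‖ ^ 2 := by
  rw [Matrix.det_mul, Matrix.det_conjTranspose, Complex.star_def, mul_comm, Complex.mul_conj,
    Complex.ofReal_re, Complex.normSq_eq_norm_sq]

theorem continuous_gramDet : Continuous (gramDet (n := n)) := by
  unfold gramDet
  fun_prop

theorem gramDet_reindex {k : Type*} [Fintype k] [DecidableEq k] (e : n ≃ k) (A : Matrix n n ℂ) :
    gramDet (Matrix.reindex e e A) = gramDet A := by
  rw [gramDet, gramDet, ← Matrix.det_reindex_self e (1 + Aᴴ * A)]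
  congr 2
  simp [Matrix.submatrix_add, Matrix.submatrix_mul_equiv]

theorem gramDet_conj_of_mul_conjTranspose {V : Matrix n n ℂ} (hV : Vᴴ * V = 1) (A : Matrix n n ℂ) :
    gramDet (V * A * Vᴴ) = gramDet A := by
  have hV' : V * Vᴴ = 1 := mul_eq_one_comm.mp hV
  have h : 1 + (V * A * Vᴴ)ᴴ * (V * A * Vᴴ) = V * (1 + Aᴴ * A) * Vᴴ := by
    rw [Matrix.conjTranspose_mul, Matrix.conjTranspose_mul, Matrix.conjTranspose_conjTranspose,
      Matrix.mul_add, Matrix.add_mul, mul_one, hV']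
    congr 1
    calc V * (Aᴴ * Vᴴ) * (V * A * Vᴴ) = V * Aᴴ * (Vᴴ * V) * A * Vᴴ := by noncomm_ring
      _ = _ := by rw [hV]; noncomm_ring
  rw [gramDet, gramDet, h, Matrix.det_mul, Matrix.det_mul, mul_right_comm, ← Matrix.det_mul, hV',
    Matrix.det_one, one_mul]

/-- The Gram determinant of a conjugate `L T L⁻¹` depends on `L` only through `LᴴL`. -/
theorem gramDet_conj_eq {L L' R R' T T' : Matrix n n ℂ} (hL : L * L' = 1) (hR : R * R' = 1)
    (h : Rᴴ * R = Lᴴ * L) (hT : T' * R = R * T) : gramDet (L * T * L') = gramDet T' := by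
  have hL' : L' * L = 1 := mul_eq_one_comm.mp hL
  set V := R * L' with hV
  have h1 : Vᴴ * V = 1 := by
    calc Vᴴ * V = L'ᴴ * (Rᴴ * R) * L' := by
          rw [hV, Matrix.conjTranspose_mul]; noncomm_ring
      _ = (L * L')ᴴ * (L * L') := by rw [h, Matrix.conjTranspose_mul]; noncomm_ring
      _ = 1 := by rw [hL]; simp
  have h2 : V * Vᴴ = 1 := mul_eq_one_comm.mp h1
  have h3 : V * (L * R') = 1 := by
    calc V * (L * R') = R * (L' * L) * R' := by rw [hV]; noncomm_ring
      _ = 1 := by rw [hL', mul_one, hR]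
  have h4 : Vᴴ = L * R' := by
    calc Vᴴ = Vᴴ * (V * (L * R')) := by rw [h3, mul_one]
      _ = L * R' := by rw [← mul_assoc, h1, one_mul]
  rw [← gramDet_conj_of_mul_conjTranspose h1]
  congr 1
  calc V * (L * T * L') * Vᴴ = R * (L' * L) * T * (L' * L) * R' := by
        rw [h4, hV]; noncomm_ring
    _ = T' := by rw [hL', mul_one, mul_one, ← hT, mul_assoc, hR, mul_one]

/-- The Hermitian square root of `1 - w wᴴ / (1 + wᴴw)`. -/
def reflector (w : n → ℂ) : Matrix n n ℂ :=
  1 - ((affineNorm w * (affineNorm w + 1))⁻¹ : ℂ) • Matrix.vecMulVec w (star w)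

theorem det_reflector (w : n → ℂ) : (reflector w).det = ((affineNorm w)⁻¹ : ℂ) := by
  have h := Matrix.det_one_add_replicateCol_mul_replicateRow (ι := Unit)
    (-((affineNorm w * (affineNorm w + 1))⁻¹ : ℂ) • w) (star w)
  rw [dotProduct_smul, star_dotProduct_self] at h
  have h1 : (affineNorm w : ℂ) ≠ 0 := by exact_mod_cast (affineNorm_pos w).ne'
  have h2 : (affineNorm w + 1 : ℂ) ≠ 0 := by
    exact_mod_cast (add_pos (affineNorm_pos w) one_pos).ne'
  convert h using 1
  · congr 1
    rw [reflector, sub_eq_add_neg]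
    congr 1
    ext i j
    simp [Matrix.mul_apply, Matrix.vecMulVec_apply]
    ring
  · push_cast
    rw [smul_eq_mul]
    generalize (affineNorm w : ℂ) = ρ at h1 h2
    field_simp
    ring

theorem conjTranspose_reflector (w : n → ℂ) : (reflector w)ᴴ = reflector w := by
  ext i j
  simp [reflector, Matrix.vecMulVec_apply, Matrix.one_apply, eq_comm, mul_comm]

theorem reflector_mul_self (w : n → ℂ) :
    reflector w * reflector w = 1 - ((affineNorm w ^ 2)⁻¹ : ℂ) • Matrix.vecMulVec w (star w) := by
  have h1 : (affineNorm w : ℂ) ≠ 0 := by exact_mod_cast (affineNorm_pos w).ne'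
  have h2 : (affineNorm w + 1 : ℂ) ≠ 0 := by
    exact_mod_cast (add_pos (affineNorm_pos w) one_pos).ne'
  have h3 : Matrix.vecMulVec w (star w) * Matrix.vecMulVec w (star w) =
      ((affineNorm w : ℂ) ^ 2 - 1) • Matrix.vecMulVec w (star w) := by
    rw [Matrix.vecMulVec_mul_vecMulVec, star_dotProduct_self]
    push_cast
    ext i j
    simp [Matrix.vecMulVec_apply]
    ring
  rw [reflector, mul_sub, sub_mul, sub_mul, one_mul, mul_one, one_mul, smul_mul_smul_comm, h3,
    smul_smul]
  set E := Matrix.vecMulVec w (star w)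
  generalize (affineNorm w : ℂ) = ρ at h1 h2
  have : (ρ ^ 2)⁻¹ = 2 * (ρ * (ρ + 1))⁻¹ - (ρ * (ρ + 1))⁻¹ * (ρ * (ρ + 1))⁻¹ * (ρ ^ 2 - 1) := by
    field_simp
    ring
  rw [this]
  module

/-- The block Cholesky factor of the Gram matrix of `shear w`. -/
def choleskyFactor (w : n → ℂ) : Matrix (Unit ⊕ n) (Unit ⊕ n) ℂ :=
  bordered (affineNorm w) (((affineNorm w)⁻¹ : ℂ) • star w) 0 (reflector w)

theorem choleskyFactor_gram (w : n → ℂ) :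
    (choleskyFactor w)ᴴ * choleskyFactor w = (shear w)ᴴ * shear w := by
  have h1 : (affineNorm w : ℂ) ≠ 0 := by exact_mod_cast (affineNorm_pos w).ne'
  rw [choleskyFactor, shear, conjTranspose_bordered, conjTranspose_bordered, bordered_mul,
    bordered_mul, conjTranspose_reflector, reflector_mul_self]
  congr 1
  · simp [star_dotProduct_self]
    ring
  · simp [smul_smul, h1]
  · simp [smul_smul, h1]
  · ext i j
    simp [Matrix.vecMulVec_apply]
    field_simp
    ring

theorem det_choleskyFactor (w : n → ℂ) : (choleskyFactor w).det = 1 := by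
  have h1 : (affineNorm w : ℂ) ≠ 0 := by exact_mod_cast (affineNorm_pos w).ne'
  rw [choleskyFactor, det_bordered_zero_col, det_reflector, mul_inv_cancel₀ h1]

/-- In the Gram determinant of a block triangular matrix conjugated by a shear, the shear can be
absorbed by an affine change of the row and a conjugation of the block. -/
theorem gramDet_shear_conj (w b : n → ℂ) (a : ℂ) (D : Matrix n n ℂ) :
    gramDet (shear w * bordered a b 0 D * shear (-w)) =
      gramDet (bordered a (b ᵥ* ((affineNorm w : ℂ) • (reflector w)⁻¹) +
        ((affineNorm w)⁻¹ : ℂ) • (star w ᵥ* (D - a • 1)) ᵥ* (reflector w)⁻¹) 0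
        (reflector w * D * (reflector w)⁻¹)) := by
  have h1 : (affineNorm w : ℂ) ≠ 0 := by exact_mod_cast (affineNorm_pos w).ne'
  have hu : IsUnit (reflector w).det := by
    rw [det_reflector]
    exact (inv_ne_zero h1).isUnit
  have hR : choleskyFactor w * (choleskyFactor w)⁻¹ = 1 :=
    Matrix.mul_nonsing_inv _ (by rw [det_choleskyFactor]; exact isUnit_one)
  refine gramDet_conj_eq (shear_mul_shear_neg w) hR (choleskyFactor_gram w) ?_
  rw [choleskyFactor, bordered_mul, bordered_mul]
  congr 1
  · simp [mul_comm]
  · have e1 : b ᵥ* ((affineNorm w : ℂ) • (reflector w)⁻¹) ᵥ* reflector w =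
        (affineNorm w : ℂ) • b := by
      rw [Matrix.vecMul_vecMul, Matrix.smul_mul, Matrix.nonsing_inv_mul _ hu, Matrix.vecMul_smul,
        Matrix.vecMul_one]
    have e2 : (((affineNorm w)⁻¹ : ℂ) • (star w ᵥ* (D - a • 1)) ᵥ* (reflector w)⁻¹) ᵥ* reflector w =
        ((affineNorm w)⁻¹ : ℂ) • (star w ᵥ* (D - a • 1)) := by
      rw [Matrix.smul_vecMul, Matrix.vecMul_vecMul, Matrix.nonsing_inv_mul _ hu, Matrix.vecMul_one]
    rw [Matrix.add_vecMul, e1, e2, Matrix.vecMul_sub, Matrix.smul_vecMul, Matrix.vecMul_smul,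
      Matrix.vecMul_one]
    module
  · simp
  · rw [mul_assoc, Matrix.nonsing_inv_mul _ hu]
    simp

end Gram

section Gram

open scoped ComplexOrder MatrixOrder Matrix.Norms.L2Operator in
theorem posSemidef_one_add_gram {n : Type*} [Fintype n] [DecidableEq n] (A : Matrix n n ℂ) :
    (1 + Aᴴ * A).PosSemidef := (posDef_one_add_gram A).posSemidef

open scoped ComplexOrder MatrixOrder Matrix.Norms.L2Operator in
theorem exists_conjTranspose_mul_self_eq {n : Type*} [Fintype n] [DecidableEq n]
    {A : Matrix n n ℂ} (hA : Matrix.PosSemidef A) : ∃ C : Matrix n n ℂ, A = Cᴴ * C :=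
  CStarAlgebra.nonneg_iff_eq_star_mul_self.mp hA.nonneg

variable {n : Type*} [Fintype n] [DecidableEq n]

/-- With `1 + DᴴD = CᴴC`, the substitution `b = √(1 + |a|²) x C` for the row of a block triangular
matrix factorizes the Gram determinant. -/
theorem gramDet_bordered {D C : Matrix n n ℂ} (hC : 1 + Dᴴ * D = Cᴴ * C) (a : ℂ) (x : n → ℂ) :
    gramDet (bordered a (x ᵥ* ((√(1 + ‖a‖ ^ 2) : ℂ) • C)) 0 D) =
      (1 + ‖a‖ ^ 2) * gramDet D * (1 + ∑ i, ‖x i‖ ^ 2) := by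
  set k : ℂ := (√(1 + ‖a‖ ^ 2) : ℂ) with hk
  have hk2 : k * k = 1 + star a * a := by
    rw [hk, ← Complex.ofReal_mul, Real.mul_self_sqrt (by positivity), Complex.star_def,
      mul_comm (starRingEnd ℂ a), Complex.mul_conj, Complex.normSq_eq_norm_sq]
    push_cast
    rfl
  have hk0 : k ≠ 0 := by
    rw [hk]
    exact_mod_cast (Real.sqrt_pos.mpr (by positivity)).ne'
  have hks : star k = k := by rw [hk, Complex.star_def, Complex.conj_ofReal]
  set y : n → ℂ := x ᵥ* C with hy
  have hb : x ᵥ* (k • C) = k • y := Matrix.vecMul_smul _ _ _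
  have hxx : x ⬝ᵥ star x = ((∑ i, ‖x i‖ ^ 2 : ℝ) : ℂ) := by
    rw [dotProduct]
    push_cast
    refine Finset.sum_congr rfl fun i _ => ?_
    rw [Pi.star_apply, Complex.star_def, Complex.mul_conj, Complex.normSq_eq_norm_sq]
    push_cast
    rfl
  have h1 : 1 + (bordered a (k • y) 0 D)ᴴ * bordered a (k • y) 0 D =
      bordered 1 0 ((a * k⁻¹) • star y) 1 *
        bordered (k * k) ((star a * k) • y) 0 (Cᴴ * (1 + Matrix.vecMulVec (star x) x) * C) := by
    have e : Cᴴ * (1 + Matrix.vecMulVec (star x) x) * C =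
        1 + Dᴴ * D + Matrix.vecMulVec (star y) y := by
      rw [mul_add, add_mul, mul_one, ← hC, Matrix.mul_vecMulVec, Matrix.vecMulVec_mul,
        Matrix.mulVec_conjTranspose, star_star]
    rw [e, conjTranspose_bordered, bordered_mul, bordered_mul, one_eq_bordered]
    unfold bordered
    rw [Matrix.fromBlocks_add]
    congr 1
    · ext i j; simp [hk2]
    · ext i j; simp [mul_assoc]
    · ext i j; simp [hks]; field_simp
    · ext i j
      simp [Matrix.vecMulVec_apply, hks]
      have e2 : (starRingEnd ℂ) a * k * (a * k⁻¹ * ((starRingEnd ℂ) (y i) * y j)) =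
          (k * k - 1) * ((starRingEnd ℂ) (y i) * y j) := by
        rw [hk2, Complex.star_def]
        field_simp
        ring
      rw [e2]
      ring
  have h2 : (1 + Matrix.vecMulVec (star x) x).det = 1 + ((∑ i, ‖x i‖ ^ 2 : ℝ) : ℂ) := by
    rw [← hxx, ← Matrix.det_one_add_replicateCol_mul_replicateRow (ι := Unit)]
    congr 2
    ext i j
    simp [Matrix.mul_apply, Matrix.vecMulVec_apply]
  have h3 : (C.det * star C.det) = gramDet D := by
    rw [ofReal_gramDet, hC, Matrix.det_mul, Matrix.det_conjTranspose, mul_comm]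
  have h4 : (gramDet (bordered a (k • y) 0 D) : ℂ) =
      (((1 + ‖a‖ ^ 2) * gramDet D * (1 + ∑ i, ‖x i‖ ^ 2) : ℝ) : ℂ) := by
    rw [ofReal_gramDet, h1, Matrix.det_mul, det_bordered_zero_row, det_bordered_zero_col,
      Matrix.det_mul, Matrix.det_mul, h2, Matrix.det_one, Matrix.det_conjTranspose]
    push_cast
    rw [← h3, hk, ← Complex.ofReal_mul, Real.mul_self_sqrt (by positivity)]
    push_cast
    ring
  rw [hb]
  exact_mod_cast h4

end Gram

/-! ### Integration over the row and the block -/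

theorem lintegral_linearMap_comp {E : Type*} [NormedAddCommGroup E] [NormedSpace ℝ E]
    [FiniteDimensional ℝ E] [MeasurableSpace E] [BorelSpace E] (μ : Measure E)
    [μ.IsAddHaarMeasure] (L : E →ₗ[ℝ] E) (hL : LinearMap.det L ≠ 0) {f : E → ENNReal}
    (hf : Measurable f) :
    ∫⁻ x, f (L x) ∂μ = ENNReal.ofReal |(LinearMap.det L)⁻¹| * ∫⁻ x, f x ∂μ := by
  have hLm : Measurable L := L.continuous_of_finiteDimensional.measurable
  rw [← lintegral_map hf hLm, Measure.map_linearMap_addHaar_eq_smul_addHaar μ hL,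
    lintegral_smul_measure, smul_eq_mul]

/-- Right multiplication of row vectors by a complex matrix, as a real linear map. -/
def vecMulReal {m : ℕ} (A : Matrix (Fin m) (Fin m) ℂ) : (Fin m → ℂ) →ₗ[ℝ] (Fin m → ℂ) :=
  (Matrix.toLin' Aᵀ).restrictScalars ℝ

theorem vecMulReal_apply {m : ℕ} (A : Matrix (Fin m) (Fin m) ℂ) (x : Fin m → ℂ) :
    vecMulReal A x = x ᵥ* A := by
  simp [vecMulReal, Matrix.mulVec_transpose]

theorem det_vecMulReal {m : ℕ} (A : Matrix (Fin m) (Fin m) ℂ) :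
    LinearMap.det (vecMulReal A) = ‖A.det‖ ^ 2 := by
  rw [vecMulReal, det_restrictScalars_toLin', Matrix.det_transpose]

theorem lintegral_vecMul_add {m : ℕ} {A : Matrix (Fin m) (Fin m) ℂ} (hA : A.det ≠ 0)
    (c : Fin m → ℂ) {f : (Fin m → ℂ) → ENNReal} (hf : Measurable f) :
    ∫⁻ x, f (x ᵥ* A + c) = ENNReal.ofReal ((‖A.det‖ ^ 2)⁻¹) * ∫⁻ x, f x := by
  have hd : LinearMap.det (vecMulReal A) ≠ 0 := by
    rw [det_vecMulReal]
    positivity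
  have h := lintegral_linearMap_comp volume (vecMulReal A) hd
    (f := fun x => f (x + c)) (hf.comp (measurable_add_const c))
  simp only [vecMulReal_apply] at h
  rw [h, lintegral_add_right_eq_self f c, det_vecMulReal, abs_of_nonneg (by positivity)]

/-- Right multiplication of square arrays by a complex matrix, as a real linear map. -/
def mulRightReal {m : ℕ} (A : Matrix (Fin m) (Fin m) ℂ) :
    (Fin m → Fin m → ℂ) →ₗ[ℝ] (Fin m → Fin m → ℂ) :=
  LinearMap.pi fun i => vecMulReal A ∘ₗ LinearMap.proj i

theorem of_mulRightReal {m : ℕ} (A : Matrix (Fin m) (Fin m) ℂ) (D : Fin m → Fin m → ℂ) :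
    Matrix.of (mulRightReal A D) = Matrix.of D * A := by
  ext i j
  simp [mulRightReal, vecMulReal_apply, Matrix.vecMul, dotProduct, Matrix.mul_apply]

theorem det_mulRightReal {m : ℕ} (A : Matrix (Fin m) (Fin m) ℂ) :
    LinearMap.det (mulRightReal A) = (‖A.det‖ ^ 2) ^ m := by
  rw [mulRightReal, LinearMap.det_pi]
  simp [det_vecMulReal]

/-- Transposition of square arrays. -/
def swapReal (m : ℕ) : (Fin m → Fin m → ℂ) ≃ₗ[ℝ] (Fin m → Fin m → ℂ) :=
  LinearEquiv.ofInvolutive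
    { toFun := fun D i j => D j i
      map_add' := fun _ _ => rfl
      map_smul' := fun _ _ => rfl } fun _ => rfl

/-- Conjugation by an invertible matrix preserves Lebesgue measure on matrices. -/
theorem lintegral_conj {m : ℕ} {B : Matrix (Fin m) (Fin m) ℂ} (hB : B.det ≠ 0)
    {f : (Fin m → Fin m → ℂ) → ENNReal} (hf : Measurable f) :
    ∫⁻ D, f (fun i j => (B * Matrix.of D * B⁻¹ : Matrix (Fin m) (Fin m) ℂ) i j) = ∫⁻ D, f D := by
  set L := ((swapReal m).toLinearMap ∘ₗ mulRightReal Bᵀ ∘ₗ (swapReal m).symm.toLinearMap) ∘ₗ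
    mulRightReal B⁻¹ with hL
  have hLd : LinearMap.det L = 1 := by
    rw [hL, LinearMap.det_comp, LinearMap.det_conj, det_mulRightReal, det_mulRightReal,
      Matrix.det_transpose, Matrix.det_nonsing_inv, Ring.inverse_eq_inv', norm_inv, ← mul_pow,
      ← mul_pow, mul_inv_cancel₀ (norm_ne_zero_iff.mpr hB), one_pow, one_pow]
  have hLa : ∀ D, L D = fun i j => (B * Matrix.of D * B⁻¹ : Matrix (Fin m) (Fin m) ℂ) i j := by
    intro D
    have h1 : ∀ X : Fin m → Fin m → ℂ,
        Matrix.of ((swapReal m) (mulRightReal Bᵀ ((swapReal m).symm X))) = B * Matrix.of X := by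
      intro X
      have := of_mulRightReal Bᵀ ((swapReal m).symm X)
      have h2 : Matrix.of ((swapReal m).symm X) = (Matrix.of X)ᵀ := rfl
      rw [h2, ← Matrix.transpose_mul] at this
      exact congrArg Matrix.transpose this
    have h3 := h1 (mulRightReal B⁻¹ D)
    rw [of_mulRightReal, ← mul_assoc] at h3
    exact h3
  have h := lintegral_linearMap_comp volume L (by rw [hLd]; exact one_ne_zero) hf
  simp only [hLa, hLd, inv_one, abs_one, ENNReal.ofReal_one, one_mul] at h
  exact h

/-- Integration of the Gram determinant of a block triangular matrix over its row. -/
theorem lintegral_gramDet_bordered {m : ℕ} (t : ℕ) (a : ℂ) (D : Matrix (Fin m) (Fin m) ℂ) :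
    ∫⁻ b : Fin m → ℂ, ENNReal.ofReal (1 / gramDet (bordered a b 0 D) ^ (m + t + 1)) =
      ENNReal.ofReal (π ^ m * t.factorial / (m + t).factorial) *
        ENNReal.ofReal (1 / (1 + ‖a‖ ^ 2) ^ (t + 1) * (1 / gramDet D ^ (m + t))) := by
  obtain ⟨C, hC⟩ := exists_conjTranspose_mul_self_eq (posSemidef_one_add_gram D)
  have hg := gramDet_pos D
  have hCd : ‖C.det‖ ^ 2 = gramDet D := by rw [← re_det_gram, ← hC, gramDet]
  set k : ℝ := √(1 + ‖a‖ ^ 2) with hk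
  have hk2 : k ^ 2 = 1 + ‖a‖ ^ 2 := Real.sq_sqrt (by positivity)
  have hk0 : 0 < k := Real.sqrt_pos.mpr (by positivity)
  have hdet : ‖((k : ℂ) • C).det‖ ^ 2 = (1 + ‖a‖ ^ 2) ^ m * gramDet D := by
    rw [Matrix.det_smul, norm_mul, mul_pow, hCd, norm_pow, Complex.norm_real,
      Real.norm_of_nonneg hk0.le, Fintype.card_fin, ← pow_mul, mul_comm m 2, pow_mul, hk2]
  have hd0 : ((k : ℂ) • C).det ≠ 0 := by
    intro h
    have hp : 0 < (1 + ‖a‖ ^ 2) ^ m * gramDet D := by positivity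
    rw [← hdet, h] at hp
    simp at hp
  have hm : Measurable fun b : Fin m → ℂ =>
      ENNReal.ofReal (1 / gramDet (bordered a b 0 D) ^ (m + t + 1)) := by
    have : Continuous fun b : Fin m → ℂ => gramDet (bordered a b 0 D) :=
      continuous_gramDet.comp (Continuous.bordered continuous_const continuous_id continuous_const
        continuous_const)
    exact ENNReal.measurable_ofReal.comp (measurable_const.div (this.measurable.pow_const _))
  have h := lintegral_vecMul_add hd0 0 hm
  have hx : ∀ x : Fin m → ℂ, ENNReal.ofReal
      (1 / gramDet (bordered a (x ᵥ* ((k : ℂ) • C) + 0) 0 D) ^ (m + t + 1)) =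
      ENNReal.ofReal (1 / ((1 + ‖a‖ ^ 2) * gramDet D) ^ (m + t + 1)) *
        ENNReal.ofReal (1 / (1 + ∑ i, ‖x i‖ ^ 2) ^ (m + t + 1)) := by
    intro x
    rw [add_zero, gramDet_bordered hC, ← ENNReal.ofReal_mul (by positivity), mul_pow,
      one_div_mul_one_div]
  simp_rw [hx] at h
  rw [lintegral_const_mul _ (by fun_prop), lintegral_pi_resolvent one_pos, hdet] at h
  have hpos : 0 < (1 + ‖a‖ ^ 2) ^ m * gramDet D := by positivity
  have h5 := congrArg (fun z => ENNReal.ofReal ((1 + ‖a‖ ^ 2) ^ m * gramDet D) * z) h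
  simp only [← mul_assoc] at h5
  rw [← ENNReal.ofReal_mul hpos.le (q := ((1 + ‖a‖ ^ 2) ^ m * gramDet D)⁻¹),
    mul_inv_cancel₀ hpos.ne', ENNReal.ofReal_one, one_mul] at h5
  rw [← h5, ← ENNReal.ofReal_mul hpos.le, ← ENNReal.ofReal_mul (by positivity),
    ← ENNReal.ofReal_mul (by positivity)]
  congr 1
  rw [mul_pow]
  field_simp
  ring

/-! ### Measurability of the unordered eigenvalues -/

theorem measurable_sym_iff {m : ℕ} {X : Type*} [MeasurableSpace X] {f : Sym ℂ m → X} :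
    Measurable f ↔ Measurable (f ∘ unordered) := Iff.rfl

theorem measurable_unordered (m : ℕ) : Measurable (unordered (M := m)) := fun _ hs => hs

theorem unordered_surjective (m : ℕ) : Function.Surjective (unordered (M := m)) := by
  rintro ⟨s, hs⟩
  obtain ⟨l, rfl⟩ := Quot.exists_rep s
  have hl : l.length = m := hs
  subst hl
  refine ⟨l.get, Subtype.ext ?_⟩
  change Multiset.map l.get Finset.univ.val = (l : Multiset ℂ)
  rw [Fin.univ_val_map, List.ofFn_get]

/-- The coefficients of the characteristic polynomial. -/
def charpolyCoeff {m : ℕ} (A : Fin m → Fin m → ℂ) : Fin m → ℂ :=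
  fun i => (Matrix.of A).charpoly.coeff i

theorem continuous_charpolyCoeff (m : ℕ) : Continuous (charpolyCoeff (m := m)) := by
  refine continuous_pi fun i => ?_
  have h : ∀ A : Fin m → Fin m → ℂ, charpolyCoeff A i =
      MvPolynomial.eval (fun p => A p.1 p.2) ((Matrix.charpoly.univ ℂ (Fin m)).coeff i) := by
    intro A
    have h := Matrix.charpoly.univ_map_eval₂Hom (Fin m) (RingHom.id ℂ) fun p => A p.1 p.2
    have h' : Matrix.of (Function.curry fun p : Fin m × Fin m => A p.1 p.2) = Matrix.of A := rfl
    rw [charpolyCoeff, ← h', ← h, Polynomial.coeff_map]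
    rfl
  simp_rw [h]
  exact (MvPolynomial.continuous_eval _).comp (by fun_prop)

theorem charpolyCoeff_eq_iff {m : ℕ} (A B : Fin m → Fin m → ℂ) :
    charpolyCoeff A = charpolyCoeff B ↔
      eigenvalues (Matrix.of A) = eigenvalues (Matrix.of B) := by
  constructor
  · intro h
    have hp : (Matrix.of A).charpoly = (Matrix.of B).charpoly := by
      have hA := Matrix.charpoly_natDegree_eq_dim (Matrix.of A)
      have hB := Matrix.charpoly_natDegree_eq_dim (Matrix.of B)
      rw [Fintype.card_fin] at hA hB
      ext k
      rcases lt_trichotomy k m with hk | rfl | hk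
      · exact congrFun h ⟨k, hk⟩
      · have h1 := (Matrix.charpoly_monic (Matrix.of A)).coeff_natDegree
        have h2 := (Matrix.charpoly_monic (Matrix.of B)).coeff_natDegree
        rw [hA] at h1
        rw [hB] at h2
        rw [h1, h2]
      · rw [Polynomial.coeff_eq_zero_of_natDegree_lt (by omega),
          Polynomial.coeff_eq_zero_of_natDegree_lt (by omega)]
    exact Subtype.ext (congrArg Polynomial.roots hp)
  · intro h
    have hr : (Matrix.of A).charpoly.roots = (Matrix.of B).charpoly.roots :=
      congrArg Subtype.val h
    have hp : (Matrix.of A).charpoly = (Matrix.of B).charpoly := by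
      rw [(IsAlgClosed.splits _).eq_prod_roots_of_monic (Matrix.charpoly_monic (Matrix.of A)), hr,
        ← (IsAlgClosed.splits _).eq_prod_roots_of_monic (Matrix.charpoly_monic (Matrix.of B))]
    ext i
    rw [charpolyCoeff, charpolyCoeff, hp]

theorem eigenvalues_diagonal {m : ℕ} (z : Fin m → ℂ) :
    eigenvalues (Matrix.diagonal z) = unordered z := by
  refine Subtype.ext ?_
  change (Matrix.diagonal z).charpoly.roots = Multiset.map z Finset.univ.val
  rw [Matrix.charpoly_diagonal]
  exact Polynomial.roots_multiset_prod_X_sub_C (Multiset.map z Finset.univ.val) ▸ by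
    rw [Multiset.map_map]
    rfl

/-- The quotient map to unordered tuples is, up to the Borel isomorphism given by the elementary
symmetric functions, a Borel surjection between standard Borel spaces; hence the eigenvalues depend
measurably on the matrix. -/
theorem measurable_eigenvalues (m : ℕ) :
    Measurable fun A : Fin m → Fin m → ℂ => eigenvalues (Matrix.of A) := by
  intro E hE
  have hE' : MeasurableSet (unordered ⁻¹' E : Set (Fin m → ℂ)) := hE
  -- Up to signs, `q` maps a tuple to its elementary symmetric functions; its fibres are those of
  -- `unordered`.
  set q : (Fin m → ℂ) → (Fin m → ℂ) := fun z => charpolyCoeff fun i j => Matrix.diagonal z i j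
    with hq
  have hqc : Continuous q := (continuous_charpolyCoeff m).comp
    (continuous_pi fun i => continuous_pi fun j => by
      by_cases h : i = j
      · subst h; simpa using continuous_apply i
      · simpa [h] using continuous_const)
  have hqe : ∀ (A : Fin m → Fin m → ℂ) z, q z = charpolyCoeff A ↔
      unordered z = eigenvalues (Matrix.of A) := by
    intro A z
    rw [hq, charpolyCoeff_eq_iff, ← eigenvalues_diagonal]
    rfl
  have hqs : Function.Surjective q := by
    intro c
    set p : Polynomial ℂ :=
      Polynomial.X ^ m + ∑ i : Fin m, Polynomial.C (c i) * Polynomial.X ^ (i : ℕ) with hp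
    have hdeg : (∑ i : Fin m, Polynomial.C (c i) * Polynomial.X ^ (i : ℕ)).degree <
        ((m : ℕ) : WithBot ℕ) :=
      Polynomial.degree_sum_fin_lt c
    have hmon : p.Monic := Polynomial.monic_X_pow_add hdeg
    have hnat : p.natDegree = m := by
      rw [hp, Polynomial.natDegree_add_eq_left_of_degree_lt (by simpa using hdeg),
        Polynomial.natDegree_X_pow]
    obtain ⟨z, hz⟩ := unordered_surjective m ⟨p.roots, by
      rw [IsAlgClosed.card_roots_eq_natDegree, hnat]⟩
    refine ⟨z, ?_⟩
    have hz' : (Matrix.diagonal z).charpoly.roots = p.roots := by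
      rw [← eigenvalues_diagonal] at hz
      exact congrArg Subtype.val hz
    have hpp : (Matrix.diagonal z).charpoly = p := by
      rw [(IsAlgClosed.splits _).eq_prod_roots_of_monic (Matrix.charpoly_monic _), hz',
        ← (IsAlgClosed.splits _).eq_prod_roots_of_monic hmon]
    ext i
    change (Matrix.diagonal z).charpoly.coeff i = c i
    rw [hpp, hp, Polynomial.coeff_add, Polynomial.coeff_X_pow, if_neg i.2.ne, zero_add,
      Polynomial.finsetSum_coeff, Finset.sum_eq_single i]
    · simp
    · intro j _ hj
      rw [Polynomial.coeff_C_mul_X_pow, if_neg]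
      exact fun h => hj (Fin.ext h.symm)
    · simp
  have hpre : q ⁻¹' (q '' (unordered ⁻¹' E)) = unordered ⁻¹' E := by
    refine subset_antisymm ?_ (Set.subset_preimage_image _ _)
    rintro z ⟨z', hz', hzz⟩
    have := (hqe (fun i j => Matrix.diagonal z i j) z').mp hzz
    have e : unordered z' = unordered z := this.trans (eigenvalues_diagonal z)
    rw [Set.mem_preimage, ← e]
    exact hz'
  have hS : MeasurableSet (q '' (unordered ⁻¹' E)) := by
    rw [← hqc.measurable.measurableSet_preimage_iff_of_surjective hqs, hpre]
    exact hE'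
  have hfin : (fun A : Fin m → Fin m → ℂ => eigenvalues (Matrix.of A)) ⁻¹' E =
      charpolyCoeff ⁻¹' (q '' (unordered ⁻¹' E)) := by
    ext A
    obtain ⟨z, hz⟩ := unordered_surjective m (eigenvalues (Matrix.of A))
    have hqz := (hqe A z).mpr hz
    rw [Set.mem_preimage, Set.mem_preimage, ← hz, ← hqz, ← Set.mem_preimage (f := q), hpre]
    rfl
  rw [hfin]
  exact (continuous_charpolyCoeff m).measurable hS

/-! ### The eigenvalue weight by induction on the size -/

/-- The unnormalized element weight `|det A|^{2a} / det(1 + AᴴA)^s`. -/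
def gramWeight {n : Type*} [Fintype n] [DecidableEq n] (a s : ℕ) (A : Matrix n n ℂ) : ENNReal :=
  ENNReal.ofReal (‖A.det‖ ^ (2 * a) / gramDet A ^ s)

theorem measurable_gramWeight {m : ℕ} (a s : ℕ) :
    Measurable fun A : Fin m → Fin m → ℂ => gramWeight a s (Matrix.of A) := by
  have h1 : Continuous fun A : Fin m → Fin m → ℂ => (Matrix.of A).det :=
    (continuous_matrix_of continuous_id).matrix_det
  have h2 : Continuous fun A : Fin m → Fin m → ℂ => gramDet (Matrix.of A) :=
    continuous_gramDet.comp (continuous_matrix_of continuous_id)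
  unfold gramWeight
  exact ENNReal.measurable_ofReal.comp
    ((h1.norm.measurable.pow_const _).div (h2.measurable.pow_const _))

theorem gramWeight_inflate {m : ℕ} (a s : ℕ) (w b : Fin m → ℂ) (x : ℂ × (Fin m → Fin m → ℂ)) :
    gramWeight a s (Matrix.of (inflate w x b)) =
      ENNReal.ofReal ((‖x.1‖ * ‖(Matrix.of x.2).det‖) ^ (2 * a)) *
        ENNReal.ofReal
          (1 / gramDet (shear w * bordered x.1 b 0 (Matrix.of x.2) * shear (-w)) ^ s) := by
  rw [gramWeight, inflate, of_flatten, gramDet_reindex, Matrix.det_reindex_self, Matrix.det_mul,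
    Matrix.det_mul, det_shear, det_shear, det_bordered_zero_col, one_mul, mul_one, norm_mul,
    div_eq_mul_one_div, ENNReal.ofReal_mul (by positivity)]

theorem det_reflector_ne_zero {m : ℕ} (w : Fin m → ℂ) : (reflector w).det ≠ 0 := by
  rw [det_reflector]
  exact inv_ne_zero (by exact_mod_cast (affineNorm_pos w).ne')

/-- Integration of the Gram determinant of an inflated matrix over its first row. -/
theorem lintegral_gramDet_shear_conj {m : ℕ} (t : ℕ) (w : Fin m → ℂ) (a : ℂ)
    (D : Matrix (Fin m) (Fin m) ℂ) :
    ∫⁻ b : Fin m → ℂ, ENNReal.ofReal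
        (1 / gramDet (shear w * bordered a b 0 D * shear (-w)) ^ (m + t + 1)) =
      ENNReal.ofReal (1 / (1 + ∑ i, ‖w i‖ ^ 2) ^ (m + 1)) *
        (ENNReal.ofReal (π ^ m * t.factorial / (m + t).factorial) *
          ENNReal.ofReal (1 / (1 + ‖a‖ ^ 2) ^ (t + 1) *
            (1 / gramDet (reflector w * D * (reflector w)⁻¹) ^ (m + t)))) := by
  have h1 : (affineNorm w : ℂ) ≠ 0 := by exact_mod_cast (affineNorm_pos w).ne'
  have hd : ((affineNorm w : ℂ) • (reflector w)⁻¹).det = (affineNorm w : ℂ) ^ (m + 1) := by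
    rw [Matrix.det_smul, Matrix.det_nonsing_inv, Ring.inverse_eq_inv', det_reflector, inv_inv,
      Fintype.card_fin, pow_succ]
  have hm : Measurable fun b : Fin m → ℂ => ENNReal.ofReal
      (1 / gramDet (bordered a b 0 (reflector w * D * (reflector w)⁻¹)) ^ (m + t + 1)) := by
    have : Continuous fun b : Fin m → ℂ =>
        gramDet (bordered a b 0 (reflector w * D * (reflector w)⁻¹)) :=
      continuous_gramDet.comp (Continuous.bordered continuous_const continuous_id continuous_const
        continuous_const)
    exact ENNReal.measurable_ofReal.comp (measurable_const.div (this.measurable.pow_const _))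
  simp_rw [gramDet_shear_conj]
  rw [lintegral_vecMul_add (A := (affineNorm w : ℂ) • (reflector w)⁻¹)
    (by rw [hd]; exact pow_ne_zero _ h1) _ hm, lintegral_gramDet_bordered, hd]
  congr 2
  rw [norm_pow, Complex.norm_real, Real.norm_of_nonneg (affineNorm_pos w).le, ← pow_mul, mul_comm,
    pow_mul, affineNorm_sq, one_div]

/-- Integration of the element weight over the first row and over the block of the triangular form,
against a function of the eigenvalue and the conjugacy class of the block. -/
theorem lintegral_gramWeight_inflate {m : ℕ} (a t : ℕ) (w : Fin m → ℂ)
    {K : ℂ × (Fin m → Fin m → ℂ) → ENNReal} (hK : Measurable K)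
    (hKc : ∀ (μ : ℂ) (D : Fin m → Fin m → ℂ), K (μ, fun i j =>
      (reflector w * Matrix.of D * (reflector w)⁻¹ : Matrix (Fin m) (Fin m) ℂ) i j) = K (μ, D)) :
    ∫⁻ x, ∫⁻ b, K x * gramWeight a (m + t + 1) (Matrix.of (inflate w x b)) =
      ENNReal.ofReal (1 / (1 + ∑ i, ‖w i‖ ^ 2) ^ (m + 1)) *
        (ENNReal.ofReal (π ^ m * t.factorial / (m + t).factorial) *
          ∫⁻ μ : ℂ, ENNReal.ofReal (‖μ‖ ^ (2 * a) / (1 + ‖μ‖ ^ 2) ^ (t + 1)) *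
            ∫⁻ D, K (μ, D) * gramWeight a (m + t) (Matrix.of D)) := by
  set c₁ := ENNReal.ofReal (1 / (1 + ∑ i, ‖w i‖ ^ 2) ^ (m + 1)) with hc₁
  set c₂ := ENNReal.ofReal (π ^ m * t.factorial / (m + t).factorial) with hc₂
  set u : ℂ → ENNReal := fun μ => ENNReal.ofReal (‖μ‖ ^ (2 * a) / (1 + ‖μ‖ ^ 2) ^ (t + 1)) with hu
  have hum : Measurable u := by rw [hu]; fun_prop
  have hdet : ∀ D : Matrix (Fin m) (Fin m) ℂ,
      (reflector w * D * (reflector w)⁻¹).det = D.det := by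
    intro D
    rw [Matrix.det_conj ((Matrix.isUnit_iff_isUnit_det _).mpr (det_reflector_ne_zero w).isUnit)]
  have hgm := measurable_gramWeight (m := m) a (m + t)
  have hx : ∀ x : ℂ × (Fin m → Fin m → ℂ),
      ∫⁻ b, K x * gramWeight a (m + t + 1) (Matrix.of (inflate w x b)) =
        c₁ * c₂ * (u x.1 * (K x * gramWeight a (m + t)
          (reflector w * Matrix.of x.2 * (reflector w)⁻¹))) := by
    intro x
    have hm : Measurable fun b : Fin m → ℂ => ENNReal.ofReal
        (1 / gramDet (shear w * bordered x.1 b 0 (Matrix.of x.2) * shear (-w)) ^ (m + t + 1)) := by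
      have : Continuous fun b : Fin m → ℂ =>
          gramDet (shear w * bordered x.1 b 0 (Matrix.of x.2) * shear (-w)) :=
        continuous_gramDet.comp ((continuous_const.matrix_mul (Continuous.bordered continuous_const
          continuous_id continuous_const continuous_const)).matrix_mul continuous_const)
      exact ENNReal.measurable_ofReal.comp (measurable_const.div (this.measurable.pow_const _))
    simp_rw [gramWeight_inflate, ← mul_assoc]
    rw [lintegral_const_mul _ hm, lintegral_gramDet_shear_conj, gramWeight, hdet]
    have hpos := gramDet_pos (reflector w * Matrix.of x.2 * (reflector w)⁻¹)
    have e : ENNReal.ofReal ((‖x.1‖ * ‖(Matrix.of x.2).det‖) ^ (2 * a)) *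
        ENNReal.ofReal (1 / (1 + ‖x.1‖ ^ 2) ^ (t + 1) *
            (1 / gramDet (reflector w * Matrix.of x.2 * (reflector w)⁻¹) ^ (m + t))) =
        u x.1 * ENNReal.ofReal (‖(Matrix.of x.2).det‖ ^ (2 * a) /
          gramDet (reflector w * Matrix.of x.2 * (reflector w)⁻¹) ^ (m + t)) := by
      rw [hu, ← ENNReal.ofReal_mul (by positivity), ← ENNReal.ofReal_mul (by positivity)]
      congr 1
      rw [mul_pow]
      field_simp
    rw [← hc₁, ← hc₂]
    calc _ = c₁ * c₂ * K x * (ENNReal.ofReal ((‖x.1‖ * ‖(Matrix.of x.2).det‖) ^ (2 * a)) *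
        ENNReal.ofReal (1 / (1 + ‖x.1‖ ^ 2) ^ (t + 1) *
            (1 / gramDet (reflector w * Matrix.of x.2 * (reflector w)⁻¹) ^ (m + t)))) := by ring
      _ = _ := by rw [e]; ring
  have hcm : Measurable fun D : Fin m → Fin m → ℂ => gramWeight a (m + t)
      (reflector w * Matrix.of D * (reflector w)⁻¹) := by
    have : Continuous fun D : Fin m → Fin m → ℂ => (fun i j =>
        (reflector w * Matrix.of D * (reflector w)⁻¹ : Matrix (Fin m) (Fin m) ℂ) i j) := by
      have h := (continuous_const (y := reflector w)).matrix_mul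
        (continuous_matrix_of (continuous_id (X := Fin m → Fin m → ℂ)))
      exact h.matrix_mul (continuous_const (y := (reflector w)⁻¹))
    exact hgm.comp this.measurable
  have hI : Measurable fun x : ℂ × (Fin m → Fin m → ℂ) => u x.1 * (K x * gramWeight a (m + t)
      (reflector w * Matrix.of x.2 * (reflector w)⁻¹)) :=
    (hum.comp measurable_fst).mul (hK.mul (hcm.comp measurable_snd))
  simp_rw [hx]
  rw [lintegral_const_mul _ hI, mul_assoc, Measure.volume_eq_prod, lintegral_prod _ hI.aemeasurable]
  congr 2
  refine lintegral_congr fun μ => ?_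
  have hKμ : Measurable fun D => K (μ, D) := measurable_section_left hK μ
  have h1 : Measurable fun D => K (μ, D) * gramWeight a (m + t)
      (reflector w * Matrix.of D * (reflector w)⁻¹) := hKμ.mul hcm
  have h2 : Measurable fun D => K (μ, D) * gramWeight a (m + t) (Matrix.of D) := hKμ.mul hgm
  simp only
  rw [lintegral_const_mul _ h1, ← lintegral_conj (det_reflector_ne_zero w) h2]
  congr 1
  refine lintegral_congr fun D => ?_
  rw [hKc]
  rfl

/-- The squared modulus of the Vandermonde determinant. -/
def vandermondeSq {m : ℕ} (z : Fin m → ℂ) : ℝ := ∏ k, ∏ j ∈ Finset.Iio k, ‖z k - z j‖ ^ 2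

theorem vandermondeSq_eq_prod_Ioi {m : ℕ} (z : Fin m → ℂ) :
    vandermondeSq z = ∏ i, ∏ j ∈ Finset.Ioi i, ‖z j - z i‖ ^ 2 :=
  Finset.prod_comm' fun i j => by simp

theorem vandermondeSq_eq_det {m : ℕ} (z : Fin m → ℂ) :
    vandermondeSq z = ‖(Matrix.vandermonde z).det‖ ^ 2 := by
  rw [vandermondeSq_eq_prod_Ioi, Matrix.det_vandermonde, norm_prod, ← Finset.prod_pow]
  simp_rw [norm_prod, ← Finset.prod_pow]

theorem vandermondeSq_nonneg {m : ℕ} (z : Fin m → ℂ) : 0 ≤ vandermondeSq z := by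
  rw [vandermondeSq_eq_det]
  positivity

theorem vandermondeSq_cons {m : ℕ} (μ : ℂ) (z : Fin m → ℂ) :
    vandermondeSq (Fin.cons μ z : Fin (m + 1) → ℂ) = (∏ j, ‖μ - z j‖ ^ 2) * vandermondeSq z := by
  rw [vandermondeSq_eq_prod_Ioi, vandermondeSq_eq_prod_Ioi, Fin.prod_univ_succ, Fin.prod_Ioi_zero]
  simp only [Fin.prod_Ioi_succ, Fin.cons_zero, Fin.cons_succ, norm_sub_rev μ]

/-- The unnormalized joint eigenvalue density. -/
def eigWeight {m : ℕ} (a t : ℕ) (z : Fin m → ℂ) : ℝ :=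
  (∏ j, ‖z j‖ ^ (2 * a) / (1 + ‖z j‖ ^ 2) ^ (t + 1)) * vandermondeSq z

theorem eigWeight_nonneg {m : ℕ} (a t : ℕ) (z : Fin m → ℂ) : 0 ≤ eigWeight a t z :=
  mul_nonneg (by positivity) (vandermondeSq_nonneg z)

theorem measurable_eigWeight {m : ℕ} (a t : ℕ) : Measurable (eigWeight (m := m) a t) := by
  unfold eigWeight vandermondeSq
  fun_prop

theorem eigWeight_cons {m : ℕ} (a t : ℕ) (μ : ℂ) (z : Fin m → ℂ) :
    eigWeight a t (Fin.cons μ z : Fin (m + 1) → ℂ) =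
      ‖μ‖ ^ (2 * a) / (1 + ‖μ‖ ^ 2) ^ (t + 1) * ((∏ j, ‖μ - z j‖ ^ 2) * eigWeight a t z) := by
  rw [eigWeight, eigWeight, vandermondeSq_cons, Fin.prod_univ_succ]
  simp only [Fin.cons_zero, Fin.cons_succ]
  ring

/-- Deflation removes one eigenvalue. -/
theorem eigenvalues_inflate {m : ℕ} (w b : Fin m → ℂ) (x : ℂ × (Fin m → Fin m → ℂ)) :
    eigenvalues (Matrix.of (inflate w x b)) = x.1 ::ₛ eigenvalues (Matrix.of x.2) := by
  refine Subtype.ext ?_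
  change (Matrix.of (inflate w x b)).charpoly.roots = x.1 ::ₘ (Matrix.of x.2).charpoly.roots
  rw [inflate, of_flatten, Matrix.charpoly_reindex, charpoly_shear_conj,
    charpoly_bordered_zero_col, Polynomial.roots_mul, Polynomial.roots_X_sub_C]
  · rfl
  · exact mul_ne_zero (Polynomial.X_sub_C_ne_zero _) (Matrix.charpoly_monic _).ne_zero

theorem unordered_cons {m : ℕ} (μ : ℂ) (z : Fin m → ℂ) :
    unordered (Fin.cons μ z : Fin (m + 1) → ℂ) = μ ::ₛ unordered z := by
  refine Subtype.ext ?_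
  change Multiset.map (Fin.cons μ z : Fin (m + 1) → ℂ) Finset.univ.val =
    μ ::ₘ Multiset.map z Finset.univ.val
  rw [Fin.univ_val_map, Fin.univ_val_map, List.ofFn_succ]
  rfl

/-- The product of the squared distances of `μ` to the points of an unordered tuple. -/
def distProd {m : ℕ} (μ : ℂ) (s : Sym ℂ m) : ENNReal :=
  ENNReal.ofReal ((s.1.map fun ν => ‖μ - ν‖ ^ 2).prod)

theorem distProd_unordered {m : ℕ} (μ : ℂ) (z : Fin m → ℂ) :
    distProd μ (unordered z) = ENNReal.ofReal (∏ j, ‖μ - z j‖ ^ 2) := by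
  rw [distProd, unordered, Multiset.map_map]
  rfl

theorem norm_prod_map_sub_sq (μ : ℂ) (s : Multiset ℂ) :
    ‖(s.map fun ν => μ - ν).prod‖ ^ 2 = (s.map fun ν => ‖μ - ν‖ ^ 2).prod := by
  induction s using Multiset.induction_on with
  | empty => simp
  | cons ν s ih => simp [mul_pow, ih]

theorem deflationJacobian_eq_distProd {m : ℕ} (x : ℂ × (Fin m → Fin m → ℂ)) :
    deflationJacobian x = distProd x.1 (eigenvalues (Matrix.of x.2)) := by
  have h := Matrix.eval_charpoly (Matrix.of x.2) x.1
  rw [(IsAlgClosed.splits _).eq_prod_roots_of_monic (Matrix.charpoly_monic (Matrix.of x.2)),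
    Polynomial.eval_multiset_prod, Multiset.map_map] at h
  rw [deflationJacobian, Matrix.smul_one_eq_diagonal, ← Matrix.scalar_apply, ← h, distProd]
  congr 1
  have h2 := norm_prod_map_sub_sq x.1 (Matrix.of x.2).charpoly.roots
  simp only [Function.comp_def, Polynomial.eval_sub, Polynomial.eval_X, Polynomial.eval_C]
  exact h2

theorem eigenvalues_conj {m : ℕ} {B : Matrix (Fin m) (Fin m) ℂ} (hB : B.det ≠ 0)
    (D : Matrix (Fin m) (Fin m) ℂ) : eigenvalues (B * D * B⁻¹) = eigenvalues D := by
  have h : (B * D * B⁻¹).charpoly = D.charpoly :=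
    Matrix.charpoly_units_conj (Matrix.nonsingInvUnit B hB.isUnit) D
  exact Subtype.ext (congrArg Polynomial.roots h)

/-- The ratio between the element weight, pushed to the eigenvalues, and the eigenvalue weight. -/
def schurConst (t m : ℕ) : ℝ :=
  ∏ j ∈ Finset.range m, π ^ (2 * j) * t.factorial / ((j + 1).factorial * (j + t).factorial)

theorem schurConst_pos (t m : ℕ) : 0 < schurConst t m :=
  Finset.prod_pos fun _ _ => by positivity

/-- The law of the eigenvalues under the element weight, tested against functions of the unordered
eigenvalues. One eigenvalue is split off by deflation; the integrals over its eigenvector and over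
the remaining row are explicit, and what is left is the same statement for the smaller block, with
the deflation Jacobian as an additional factor of the test function. -/
theorem lintegral_gramWeight_eigenvalues (a t m : ℕ) {h : Sym ℂ m → ENNReal} (hh : Measurable h) :
    ∫⁻ G : Fin m → Fin m → ℂ, gramWeight a (m + t) (Matrix.of G) * h (eigenvalues (Matrix.of G)) =
      ENNReal.ofReal (schurConst t m) *
        ∫⁻ z : Fin m → ℂ, ENNReal.ofReal (eigWeight a t z) * h (unordered z) := by
  induction m with
  | zero =>
    have e : ∀ G : Fin 0 → Fin 0 → ℂ, eigenvalues (Matrix.of G) = unordered Fin.elim0 :=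
      fun G => Subsingleton.elim _ _
    have e' : ∀ z : Fin 0 → ℂ, unordered z = unordered Fin.elim0 := fun z => Subsingleton.elim _ _
    simp [e, e', gramWeight, gramDet, schurConst, eigWeight, vandermondeSq, volume_pi]
  | succ m ih =>
    set K : ℂ × (Fin m → Fin m → ℂ) → ENNReal := fun x =>
      deflationJacobian x * h (x.1 ::ₛ eigenvalues (Matrix.of x.2)) with hK
    have hKm : Measurable K := by
      refine measurable_deflationJacobian.mul ?_
      have h1 : Measurable fun x : ℂ × (Fin m → Fin m → ℂ) => inflate 0 x 0 :=
        measurable_section_right (measurable_section_left continuous_inflate.measurable 0) 0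
      have h2 := hh.comp ((measurable_eigenvalues (m + 1)).comp h1)
      simpa only [Function.comp_def, eigenvalues_inflate] using h2
    have hΦ : Measurable fun G : Fin (m + 1) → Fin (m + 1) → ℂ =>
        gramWeight a (m + 1 + t) (Matrix.of G) * h (eigenvalues (Matrix.of G)) :=
      (measurable_gramWeight _ _).mul (hh.comp (measurable_eigenvalues _))
    have hdef := lintegral_deflation m hΦ
    -- The factor of the integrand that depends only on the eigenvalues is `K`.
    have hre : ∀ (w : Fin m → ℂ) (x : ℂ × (Fin m → Fin m → ℂ)) (b : Fin m → ℂ),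
        deflationJacobian x * (gramWeight a (m + 1 + t) (Matrix.of (inflate w x b)) *
          h (eigenvalues (Matrix.of (inflate w x b)))) =
        K x * gramWeight a (m + t + 1) (Matrix.of (inflate w x b)) := by
      intro w x b
      rw [eigenvalues_inflate, hK, add_right_comm m 1 t]
      ring
    have hKc : ∀ (w : Fin m → ℂ) (μ : ℂ) (D : Fin m → Fin m → ℂ), K (μ, fun i j =>
        (reflector w * Matrix.of D * (reflector w)⁻¹ : Matrix (Fin m) (Fin m) ℂ) i j) =
        K (μ, D) := by
      intro w μ D
      have e := eigenvalues_conj (det_reflector_ne_zero w) (Matrix.of D)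
      have e' : Matrix.of (fun i j => (reflector w * Matrix.of D * (reflector w)⁻¹ :
        Matrix (Fin m) (Fin m) ℂ) i j) = reflector w * Matrix.of D * (reflector w)⁻¹ := rfl
      simp only [hK, deflationJacobian_eq_distProd]
      rw [e', e]
    have hD : ∀ μ : ℂ, ∫⁻ D, K (μ, D) * gramWeight a (m + t) (Matrix.of D) =
        ENNReal.ofReal (schurConst t m) * ∫⁻ z : Fin m → ℂ, ENNReal.ofReal (eigWeight a t z) *
          (distProd μ (unordered z) * h (μ ::ₛ unordered z)) := by
      intro μ
      have hm : Measurable fun s : Sym ℂ m => distProd μ s * h (μ ::ₛ s) := by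
        rw [measurable_sym_iff]
        have h1 : Measurable fun z : Fin m → ℂ => ENNReal.ofReal (∏ j, ‖μ - z j‖ ^ 2) := by
          fun_prop
        have h2 : Measurable fun z : Fin m → ℂ => h (unordered (Fin.cons μ z : Fin (m + 1) → ℂ)) :=
          hh.comp ((measurable_unordered (m + 1)).comp
            (measurable_section_left (measurePreserving_finCons ℂ m).measurable μ))
        have h3 : Measurable fun z : Fin m → ℂ => ENNReal.ofReal (∏ j, ‖μ - z j‖ ^ 2) *
            h (unordered (Fin.cons μ z : Fin (m + 1) → ℂ)) := h1.mul h2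
        simpa only [Function.comp_def, distProd_unordered, unordered_cons] using h3
      rw [← ih hm]
      refine lintegral_congr fun D => ?_
      simp only [hK, deflationJacobian_eq_distProd]
      ring
    have hz : ∫⁻ μ : ℂ, ENNReal.ofReal (‖μ‖ ^ (2 * a) / (1 + ‖μ‖ ^ 2) ^ (t + 1)) *
        ∫⁻ D, K (μ, D) * gramWeight a (m + t) (Matrix.of D) =
        ENNReal.ofReal (schurConst t m) * ∫⁻ z : Fin (m + 1) → ℂ,
          ENNReal.ofReal (eigWeight a t z) * h (unordered z) := by
      have hm : Measurable fun z : Fin (m + 1) → ℂ =>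
          ENNReal.ofReal (eigWeight a t z) * h (unordered z) :=
        (ENNReal.measurable_ofReal.comp (measurable_eigWeight a t)).mul
          (hh.comp (measurable_unordered _))
      have hm' : Measurable fun p : ℂ × (Fin m → ℂ) =>
          ENNReal.ofReal (eigWeight a t (Fin.cons p.1 p.2 : Fin (m + 1) → ℂ)) *
            h (unordered (Fin.cons p.1 p.2 : Fin (m + 1) → ℂ)) :=
        hm.comp (measurePreserving_finCons ℂ m).measurable
      rw [lintegral_fin_cons _ hm, ← lintegral_const_mul _ hm'.lintegral_prod_right']
      refine lintegral_congr fun μ => ?_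
      rw [hD, ← mul_assoc, mul_comm (ENNReal.ofReal (_ / _)), mul_assoc, ← lintegral_const_mul']
      · congr 1
        refine lintegral_congr fun z => ?_
        rw [unordered_cons, distProd_unordered, eigWeight_cons, ENNReal.ofReal_mul (by positivity),
          ENNReal.ofReal_mul (by positivity)]
        ring
      · exact ENNReal.ofReal_ne_top
    -- All that is left of the eigenvector `(1, w)` is the factor `(1 + |w|²)^{-(m+1)}`.
    simp_rw [hre, fun w => lintegral_gramWeight_inflate a t w hKm (hKc w), hz] at hdef
    have hw := lintegral_pi_resolvent one_pos m 0
    simp only [add_zero] at hw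
    rw [lintegral_mul_const _ (by fun_prop), hw] at hdef
    have hm1 : ((m : ENNReal) + 1) = ENNReal.ofReal (m + 1) := by
      rw [ENNReal.ofReal_add (by positivity) one_pos.le]
      simp
    have h3 := congrArg (fun y => ENNReal.ofReal (1 / (m + 1)) * y) hdef
    simp only [hm1, ← mul_assoc] at h3
    rw [← ENNReal.ofReal_mul (by positivity), one_div_mul_cancel (by positivity),
      ENNReal.ofReal_one, one_mul, ← ENNReal.ofReal_mul (by positivity),
      ← ENNReal.ofReal_mul (by positivity), ← ENNReal.ofReal_mul (by positivity)] at h3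
    rw [h3]
    congr 2
    have hs : schurConst t (m + 1) =
        schurConst t m * (π ^ (2 * m) * t.factorial / ((m + 1).factorial * (m + t).factorial)) :=
      Finset.prod_range_succ _ _
    rw [hs, Nat.factorial_succ m]
    push_cast
    simp only [Nat.factorial_zero, Nat.cast_one, one_pow, div_one, mul_one]
    field_simp
    ring

/-! ### Normalization by the Andréief identity -/

/-- Andréief's identity: the integral of a product of two alternants is a determinant of pairings,
with a factor `m!`. -/
theorem andreief {X : Type*} [MeasurableSpace X] (μ : Measure X) [SigmaFinite μ] {m : ℕ}
    (f g : Fin m → X → ℂ) (hfg : ∀ i j, Integrable (fun x => f i x * g j x) μ) :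
    Integrable (fun x : Fin m → X => (Matrix.of fun i j => f j (x i)).det *
        (Matrix.of fun i j => g j (x i)).det) (Measure.pi fun _ => μ) ∧
      ∫ x : Fin m → X, (Matrix.of fun i j => f j (x i)).det *
        (Matrix.of fun i j => g j (x i)).det ∂(Measure.pi fun _ => μ) =
      m.factorial * (Matrix.of fun i j => ∫ x, f i x * g j x ∂μ).det := by
  have hexp : ∀ x : Fin m → X, (Matrix.of fun i j => f j (x i)).det *
      (Matrix.of fun i j => g j (x i)).det =
      ∑ σ : Equiv.Perm (Fin m), ∑ τ : Equiv.Perm (Fin m),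
        ((Equiv.Perm.sign σ : ℤ) : ℂ) * ((Equiv.Perm.sign τ : ℤ) : ℂ) *
          ∏ i, (f (σ i) (x i) * g (τ i) (x i)) := by
    intro x
    rw [← Matrix.det_transpose, ← Matrix.det_transpose (Matrix.of fun i j => g j (x i)),
      Matrix.det_apply', Matrix.det_apply', Finset.sum_mul_sum]
    refine Finset.sum_congr rfl fun σ _ => Finset.sum_congr rfl fun τ _ => ?_
    simp only [Matrix.transpose_apply, Matrix.of_apply, Finset.prod_mul_distrib]
    ring
  have hint : ∀ σ τ : Equiv.Perm (Fin m), Integrable (fun x : Fin m → X =>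
      ((Equiv.Perm.sign σ : ℤ) : ℂ) * ((Equiv.Perm.sign τ : ℤ) : ℂ) *
          ∏ i, (f (σ i) (x i) * g (τ i) (x i))) (Measure.pi fun _ => μ) := fun σ τ =>
    (Integrable.fintype_prod (f := fun i x => f (σ i) x * g (τ i) x)
      (fun i => hfg (σ i) (τ i))).const_mul _
  simp_rw [hexp]
  refine ⟨integrable_finsetSum _ fun σ _ => integrable_finsetSum _ fun τ _ => hint σ τ, ?_⟩
  rw [integral_finsetSum _ fun σ _ => integrable_finsetSum _ fun τ _ => hint σ τ]
  -- Permuting the rows of the matrix of pairings cancels the sign of `σ`.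
  have hrow : ∀ σ : Equiv.Perm (Fin m), ∫ x : Fin m → X, ∑ τ : Equiv.Perm (Fin m),
        ((Equiv.Perm.sign σ : ℤ) : ℂ) * ((Equiv.Perm.sign τ : ℤ) : ℂ) *
          ∏ i, (f (σ i) (x i) * g (τ i) (x i)) ∂(Measure.pi fun _ => μ) =
      (Matrix.of fun i j => ∫ x, f i x * g j x ∂μ).det := by
    intro σ
    rw [integral_finsetSum _ fun τ _ => hint σ τ]
    have hs : ((Equiv.Perm.sign σ : ℤ) : ℂ) * ((Equiv.Perm.sign σ : ℤ) : ℂ) = 1 := by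
      rw [← Int.cast_mul, Int.units_coe_mul_self, Int.cast_one]
    have h1 := Matrix.det_permute σ (Matrix.of fun i j => ∫ x, f i x * g j x ∂μ)
    have h2 : (Matrix.of fun i j => ∫ x, f i x * g j x ∂μ).det = ((Equiv.Perm.sign σ : ℤ) : ℂ) *
        ((Matrix.of fun i j => ∫ x, f i x * g j x ∂μ).submatrix σ id).det := by
      rw [h1, ← mul_assoc, hs, one_mul]
    rw [h2, ← Matrix.det_transpose, Matrix.det_apply', Finset.mul_sum]
    refine Finset.sum_congr rfl fun τ _ => ?_
    rw [integral_const_mul, integral_fintype_prod_eq_prod (fun i x => f (σ i) x * g (τ i) x),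
      mul_assoc]
    rfl
  simp_rw [hrow]
  rw [Finset.sum_const, Finset.card_univ, Fintype.card_perm, Fintype.card_fin, nsmul_eq_mul]

/-- The one-particle weight `|z|^{2a} / (1 + |z|²)^{t+1}`. -/
def radialWeight (a t : ℕ) (z : ℂ) : ℝ := ‖z‖ ^ (2 * a) / (1 + ‖z‖ ^ 2) ^ (t + 1)

theorem radialWeight_nonneg (a t : ℕ) (z : ℂ) : 0 ≤ radialWeight a t z := by
  unfold radialWeight; positivity

theorem continuous_radialWeight (a t : ℕ) : Continuous (radialWeight a t) := by
  unfold radialWeight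
  refine Continuous.div (by fun_prop) (by fun_prop) fun z => by positivity

theorem radialWeight_mul_pow (a t i : ℕ) (z : ℂ) :
    radialWeight a t z * ‖z‖ ^ (2 * i) = radialWeight (a + i) t z := by
  unfold radialWeight; ring

theorem integral_radialWeight (a l : ℕ) :
    Integrable (radialWeight a (a + l + 1)) ∧ ∫ z, radialWeight a (a + l + 1) z =
      π * (a.factorial * l.factorial / (a + l + 1).factorial) := by
  have h := lintegral_complex_beta a l
  have hm := (continuous_radialWeight a (a + l + 1)).aestronglyMeasurable (μ := volume)
  have h0 := radialWeight_nonneg a (a + l + 1)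
  have hi : Integrable (radialWeight a (a + l + 1)) := by
    refine ⟨hm, (hasFiniteIntegral_iff_ofReal (Filter.Eventually.of_forall h0)).2 ?_⟩
    exact h.trans_lt ENNReal.ofReal_lt_top
  refine ⟨hi, ?_⟩
  rw [integral_eq_lintegral_of_nonneg_ae (Filter.Eventually.of_forall h0) hm]
  refine (congrArg ENNReal.toReal h).trans (ENNReal.toReal_ofReal (by positivity))

theorem integrable_radialWeight_mul {a t i j : ℕ} (hi : a + i < t) (hj : a + j < t) :
    Integrable fun z : ℂ => ((radialWeight a t z : ℂ) * z ^ i) * (starRingEnd ℂ) z ^ j := by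
  obtain ⟨k, rfl⟩ := Nat.exists_eq_add_of_lt hi
  obtain ⟨l, hl⟩ := Nat.exists_eq_add_of_lt hj
  have h1 := (integral_radialWeight (a + i) k).1
  have h2 := (integral_radialWeight (a + j) l).1
  rw [← hl] at h2
  refine (h1.add h2).mono' ?_ (Filter.Eventually.of_forall fun z => ?_)
  · have := continuous_radialWeight a (a + i + k + 1)
    exact Continuous.aestronglyMeasurable (by fun_prop)
  · have h0 := radialWeight_nonneg a (a + i + k + 1) z
    rw [norm_mul, norm_mul, norm_pow, norm_pow, Complex.norm_conj, Complex.norm_real,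
      Real.norm_of_nonneg h0]
    simp only [Pi.add_apply, ← radialWeight_mul_pow, mul_assoc, ← mul_add]
    refine mul_le_mul_of_nonneg_left ?_ h0
    rw [pow_mul', pow_mul']
    nlinarith [sq_nonneg (‖z‖ ^ i - ‖z‖ ^ j), sq_nonneg (‖z‖ ^ i), sq_nonneg (‖z‖ ^ j)]

/-- Distinct monomials are orthogonal for a rotation invariant weight: a rotation by
`π / (i - j)` changes the sign of the integrand. -/
theorem integral_radialWeight_mul_of_ne (a t : ℕ) {i j : ℕ} (hij : i ≠ j) :
    ∫ z : ℂ, ((radialWeight a t z : ℂ) * z ^ i) * (starRingEnd ℂ) z ^ j = 0 := by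
  set α : ℝ := π / ((i : ℝ) - j) with hα
  have hne : (i : ℝ) - j ≠ 0 := sub_ne_zero.2 (by exact_mod_cast hij)
  have hmp := (rotation (Circle.exp α)).measurePreserving
  have h := hmp.integral_comp (rotation (Circle.exp α)).toHomeomorph.measurableEmbedding
    fun z : ℂ => ((radialWeight a t z : ℂ) * z ^ i) * (starRingEnd ℂ) z ^ j
  have hc : (Circle.exp α : ℂ) ^ i * (starRingEnd ℂ) (Circle.exp α : ℂ) ^ j = -1 := by
    rw [Circle.coe_exp, ← Complex.exp_conj, ← Complex.exp_nat_mul, ← Complex.exp_nat_mul,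
      ← Complex.exp_add, ← Complex.exp_pi_mul_I]
    congr 1
    rw [map_mul, Complex.conj_I, Complex.conj_ofReal, hα]
    have : (i : ℂ) - j ≠ 0 := by exact_mod_cast hne
    push_cast
    field_simp
    ring
  have hz : ∀ z : ℂ, ((radialWeight a t (rotation (Circle.exp α) z) : ℂ) *
      (rotation (Circle.exp α) z) ^ i) * (starRingEnd ℂ) (rotation (Circle.exp α) z) ^ j =
      -(((radialWeight a t z : ℂ) * z ^ i) * (starRingEnd ℂ) z ^ j) := by
    intro z
    have hw : radialWeight a t (rotation (Circle.exp α) z) = radialWeight a t z := by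
      unfold radialWeight
      rw [LinearIsometryEquiv.norm_map]
    rw [hw, rotation_apply, map_mul, mul_pow, mul_pow]
    linear_combination ((radialWeight a t z : ℂ) * z ^ i) * (starRingEnd ℂ) z ^ j * hc
  simp_rw [hz, integral_neg] at h
  exact self_eq_neg.1 h.symm

theorem integral_radialWeight_mul_self {a t i : ℕ} (hi : a + i < t) :
    ∫ z : ℂ, ((radialWeight a t z : ℂ) * z ^ i) * (starRingEnd ℂ) z ^ i =
      ((π * ((a + i).factorial * (t - a - i - 1).factorial / t.factorial) : ℝ) : ℂ) := by
  obtain ⟨k, rfl⟩ := Nat.exists_eq_add_of_lt hi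
  have h1 := (integral_radialWeight (a + i) k).2
  have e : a + i + k + 1 - a - i - 1 = k := by omega
  rw [e, ← h1, ← integral_complex_ofReal]
  refine integral_congr_ae (Filter.Eventually.of_forall fun z => ?_)
  simp only
  rw [← radialWeight_mul_pow, mul_assoc, ← mul_pow, Complex.mul_conj, Complex.normSq_eq_norm_sq,
    pow_mul]
  push_cast
  rfl

/-- The eigenvalue weight as a product of two alternants, with the one-particle weight absorbed in
the first. -/
theorem eigWeight_eq_det {m : ℕ} (a t : ℕ) (z : Fin m → ℂ) :
    (eigWeight a t z : ℂ) =
      (Matrix.of fun i j : Fin m => (radialWeight a t (z i) : ℂ) * z i ^ (j : ℕ)).det *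
        (Matrix.of fun i j : Fin m => (starRingEnd ℂ) (z i) ^ (j : ℕ)).det := by
  have h1 : (Matrix.of fun i j : Fin m => (radialWeight a t (z i) : ℂ) * z i ^ (j : ℕ)).det =
      (∏ i, (radialWeight a t (z i) : ℂ)) * (Matrix.vandermonde z).det :=
    Matrix.det_mul_column (fun i => (radialWeight a t (z i) : ℂ)) (Matrix.vandermonde z)
  have h2 : (Matrix.of fun i j : Fin m => (starRingEnd ℂ) (z i) ^ (j : ℕ)).det =
      (starRingEnd ℂ) (Matrix.vandermonde z).det := by
    rw [RingHom.map_det]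
    congr 1
    ext i j
    simp [Matrix.vandermonde_apply]
  rw [h1, h2, mul_assoc, Complex.mul_conj, Complex.normSq_eq_norm_sq, eigWeight,
    vandermondeSq_eq_det]
  push_cast [radialWeight]
  rfl

theorem lintegral_eigWeight {a t m : ℕ} (h : a + m ≤ t) :
    ∫⁻ z : Fin m → ℂ, ENNReal.ofReal (eigWeight a t z) =
      ENNReal.ofReal (m.factorial * ∏ j ∈ Finset.range m,
        (π * ((a + j).factorial * (t - a - j - 1).factorial / t.factorial))) := by
  have hlt : ∀ j : Fin m, a + j < t := fun j => by have := j.2; omega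
  obtain ⟨hi, hv⟩ := andreief (volume : Measure ℂ)
    (fun (j : Fin m) z => (radialWeight a t z : ℂ) * z ^ (j : ℕ))
    (fun (j : Fin m) z => (starRingEnd ℂ) z ^ (j : ℕ))
    fun i j => integrable_radialWeight_mul (hlt i) (hlt j)
  rw [← volume_pi] at hi hv
  simp_rw [← eigWeight_eq_det] at hi hv
  have hi' : Integrable fun z : Fin m → ℂ => eigWeight a t z := by
    simpa using hi.re
  have hdiag : (Matrix.of fun i j : Fin m =>
      ∫ z : ℂ, ((radialWeight a t z : ℂ) * z ^ (i : ℕ)) * (starRingEnd ℂ) z ^ (j : ℕ)) =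
      Matrix.diagonal fun j : Fin m => ((π * ((a + j).factorial *
        (t - a - j - 1).factorial / t.factorial) : ℝ) : ℂ) := by
    ext i j
    rw [Matrix.diagonal_apply, Matrix.of_apply]
    split_ifs with hij
    · rw [hij, integral_radialWeight_mul_self (hlt j)]
    · exact integral_radialWeight_mul_of_ne a t fun hc => hij (Fin.ext hc)
  rw [hdiag, Matrix.det_diagonal, integral_complex_ofReal] at hv
  rw [← ofReal_integral_eq_lintegral_ofReal hi'
    (Filter.Eventually.of_forall fun z => eigWeight_nonneg a t z)]
  congr 1
  rw [Finset.prod_range]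
  exact_mod_cast hv

/-! ### The law of the eigenvalues -/

theorem eigenvalueNorm_eq {M N n : ℕ} (hN : M ≤ N) (hn : M ≤ n) :
    eigenvalueNorm M N n = M.factorial * ∏ j ∈ Finset.range M,
      (π * ((N - M + j).factorial * (n + N - M - (N - M) - j - 1).factorial /
        (n + N - M).factorial)) := by
  have h1 : ∀ j : ℕ, Real.Gamma ((N : ℝ) - M + 1 + j) = (N - M + j).factorial := fun j => by
    rw [← Real.Gamma_nat_eq_factorial]; push_cast [hN]; ring_nf
  have h2 : ∀ j : ℕ, Real.Gamma ((n : ℝ) - M + 1 + j) = (n - M + j).factorial := fun j => by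
    rw [← Real.Gamma_nat_eq_factorial]; push_cast [hn]; ring_nf
  have h3 : Real.Gamma ((n : ℝ) + N - M + 1) = (n + N - M).factorial := by
    rw [← Real.Gamma_nat_eq_factorial]; push_cast [hN.trans (Nat.le_add_left N n)]; ring_nf
  rw [eigenvalueNorm]
  simp only [h1, h2, h3, Finset.prod_mul_distrib, Finset.prod_div_distrib, Finset.prod_const,
    Finset.card_range]
  -- The second gamma factors occur in the opposite order in the norms of the monomials.
  rw [← Finset.prod_range_reflect (fun j => ((n - M + j).factorial : ℝ))]
  have h4 : ∏ j ∈ Finset.range M, ((n - M + (M - 1 - j)).factorial : ℝ) =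
      ∏ j ∈ Finset.range M, ((n + N - M - (N - M) - j - 1).factorial : ℝ) := by
    refine Finset.prod_congr rfl fun j hj => ?_
    have := Finset.mem_range.1 hj
    congr 2
    omega
  rw [h4]
  ring

theorem eigenvalueNorm_pos {M N n : ℕ} (hN : M ≤ N) (hn : M ≤ n) : 0 < eigenvalueNorm M N n := by
  rw [eigenvalueNorm_eq hN hn]
  refine mul_pos (by positivity) (Finset.prod_pos fun j _ => by positivity)

theorem schurConst_mul_eigenvalueNorm {M N : ℕ} (n : ℕ) (hN : M ≤ N) :
    schurConst (n + N - M) M * eigenvalueNorm M N n = elementNorm M N n := by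
  have h1 : ∀ j : ℕ, Real.Gamma ((n : ℝ) + N - M + 1 + j) =
      (j + (n + N - M)).factorial := fun j => by
    rw [← Real.Gamma_nat_eq_factorial]
    push_cast [hN.trans (Nat.le_add_left N n)]
    ring_nf
  have h2 : Real.Gamma ((n : ℝ) + N - M + 1) = (n + N - M).factorial := by
    simpa using h1 0
  have h3 : ∀ j : ℕ, Real.Gamma (1 + (j : ℝ)) = j.factorial := fun j => by
    rw [← Real.Gamma_nat_eq_factorial, add_comm]
  have h4 : ∏ j ∈ Finset.range M, ((j + 1).factorial : ℝ) =
      M.factorial * ∏ j ∈ Finset.range M, (j.factorial : ℝ) := by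
    rw [mul_comm, ← Finset.prod_range_succ, Finset.prod_range_succ']
    simp
  have h5 : ∀ m : ℕ, ∏ j ∈ Finset.range m, π ^ (2 * j) * π = π ^ (m ^ 2) := by
    intro m
    induction m with
    | zero => simp
    | succ k ih =>
      rw [Finset.prod_range_succ, ih]
      ring
  have h6 : ∏ j ∈ Finset.range M, (j.factorial : ℝ) ≠ 0 :=
    Finset.prod_ne_zero_iff.2 fun j _ => by positivity
  have h7 : ((n + N - M).factorial : ℝ) ≠ 0 := by positivity
  have h8 : (M.factorial : ℝ) ≠ 0 := by positivity
  rw [schurConst, eigenvalueNorm, elementNorm, ← h5]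
  simp only [h1, h2, h3, Finset.prod_mul_distrib, Finset.prod_div_distrib, Finset.prod_const,
    Finset.card_range, h4]
  field_simp

theorem elementNorm_pos {M N n : ℕ} (hN : M ≤ N) (hn : M ≤ n) : 0 < elementNorm M N n := by
  rw [← schurConst_mul_eigenvalueNorm n hN]
  exact mul_pos (schurConst_pos _ _) (eigenvalueNorm_pos hN hn)

theorem ofReal_elementDensity {M N n : ℕ} (hN : M ≤ N) (hn : M ≤ n)
    (A : Matrix (Fin M) (Fin M) ℂ) :
    ENNReal.ofReal (elementDensity M N n A) = ENNReal.ofReal (1 / elementNorm M N n) *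
      gramWeight (N - M) (M + (n + N - M)) A := by
  have h := elementNorm_pos hN hn
  have e : M + (n + N - M) = n + N := by omega
  rw [elementDensity, gramWeight, e, ENNReal.ofReal_mul (by positivity), re_det_gram, pow_mul]
  rfl

theorem eigenvalueDensity_eq {M N n : ℕ} (z : Fin M → ℂ) :
    eigenvalueDensity M N n z =
      1 / eigenvalueNorm M N n * eigWeight (N - M) (n + N - M) z := by
  rw [eigenvalueDensity, eigWeight, vandermondeSq, mul_assoc]

theorem lintegral_eigenvalues_elementLaw {M N n : ℕ} (hN : M ≤ N) (hn : M ≤ n)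
    {h : Sym ℂ M → ENNReal} (hh : Measurable h) :
    ∫⁻ G, h (eigenvalues (Matrix.of G)) ∂(elementLaw M N n) =
      ∫⁻ z : Fin M → ℂ, ENNReal.ofReal (eigenvalueDensity M N n z) * h (unordered z) := by
  have hC := eigenvalueNorm_pos hN hn
  have hE := elementNorm_pos hN hn
  have hS := schurConst_pos (n + N - M) M
  have hm1 := measurable_gramWeight (m := M) (N - M) (M + (n + N - M))
  have hm2 : Measurable fun G : Fin M → Fin M → ℂ => h (eigenvalues (Matrix.of G)) :=
    hh.comp (measurable_eigenvalues M)
  have hm3 : Measurable fun G : Fin M → Fin M → ℂ => ENNReal.ofReal (1 / elementNorm M N n) *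
      gramWeight (N - M) (M + (n + N - M)) (Matrix.of G) := hm1.const_mul _
  simp only [elementLaw, ofReal_elementDensity hN hn, eigenvalueDensity_eq]
  rw [lintegral_withDensity_eq_lintegral_mul _ hm3 hm2]
  simp only [Pi.mul_apply, mul_assoc]
  rw [lintegral_const_mul' _ _ ENNReal.ofReal_ne_top, lintegral_gramWeight_eigenvalues _ _ _ hh,
    ← mul_assoc, ← ENNReal.ofReal_mul (by positivity), ← schurConst_mul_eigenvalueNorm n hN,
    ← lintegral_const_mul' _ _ ENNReal.ofReal_ne_top]
  refine lintegral_congr fun z => ?_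
  have e : 1 / (schurConst (n + N - M) M * eigenvalueNorm M N n) * schurConst (n + N - M) M =
      1 / eigenvalueNorm M N n := by
    field_simp
  rw [e, ENNReal.ofReal_mul (by positivity), mul_assoc]

theorem lintegral_eigenvalueDensity {M N n : ℕ} (hN : M ≤ N) (hn : M ≤ n) :
    ∫⁻ z : Fin M → ℂ, ENNReal.ofReal (eigenvalueDensity M N n z) = 1 := by
  have hC := eigenvalueNorm_pos hN hn
  simp only [eigenvalueDensity_eq, ENNReal.ofReal_mul (one_div_pos.2 hC).le]
  rw [lintegral_const_mul' _ _ ENNReal.ofReal_ne_top, lintegral_eigWeight (by omega),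
    ← eigenvalueNorm_eq hN hn, ← ENNReal.ofReal_mul (by positivity),
    one_div_mul_cancel hC.ne', ENNReal.ofReal_one]

theorem isProbabilityMeasure_elementLaw {M N n : ℕ} (hN : M ≤ N) (hn : M ≤ n) :
    IsProbabilityMeasure (elementLaw M N n) := by
  have h := lintegral_eigenvalues_elementLaw hN hn (h := fun _ => 1) measurable_const
  simp only [mul_one, lintegral_one, lintegral_eigenvalueDensity hN hn] at h
  exact ⟨h⟩

theorem map_eigenvalues_elementLaw {M N n : ℕ} (hN : M ≤ N) (hn : M ≤ n) :
    (elementLaw M N n).map (fun G => eigenvalues (Matrix.of G)) =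
      (volume.withDensity fun z : Fin M → ℂ =>
        ENNReal.ofReal (eigenvalueDensity M N n z)).map unordered := by
  have hm : Measurable fun z : Fin M → ℂ => ENNReal.ofReal (eigenvalueDensity M N n z) := by
    simp only [eigenvalueDensity_eq]
    exact ENNReal.measurable_ofReal.comp ((measurable_eigWeight _ _).const_mul _)
  refine Measure.ext_of_lintegral _ fun h hh => ?_
  have hu : Measurable fun z : Fin M → ℂ => h (unordered z) := hh.comp (measurable_unordered M)
  rw [lintegral_map hh (measurable_eigenvalues M), lintegral_map hh (measurable_unordered M),
    lintegral_eigenvalues_elementLaw hN hn hh, lintegral_withDensity_eq_lintegral_mul _ hm hu]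
  rfl

theorem vandermondeSq_comp_perm {m : ℕ} (σ : Equiv.Perm (Fin m)) (z : Fin m → ℂ) :
    vandermondeSq (z ∘ σ) = vandermondeSq z := by
  have h : Matrix.vandermonde (z ∘ σ) = (Matrix.vandermonde z).submatrix σ id := rfl
  rw [vandermondeSq_eq_det, vandermondeSq_eq_det, h, Matrix.det_permute, norm_mul]
  rcases Int.units_eq_one_or (Equiv.Perm.sign σ) with h | h <;> simp [h]

theorem hasEigenvaluePDF_of_hasLaw {Ω : Type*} [MeasurableSpace Ω] {P : Measure Ω} {M N n : ℕ}
    (hN : M ≤ N) (hn : M ≤ n) {G : Ω → Matrix (Fin M) (Fin M) ℂ}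
    (hG : HasLaw (fun ω i j => G ω i j) (elementLaw M N n) P) :
    HasEigenvaluePDF G (eigenvalueDensity M N n) P := by
  have hC := eigenvalueNorm_pos hN hn
  refine ⟨?_, fun z => ?_, fun σ z => ?_, ?_⟩
  · have : Measurable fun z : Fin M → ℂ => 1 / eigenvalueNorm M N n *
        eigWeight (N - M) (n + N - M) z := (measurable_eigWeight _ _).const_mul _
    simpa only [← eigenvalueDensity_eq] using this
  · rw [eigenvalueDensity_eq]
    exact mul_nonneg (by positivity) (eigWeight_nonneg _ _ _)
  · rw [eigenvalueDensity_eq, eigenvalueDensity_eq, eigWeight, eigWeight,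
      vandermondeSq_comp_perm]
    congr 2
    exact Equiv.prod_comp σ fun j =>
      ‖z j‖ ^ (2 * (N - M)) / (1 + ‖z j‖ ^ 2) ^ (n + N - M + 1)
  · have h1 : HasLaw (fun G : Fin M → Fin M → ℂ => eigenvalues (Matrix.of G))
        ((volume.withDensity fun z : Fin M → ℂ =>
          ENNReal.ofReal (eigenvalueDensity M N n z)).map unordered) (elementLaw M N n) :=
      ⟨(measurable_eigenvalues M).aemeasurable, map_eigenvalues_elementLaw hN hn⟩
    exact h1.comp hG

/-! ### The potential of the neutralizing background -/

/-- Jensen's formula for a linear function on a circle about the origin. The circle may degenerate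
to a point. -/
theorem integral_log_norm_circle_sub {x y : ℝ} (hx : 0 ≤ x) (hy : 0 ≤ y) (ψ : ℝ) :
    ∫ φ in (0 : ℝ)..(2 * π), Real.log ‖(x : ℂ) * Complex.exp (φ * Complex.I) -
      y * Complex.exp (ψ * Complex.I)‖ = 2 * π * Real.log (max x y) := by
  have hyn : ‖(y : ℂ) * Complex.exp (ψ * Complex.I)‖ = y := by
    rw [norm_mul, Complex.norm_exp_ofReal_mul_I, mul_one, Complex.norm_real,
      Real.norm_of_nonneg hy]
  rcases hx.eq_or_lt with rfl | hx
  · simp only [Complex.ofReal_zero, zero_mul, zero_sub, norm_neg, hyn]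
    rw [intervalIntegral.integral_const, max_eq_right hy, smul_eq_mul, sub_zero]
  · have h := circleAverage_log_norm_sub_const_eq_log_radius_add_posLog
      (c := 0) (a := (y : ℂ) * Complex.exp (ψ * Complex.I)) hx.ne'
    rw [zero_sub, norm_neg, hyn, Real.circleAverage_def, smul_eq_mul, inv_mul_eq_iff_eq_mul₀
      Real.two_pi_pos.ne'] at h
    simp only [circleMap, zero_add] at h
    rw [h, Real.posLog_eq_log_max_one (by positivity), ← Real.log_mul hx.ne' (by positivity),
      mul_max_of_nonneg _ _ hx.le, mul_one, mul_inv_cancel_left₀ hx.ne']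

theorem norm_ckU {p : ℝ × ℝ} (hp : p.1 ∈ Set.Icc 0 π) : ‖ckU p‖ = Real.cos (p.1 / 2) := by
  have h : Complex.I * p.2 / 2 = ((p.2 / 2 : ℝ) : ℂ) * Complex.I := by push_cast; ring
  rw [ckU, norm_mul, h, Complex.norm_exp_ofReal_mul_I, mul_one, Complex.norm_real,
    Real.norm_of_nonneg (Real.cos_nonneg_of_mem_Icc ⟨by linarith [hp.1, Real.pi_pos],
      by linarith [hp.2]⟩)]

theorem norm_ckV {p : ℝ × ℝ} (hp : p.1 ∈ Set.Icc 0 π) : ‖ckV p‖ = Real.sin (p.1 / 2) := by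
  have h : -Complex.I * p.2 / 2 = ((-(p.2 / 2) : ℝ) : ℂ) * Complex.I := by push_cast; ring
  rw [ckV, norm_mul, h, Complex.norm_exp_ofReal_mul_I, mul_one, norm_mul, norm_neg,
    Complex.norm_I, one_mul, Complex.norm_real,
    Real.norm_of_nonneg (Real.sin_nonneg_of_nonneg_of_le_pi (by linarith [hp.1])
      (by linarith [hp.1, hp.2]))]

/-- The chordal distance as the distance of a point on a circle about the origin, with the azimuth
of `p'` as its angle, from a point with the azimuth of `p`. -/
theorem chordalDist_eq_norm {R : ℝ} (hR : 0 ≤ R) (p p' : ℝ × ℝ) :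
    chordalDist R p p' =
      ‖((2 * R * (Real.cos (p'.1 / 2) * Real.sin (p.1 / 2)) : ℝ) : ℂ) *
          Complex.exp (p'.2 * Complex.I) -
        ((2 * R * (Real.cos (p.1 / 2) * Real.sin (p'.1 / 2)) : ℝ) : ℂ) *
          Complex.exp (p.2 * Complex.I)‖ := by
  have e1 : Complex.exp (p'.2 * Complex.I) = Complex.exp (Complex.I * p'.2 / 2) *
      Complex.exp (-Complex.I * p.2 / 2) * Complex.exp (((p.2 + p'.2) / 2 : ℝ) * Complex.I) := by
    rw [← Complex.exp_add, ← Complex.exp_add]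
    congr 1
    push_cast
    ring
  have e2 : Complex.exp (p.2 * Complex.I) = Complex.exp (Complex.I * p.2 / 2) *
      Complex.exp (-Complex.I * p'.2 / 2) * Complex.exp (((p.2 + p'.2) / 2 : ℝ) * Complex.I) := by
    rw [← Complex.exp_add, ← Complex.exp_add]
    congr 1
    push_cast
    ring
  have e3 : ((2 * R * (Real.cos (p'.1 / 2) * Real.sin (p.1 / 2)) : ℝ) : ℂ) *
          Complex.exp (p'.2 * Complex.I) -
        ((2 * R * (Real.cos (p.1 / 2) * Real.sin (p'.1 / 2)) : ℝ) : ℂ) *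
          Complex.exp (p.2 * Complex.I) =
      ((2 * R : ℝ) : ℂ) * (Complex.I * (ckU p' * ckV p - ckU p * ckV p') *
        Complex.exp (((p.2 + p'.2) / 2 : ℝ) * Complex.I)) := by
    rw [e1, e2, ckU, ckU, ckV, ckV]
    generalize Complex.exp (((p.2 + p'.2) / 2 : ℝ) * Complex.I) = E
    push_cast
    linear_combination (-2 * R * E * (Complex.cos (p'.1 / 2) * Complex.sin (p.1 / 2) *
      Complex.exp (Complex.I * p'.2 / 2) * Complex.exp (-Complex.I * p.2 / 2) -
      Complex.cos (p.1 / 2) * Complex.sin (p'.1 / 2) * Complex.exp (Complex.I * p.2 / 2) *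
      Complex.exp (-Complex.I * p'.2 / 2))) * -Complex.I_sq
  rw [e3, norm_mul, Complex.norm_real, Real.norm_of_nonneg (by positivity), norm_mul,
    Complex.norm_exp_ofReal_mul_I, mul_one, norm_mul, Complex.norm_I, one_mul, chordalDist]

/-- The azimuthal integration in the background potential. -/
theorem backgroundPotential_eq_integral {K : ℕ} {R Q q : ℝ} (hR : 0 < R) {p : ℝ × ℝ}
    (hp : p.1 ∈ Set.Icc (thetaNorth Q q) (thetaSouth Q q)) :
    backgroundPotential K R Q q p = K * (1 + Q + q) / 2 *
      ∫ θ in (thetaNorth Q q)..(thetaSouth Q q), Real.sin θ *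
        Real.log (max (2 * R * (Real.cos (θ / 2) * Real.sin (p.1 / 2)))
          (2 * R * (Real.cos (p.1 / 2) * Real.sin (θ / 2)))) := by
  have hN : 0 ≤ thetaNorth Q q := Real.arccos_nonneg _
  have hS : thetaSouth Q q ≤ π := sub_le_self _ (Real.arccos_nonneg _)
  have cos_half : ∀ θ ∈ Set.Icc 0 π, 0 ≤ Real.cos (θ / 2) := fun θ h =>
    Real.cos_nonneg_of_mem_Icc ⟨by linarith [h.1, Real.pi_pos], by linarith [h.2]⟩
  have sin_half : ∀ θ ∈ Set.Icc 0 π, 0 ≤ Real.sin (θ / 2) := fun θ h =>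
    Real.sin_nonneg_of_nonneg_of_le_pi (by linarith [h.1]) (by linarith [h.1, h.2])
  have hp' : p.1 ∈ Set.Icc 0 π := ⟨hN.trans hp.1, hp.2.trans hS⟩
  rw [backgroundPotential, annulusIntegral, ← intervalIntegral.integral_const_mul]
  refine intervalIntegral.integral_congr fun θ hθ => ?_
  rw [Set.uIcc_of_le (hp.1.trans hp.2)] at hθ
  have hθ' : θ ∈ Set.Icc 0 π := ⟨hN.trans hθ.1, hθ.2.trans hS⟩
  have h := integral_log_norm_circle_sub (x := 2 * R * (Real.cos (θ / 2) * Real.sin (p.1 / 2)))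
    (y := 2 * R * (Real.cos (p.1 / 2) * Real.sin (θ / 2)))
    (mul_nonneg (by positivity) (mul_nonneg (cos_half _ hθ') (sin_half _ hp')))
    (mul_nonneg (by positivity) (mul_nonneg (cos_half _ hp') (sin_half _ hθ'))) p.2
  have hf : ∀ φ : ℝ, -rhoB K R Q q * pairPotential R p (θ, φ) * (R ^ 2 * Real.sin θ) =
      rhoB K R Q q * R ^ 2 * Real.sin θ * Real.log (chordalDist R p (θ, φ)) := fun φ => by
    rw [pairPotential]; ring
  simp only [hf, chordalDist_eq_norm hR.le, intervalIntegral.integral_const_mul, h]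
  rw [rhoB]
  field_simp
  ring

/-- `log cos(θ/2)` integrated against `sin θ dθ`. The integrand is written so that it is visibly
continuous where the cosine vanishes. -/
theorem integral_sin_mul_log_cos {a b : ℝ} (ha : 0 ≤ a) (hab : a ≤ b) (hb : b ≤ π) :
    ∫ θ in a..b, 2 * Real.sin (θ / 2) * (Real.cos (θ / 2) * Real.log (Real.cos (θ / 2))) =
      (2 * (Real.cos (a / 2) * (Real.cos (a / 2) * Real.log (Real.cos (a / 2)))) -
          Real.cos (a / 2) ^ 2) -
        (2 * (Real.cos (b / 2) * (Real.cos (b / 2) * Real.log (Real.cos (b / 2)))) -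
          Real.cos (b / 2) ^ 2) := by
  have hc : Continuous fun θ : ℝ => Real.cos (θ / 2) * Real.log (Real.cos (θ / 2)) :=
    Real.continuous_mul_log.comp (by fun_prop : Continuous fun θ : ℝ => Real.cos (θ / 2))
  have h := intervalIntegral.integral_eq_sub_of_hasDerivAt_of_le hab
    (f := fun θ => -(2 * (Real.cos (θ / 2) * (Real.cos (θ / 2) * Real.log (Real.cos (θ / 2)))) -
          Real.cos (θ / 2) ^ 2))
    (f' := fun θ => 2 * Real.sin (θ / 2) * (Real.cos (θ / 2) * Real.log (Real.cos (θ / 2))))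
    (by fun_prop) (fun θ hθ => ?_)
    (Continuous.intervalIntegrable (by fun_prop) _ _)
  · rw [h]; ring
  · have hpos : 0 < Real.cos (θ / 2) := Real.cos_pos_of_mem_Ioo
      ⟨by linarith [hθ.1, Real.pi_pos], by linarith [hθ.2]⟩
    have h1 : HasDerivAt (fun θ : ℝ => Real.cos (θ / 2)) (-Real.sin (θ / 2) * (1 / 2)) θ :=
      ((hasDerivAt_id θ).div_const 2).cos
    refine (((h1.mul (h1.mul (h1.log hpos.ne'))).const_mul 2).sub (h1.pow 2)).neg.congr_deriv ?_
    simp only [Pi.mul_apply]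
    field_simp
    ring

theorem integral_sin_mul_log_sin {a b : ℝ} (ha : 0 ≤ a) (hab : a ≤ b) (hb : b ≤ π) :
    ∫ θ in a..b, 2 * Real.cos (θ / 2) * (Real.sin (θ / 2) * Real.log (Real.sin (θ / 2))) =
      (2 * (Real.sin (b / 2) * (Real.sin (b / 2) * Real.log (Real.sin (b / 2)))) -
          Real.sin (b / 2) ^ 2) -
        (2 * (Real.sin (a / 2) * (Real.sin (a / 2) * Real.log (Real.sin (a / 2)))) -
          Real.sin (a / 2) ^ 2) := by
  have h := integral_sin_mul_log_cos (a := π - b) (b := π - a) (by linarith) (by linarith)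
    (by linarith)
  have e : ∀ θ : ℝ, (π - θ) / 2 = π / 2 - θ / 2 := fun θ => by ring
  rw [← intervalIntegral.integral_comp_sub_left (fun θ => 2 * Real.sin (θ / 2) *
    (Real.cos (θ / 2) * Real.log (Real.cos (θ / 2)))) π] at h
  simpa only [e, Real.cos_pi_div_two_sub, Real.sin_pi_div_two_sub] using h

theorem cos_thetaNorth {Q q : ℝ} (hQ : 0 ≤ Q) (hq : 0 ≤ q) :
    Real.cos (thetaNorth Q q) = 1 - 2 * (Q / (1 + q + Q)) := by
  have h0 : 0 ≤ Q / (1 + q + Q) := by positivity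
  have h1 : Q / (1 + q + Q) ≤ 1 := (div_le_one (by positivity)).2 (by linarith)
  rw [thetaNorth, capAngle, Real.cos_arccos (by linarith) (by linarith)]

theorem cos_thetaSouth {Q q : ℝ} (hQ : 0 ≤ Q) (hq : 0 ≤ q) :
    Real.cos (thetaSouth Q q) = 2 * (q / (1 + q + Q)) - 1 := by
  have h0 : 0 ≤ q / (1 + q + Q) := by positivity
  have h1 : q / (1 + q + Q) ≤ 1 := (div_le_one (by positivity)).2 (by linarith)
  rw [thetaSouth, Real.cos_pi_sub, capAngle, Real.cos_arccos (by linarith) (by linarith)]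
  ring

/-- The part of the annulus north of the particle acts through `sin (ϑ / 2)` and the part south of
it through `cos (ϑ / 2)`, with strengths that depend on the particle only through `cos ϑ`. -/
theorem integral_sin_mul_log_max {R a b ϑ : ℝ} (hR : 0 < R) (ha : 0 ≤ a) (hb : b ≤ π)
    (hϑ : ϑ ∈ Set.Icc a b) :
    ∫ θ in a..b, Real.sin θ * Real.log (max (2 * R * (Real.cos (θ / 2) * Real.sin (ϑ / 2)))
          (2 * R * (Real.cos (ϑ / 2) * Real.sin (θ / 2)))) =
      Real.log (2 * R) * (Real.cos a - Real.cos b) + 1 +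
        (2 * (Real.cos (a / 2) * (Real.cos (a / 2) * Real.log (Real.cos (a / 2)))) -
          Real.cos (a / 2) ^ 2) +
        (2 * (Real.sin (b / 2) * (Real.sin (b / 2) * Real.log (Real.sin (b / 2)))) -
          Real.sin (b / 2) ^ 2) -
        (1 - Real.cos a) * Real.log (Real.sin (ϑ / 2)) -
        (1 + Real.cos b) * Real.log (Real.cos (ϑ / 2)) := by
  have hsin : ∀ θ : ℝ, Real.sin θ = 2 * Real.sin (θ / 2) * Real.cos (θ / 2) := fun θ => by
    rw [← Real.sin_two_mul]; ring_nf
  have cos_pos : ∀ θ, 0 ≤ θ → θ < π → 0 < Real.cos (θ / 2) := fun θ h h' =>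
    Real.cos_pos_of_mem_Ioo ⟨by linarith [Real.pi_pos], by linarith⟩
  have sin_pos : ∀ θ, 0 < θ → θ ≤ π → 0 < Real.sin (θ / 2) := fun θ h h' =>
    Real.sin_pos_of_pos_of_lt_pi (by linarith) (by linarith [Real.pi_pos])
  have hle : ∀ θ θ', 0 ≤ θ → θ ≤ θ' → θ' ≤ π →
      Real.cos (θ' / 2) * Real.sin (θ / 2) ≤ Real.cos (θ / 2) * Real.sin (θ' / 2) := by
    intro θ θ' h0 h1 h2
    have : 0 ≤ Real.sin (θ' / 2 - θ / 2) :=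
      Real.sin_nonneg_of_nonneg_of_le_pi (by linarith) (by linarith)
    rw [Real.sin_sub] at this
    linarith
  have hc : Continuous fun θ : ℝ => Real.cos (θ / 2) * Real.log (Real.cos (θ / 2)) :=
    Real.continuous_mul_log.comp (by fun_prop : Continuous fun θ : ℝ => Real.cos (θ / 2))
  have hs : Continuous fun θ : ℝ => Real.sin (θ / 2) * Real.log (Real.sin (θ / 2)) :=
    Real.continuous_mul_log.comp (by fun_prop : Continuous fun θ : ℝ => Real.sin (θ / 2))
  have hϑ0 : 0 ≤ ϑ := ha.trans hϑ.1
  have hϑ1 : ϑ ≤ π := hϑ.2.trans hb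
  have hnorth : Set.EqOn (fun θ => Real.sin θ * Real.log
      (max (2 * R * (Real.cos (θ / 2) * Real.sin (ϑ / 2)))
          (2 * R * (Real.cos (ϑ / 2) * Real.sin (θ / 2)))))
      (fun θ => (Real.log (2 * R) + Real.log (Real.sin (ϑ / 2))) * Real.sin θ +
        2 * Real.sin (θ / 2) * (Real.cos (θ / 2) * Real.log (Real.cos (θ / 2))))
      (Set.uIcc a ϑ) := by
    intro θ hθ
    rw [Set.uIcc_of_le hϑ.1] at hθ
    have hθ0 : 0 ≤ θ := ha.trans hθ.1
    simp only
    rw [max_eq_left (mul_le_mul_of_nonneg_left (hle θ ϑ hθ0 hθ.2 hϑ1 |> fun h => by linarith)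
      (by positivity))]
    -- At the poles a logarithm may take its default value, but the sine vanishes on both sides.
    rcases hθ0.eq_or_lt with rfl | hpos
    · simp
    rcases (hθ.2.trans hϑ1).eq_or_lt with rfl | hlt
    · simp
    have h1 := (cos_pos θ hθ0 hlt).ne'
    have h2 := (sin_pos ϑ (hpos.trans_le hθ.2) hϑ1).ne'
    rw [Real.log_mul (by positivity) (mul_ne_zero h1 h2), Real.log_mul h1 h2, hsin θ]
    ring
  have hsouth : Set.EqOn (fun θ => Real.sin θ * Real.log
      (max (2 * R * (Real.cos (θ / 2) * Real.sin (ϑ / 2)))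
          (2 * R * (Real.cos (ϑ / 2) * Real.sin (θ / 2)))))
      (fun θ => (Real.log (2 * R) + Real.log (Real.cos (ϑ / 2))) * Real.sin θ +
        2 * Real.cos (θ / 2) * (Real.sin (θ / 2) * Real.log (Real.sin (θ / 2))))
      (Set.uIcc ϑ b) := by
    intro θ hθ
    rw [Set.uIcc_of_le hϑ.2] at hθ
    have hθ0 : 0 ≤ θ := hϑ0.trans hθ.1
    simp only
    rw [max_eq_right (mul_le_mul_of_nonneg_left (hle ϑ θ hϑ0 hθ.1 (hθ.2.trans hb))
      (by positivity))]
    rcases hθ0.eq_or_lt with rfl | hpos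
    · simp
    rcases (hθ.2.trans hb).eq_or_lt with rfl | hlt
    · simp
    have h1 := (cos_pos ϑ hϑ0 (hθ.1.trans_lt hlt)).ne'
    have h2 := (sin_pos θ hpos hlt.le).ne'
    rw [Real.log_mul (by positivity) (mul_ne_zero h1 h2), Real.log_mul h1 h2, hsin θ]
    ring
  have i1 : IntervalIntegrable (fun θ => (Real.log (2 * R) + Real.log (Real.sin (ϑ / 2))) *
      Real.sin θ) volume a ϑ := Continuous.intervalIntegrable (by fun_prop) _ _
  have i2 : IntervalIntegrable (fun θ => 2 * Real.sin (θ / 2) *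
      (Real.cos (θ / 2) * Real.log (Real.cos (θ / 2)))) volume a ϑ :=
    Continuous.intervalIntegrable (by fun_prop) _ _
  have i3 : IntervalIntegrable (fun θ => (Real.log (2 * R) + Real.log (Real.cos (ϑ / 2))) *
      Real.sin θ) volume ϑ b := Continuous.intervalIntegrable (by fun_prop) _ _
  have i4 : IntervalIntegrable (fun θ => 2 * Real.cos (θ / 2) *
      (Real.sin (θ / 2) * Real.log (Real.sin (θ / 2)))) volume ϑ b :=
    Continuous.intervalIntegrable (by fun_prop) _ _
  rw [← intervalIntegral.integral_add_adjacent_intervals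
    ((i1.add i2).congr (hnorth.symm.mono Set.uIoc_subset_uIcc))
    ((i3.add i4).congr (hsouth.symm.mono Set.uIoc_subset_uIcc)),
    intervalIntegral.integral_congr hnorth, intervalIntegral.integral_congr hsouth,
    intervalIntegral.integral_add i1 i2, intervalIntegral.integral_add i3 i4,
    intervalIntegral.integral_const_mul, intervalIntegral.integral_const_mul, integral_sin,
    integral_sin, integral_sin_mul_log_cos ha hϑ.1 hϑ1, integral_sin_mul_log_sin hϑ0 hϑ.2 hb]
  have hc2 : Real.cos ϑ = 2 * Real.cos (ϑ / 2) ^ 2 - 1 := by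
    rw [← Real.cos_two_mul]; ring_nf
  have hsc := Real.sin_sq_add_cos_sq (ϑ / 2)
  rw [hc2]
  linear_combination (1 - 2 * Real.log (Real.sin (ϑ / 2))) * hsc

/-- Up to a constant, the background acts on a particle of the annulus like charges `Q K` and
`q K` at the two poles. -/
theorem exists_backgroundPotential_eq (K : ℕ) {R Q q : ℝ} (hR : 0 < R) (hQ : 0 ≤ Q)
    (hq : 0 ≤ q) : ∃ C : ℝ, ∀ p : ℝ × ℝ, p.1 ∈ Set.Icc (thetaNorth Q q) (thetaSouth Q q) →
      backgroundPotential K R Q q p = C - Q * K * Real.log (Real.sin (p.1 / 2)) -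
        q * K * Real.log (Real.cos (p.1 / 2)) := by
  refine ⟨K * (1 + Q + q) / 2 * (Real.log (2 * R) *
      (Real.cos (thetaNorth Q q) - Real.cos (thetaSouth Q q)) + 1 +
        (2 * (Real.cos (thetaNorth Q q / 2) * (Real.cos (thetaNorth Q q / 2) *
          Real.log (Real.cos (thetaNorth Q q / 2)))) - Real.cos (thetaNorth Q q / 2) ^ 2) +
        (2 * (Real.sin (thetaSouth Q q / 2) * (Real.sin (thetaSouth Q q / 2) *
          Real.log (Real.sin (thetaSouth Q q / 2)))) - Real.sin (thetaSouth Q q / 2) ^ 2)),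
    fun p hp => ?_⟩
  rw [backgroundPotential_eq_integral hR hp, integral_sin_mul_log_max hR
    (show 0 ≤ thetaNorth Q q from Real.arccos_nonneg _)
    (show thetaSouth Q q ≤ π from sub_le_self _ (Real.arccos_nonneg _)) hp, cos_thetaNorth hQ hq,
    cos_thetaSouth hQ hq]
  have : 1 + q + Q ≠ 0 := by positivity
  field_simp
  ring

/-! ### The Boltzmann factor -/

theorem rpow_eq_exp_of_pos_or {s x : ℝ} (h : 0 < s ∨ x = 0) :
    s ^ x = Real.exp (x * Real.log s) := by
  rcases h with h | rfl
  · rw [Real.rpow_def_of_pos h, mul_comm]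
  · simp

/-- On the annulus the weight is the Boltzmann factor at inverse temperature `2`. -/
theorem exists_plasmaWeight_eq (K : ℕ) {R Q q : ℝ} (hR : 0 < R) (hQ : 0 ≤ Q) (hq : 0 ≤ q) :
    ∃ c : ℝ, 0 < c ∧ ∀ p : Fin K → ℝ × ℝ,
      (∀ j, (p j).1 ∈ Set.Icc (thetaNorth Q q) (thetaSouth Q q)) →
      (∀ j k, j ≠ k → chordalDist R (p j) (p k) ≠ 0) →
      plasmaWeight 2 K Q q p = c * boltzmannFactor 2 K R Q q p := by
  obtain ⟨C, hC⟩ := exists_backgroundPotential_eq K hR hQ hq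
  set E : ℝ := 1 / 2 * annulusIntegral R Q q fun p' =>
    -rhoB K R Q q * backgroundPotential K R Q q p' with hE
  have hden : 0 < ∏ k : Fin K, ∏ _j ∈ Finset.Iio k, (2 * R) ^ 2 :=
    Finset.prod_pos fun _ _ => Finset.prod_pos fun _ _ => by positivity
  refine ⟨Real.exp (2 * E) * Real.exp (2 * C) ^ K /
    ∏ k : Fin K, ∏ _j ∈ Finset.Iio k, (2 * R) ^ 2, by positivity, fun p hp hne => ?_⟩
  have hN : 0 ≤ thetaNorth Q q := Real.arccos_nonneg _
  have hS : thetaSouth Q q ≤ π := sub_le_self _ (Real.arccos_nonneg _)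
  have hone : ∀ l, ‖ckV (p l)‖ ^ (2 * Q * K) * ‖ckU (p l)‖ ^ (2 * q * K) =
      Real.exp (2 * C) * Real.exp (-2 * backgroundPotential K R Q q (p l)) := by
    intro l
    have hl : (p l).1 ∈ Set.Icc 0 π := ⟨hN.trans (hp l).1, (hp l).2.trans hS⟩
    -- A particle can only sit at a pole that carries no charge.
    have hs : 0 < Real.sin ((p l).1 / 2) ∨ 2 * Q * K = 0 := by
      rcases hl.1.eq_or_lt with h0 | h0
      · right
        have h1 : thetaNorth Q q = 0 := le_antisymm ((hp l).1.trans h0.ge) hN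
        have h2 := cos_thetaNorth hQ hq
        rw [h1, Real.cos_zero] at h2
        have h3 : Q / (1 + q + Q) = 0 := by linarith
        rcases div_eq_zero_iff.1 h3 with h | h
        · simp [h]
        · linarith
      · exact Or.inl (Real.sin_pos_of_pos_of_lt_pi (by linarith) (by linarith [hl.2]))
    have hc : 0 < Real.cos ((p l).1 / 2) ∨ 2 * q * K = 0 := by
      rcases hl.2.eq_or_lt with h0 | h0
      · right
        have h1 : thetaSouth Q q = π := le_antisymm hS (h0.ge.trans (hp l).2)
        have h2 := cos_thetaSouth hQ hq
        rw [h1, Real.cos_pi] at h2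
        have h3 : q / (1 + q + Q) = 0 := by linarith
        rcases div_eq_zero_iff.1 h3 with h | h
        · simp [h]
        · linarith
      · exact Or.inl (Real.cos_pos_of_mem_Ioo ⟨by linarith [hl.1, Real.pi_pos], by linarith⟩)
    rw [norm_ckU hl, norm_ckV hl, rpow_eq_exp_of_pos_or hs, rpow_eq_exp_of_pos_or hc,
      hC _ (hp l), ← Real.exp_add, ← Real.exp_add]
    congr 1
    ring
  have hpair : ∀ k, ∀ j ∈ Finset.Iio k,
      (2 * R) ^ 2 * ‖ckU (p k) * ckV (p j) - ckU (p j) * ckV (p k)‖ ^ (2 : ℝ) =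
        Real.exp (-2 * pairPotential R (p k) (p j)) := by
    intro k j hj
    have hkj : 0 < chordalDist R (p k) (p j) :=
      lt_of_le_of_ne (by unfold chordalDist; positivity)
        (hne k j (Finset.mem_Iio.1 hj).ne').symm
    have e : -2 * pairPotential R (p k) (p j) =
        Real.log (chordalDist R (p k) (p j)) + Real.log (chordalDist R (p k) (p j)) := by
      rw [pairPotential]; ring
    rw [e, Real.exp_add, Real.exp_log hkj, chordalDist, Real.rpow_two, norm_sub_rev]
    ring
  have hprod : (∏ k : Fin K, ∏ _j ∈ Finset.Iio k, (2 * R) ^ 2) *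
      ∏ k, ∏ j ∈ Finset.Iio k, ‖ckU (p k) * ckV (p j) - ckU (p j) * ckV (p k)‖ ^ (2 : ℝ) =
      Real.exp (∑ k, ∑ j ∈ Finset.Iio k, -2 * pairPotential R (p k) (p j)) := by
    rw [Real.exp_sum, ← Finset.prod_mul_distrib]
    refine Finset.prod_congr rfl fun k _ => ?_
    rw [Real.exp_sum, ← Finset.prod_mul_distrib]
    exact Finset.prod_congr rfl (hpair k)
  have hexp : -2 * plasmaEnergy K R Q q p =
      (∑ k, ∑ j ∈ Finset.Iio k, -2 * pairPotential R (p k) (p j)) +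
        (∑ j, -2 * backgroundPotential K R Q q (p j)) + -(2 * E) := by
    simp only [plasmaEnergy, ← hE, ← Finset.mul_sum]
    ring
  rw [plasmaWeight, boltzmannFactor, hexp, Real.exp_add, Real.exp_add, ← hprod,
    Finset.prod_congr rfl fun l _ => hone l, Finset.prod_mul_distrib, Finset.prod_const,
    Finset.card_univ, Fintype.card_fin, Real.exp_sum, Real.exp_neg]
  field_simp

/-! ### The stereographic image of the area of the sphere -/

/-- Stereographic projection from the south pole, in units of the diameter. -/
def sphereToPlane (p : ℝ × ℝ) : ℂ := Complex.exp (Complex.I * p.2) * Real.tan (p.1 / 2)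

theorem stereographic_div {R : ℝ} (hR : R ≠ 0) (p : ℝ × ℝ) :
    stereographic R p / (2 * R) = sphereToPlane p := by
  have : (R : ℂ) ≠ 0 := by exact_mod_cast hR
  rw [stereographic, sphereToPlane]
  field_simp

theorem measurable_sphereToPlane : Measurable sphereToPlane := by
  have : Measurable fun p : ℝ × ℝ => Real.tan (p.1 / 2) := by
    simp only [Real.tan_eq_sin_div_cos]
    fun_prop
  unfold sphereToPlane
  fun_prop

/-- Polar coordinates on the plane with angles in `[0, 2π]`. -/
theorem lintegral_complex_polar {f : ℂ → ENNReal} (hf : Measurable f) :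
    ∫⁻ z, f z = ∫⁻ r in Set.Ioi (0 : ℝ), ENNReal.ofReal r *
      ∫⁻ φ in Set.Icc (0 : ℝ) (2 * π), f (Complex.exp (Complex.I * φ) * r) := by
  have hm : Measurable fun p : ℝ × ℝ =>
      ENNReal.ofReal p.1 * f (Complex.exp (Complex.I * p.2) * p.1) := by fun_prop
  have hr : ∀ r : ℝ, ∫⁻ φ in Set.Ioo (-π) π, f (Complex.exp (Complex.I * φ) * r) =
      ∫⁻ φ in Set.Icc (0 : ℝ) (2 * π), f (Complex.exp (Complex.I * φ) * r) := by
    intro r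
    have h1 := isAddFundamentalDomain_Ioc Real.two_pi_pos (-π)
    have h2 := isAddFundamentalDomain_Ioc Real.two_pi_pos 0
    rw [zero_add] at h2
    rw [show -π + 2 * π = π by ring] at h1
    rw [setLIntegral_congr Ioo_ae_eq_Ioc, setLIntegral_congr Ioc_ae_eq_Icc.symm]
    refine h1.setLIntegral_eq h2 _ ?_
    rintro ⟨_, k, rfl⟩ x
    simp only [AddSubgroup.vadd_def, vadd_eq_add]
    congr 2
    rw [Complex.exp_eq_exp_iff_exists_int]
    exact ⟨k, by push_cast [zsmul_eq_mul]; ring⟩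
  rw [← Complex.lintegral_comp_polarCoord_symm, polarCoord_target,
    Measure.volume_eq_prod]
  have h : ∀ p : ℝ × ℝ, ENNReal.ofReal p.1 • f (Complex.polarCoord.symm p) =
      ENNReal.ofReal p.1 * f (Complex.exp (Complex.I * p.2) * p.1) := by
    intro p
    rw [Complex.polarCoord_symm_apply, smul_eq_mul, mul_comm Complex.I, Complex.exp_mul_I,
      Complex.ofReal_cos, Complex.ofReal_sin, mul_comm (p.1 : ℂ)]
  simp only [h]
  rw [← Measure.prod_restrict, lintegral_prod _ hm.aemeasurable]
  refine lintegral_congr fun r => ?_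
  simp only
  rw [lintegral_const_mul _ (by fun_prop), hr]

/-- The substitution `r = tan (θ / 2)`. -/
theorem lintegral_tan_half (F : ℝ → ENNReal) :
    ∫⁻ r in Set.Ioi (0 : ℝ), F r =
      ∫⁻ θ in Set.Ioo 0 π, ENNReal.ofReal (1 / (2 * Real.cos (θ / 2) ^ 2)) *
        F (Real.tan (θ / 2)) := by
  have hmem : ∀ θ ∈ Set.Ioo (0 : ℝ) π, θ / 2 ∈ Set.Ioo (-(π / 2)) (π / 2) := fun θ h =>
    ⟨by linarith [h.1, Real.pi_pos], by linarith [h.2]⟩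
  have himg : (fun θ : ℝ => Real.tan (θ / 2)) '' Set.Ioo 0 π = Set.Ioi 0 := by
    ext r
    constructor
    · rintro ⟨θ, h, rfl⟩
      exact Real.tan_pos_of_pos_of_lt_pi_div_two (by linarith [h.1]) (hmem θ h).2
    · intro hr
      refine ⟨2 * Real.arctan r, ⟨by linarith [Real.arctan_pos.2 hr], by
        linarith [Real.arctan_lt_pi_div_two r]⟩, ?_⟩
      simp only [mul_div_cancel_left₀ _ (two_ne_zero' ℝ), Real.tan_arctan]
  rw [← himg, lintegral_image_eq_lintegral_abs_deriv_mul measurableSet_Ioo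
    (f' := fun θ => 1 / (2 * Real.cos (θ / 2) ^ 2)) (fun θ h => ?_) (fun x hx y hy hxy => ?_)]
  · refine setLIntegral_congr_fun measurableSet_Ioo fun θ _ => ?_
    rw [abs_of_nonneg (by positivity)]
  · have hc := (Real.cos_pos_of_mem_Ioo (hmem θ h)).ne'
    refine HasDerivAt.hasDerivWithinAt ?_
    have h1 : HasDerivAt (fun θ : ℝ => θ / 2) (1 / 2) θ := (hasDerivAt_id θ).div_const 2
    refine ((Real.hasDerivAt_tan hc).comp θ h1).congr_deriv ?_
    field_simp
  · have := Real.injOn_tan (hmem x hx) (hmem y hy) hxy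
    linarith

/-- The density of the spherical area measure in the stereographic plane. -/
def planeDensity (R : ℝ) (z : ℂ) : ℝ := 4 * R ^ 2 / (1 + ‖z‖ ^ 2) ^ 2

theorem measurable_planeDensity (R : ℝ) : Measurable (planeDensity R) := by
  unfold planeDensity
  fun_prop

/-- The stereographic image of the area measure of the sphere. -/
theorem map_sphereToPlane (R : ℝ) :
    (sphereArea R).map sphereToPlane =
      volume.withDensity fun z => ENNReal.ofReal (planeDensity R z) := by
  have hD : Measurable fun z => ENNReal.ofReal (planeDensity R z) :=
    ENNReal.measurable_ofReal.comp (measurable_planeDensity R)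
  refine Measure.ext_of_lintegral _ fun f hf => ?_
  have hs : Measurable fun p : ℝ × ℝ => ENNReal.ofReal (R ^ 2 * Real.sin p.1) := by fun_prop
  have hfg : Measurable fun p => f (sphereToPlane p) := hf.comp measurable_sphereToPlane
  rw [lintegral_map hf measurable_sphereToPlane, sphereArea,
    lintegral_withDensity_eq_lintegral_mul _ hs hfg,
    lintegral_withDensity_eq_lintegral_mul _ hD hf,
    lintegral_complex_polar (hD.mul hf), lintegral_tan_half, Measure.volume_eq_prod,
    ← Measure.prod_restrict, lintegral_prod _ (hs.mul hfg).aemeasurable,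
    setLIntegral_congr Ioo_ae_eq_Icc.symm]
  refine setLIntegral_congr_fun measurableSet_Ioo fun θ hθ => ?_
  have hc : 0 < Real.cos (θ / 2) := Real.cos_pos_of_mem_Ioo
    ⟨by linarith [hθ.1, Real.pi_pos], by linarith [hθ.2]⟩
  have ht : 0 < Real.tan (θ / 2) :=
    Real.tan_pos_of_pos_of_lt_pi_div_two (by linarith [hθ.1]) (by linarith [hθ.2])
  have hn : ∀ φ : ℝ, ‖Complex.exp (Complex.I * φ) * (Real.tan (θ / 2) : ℝ)‖ =
      Real.tan (θ / 2) := by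
    intro φ
    rw [norm_mul, mul_comm Complex.I, Complex.norm_exp_ofReal_mul_I, one_mul, Complex.norm_real,
      Real.norm_of_nonneg ht.le]
  simp only [Pi.mul_apply, planeDensity, hn]
  have hm : Measurable fun φ : ℝ => f (sphereToPlane (θ, φ)) :=
    hfg.comp measurable_prodMk_left
  rw [lintegral_const_mul _ hm]
  have e : ∀ φ : ℝ, f (Complex.exp (Complex.I * φ) * (Real.tan (θ / 2) : ℝ)) =
    f (sphereToPlane (θ, φ)) := fun φ => rfl
  simp only [e]
  rw [lintegral_const_mul _ hm, ← mul_assoc, ← mul_assoc, ← ENNReal.ofReal_mul (by positivity),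
    ← ENNReal.ofReal_mul (by positivity)]
  congr 2
  have h1 : 1 + Real.tan (θ / 2) ^ 2 = 1 / Real.cos (θ / 2) ^ 2 := by
    rw [← Real.inv_one_add_tan_sq hc.ne', one_div, inv_inv]
  have h2 : Real.sin θ = 2 * Real.sin (θ / 2) * Real.cos (θ / 2) := by
    rw [← Real.sin_two_mul]; ring_nf
  rw [h1, h2, Real.tan_eq_sin_div_cos]
  field_simp
  ring

theorem lintegral_fin_prod {X : Type*} [MeasureSpace X] [SigmaFinite (volume : Measure X)] :
    ∀ {m : ℕ} {f : Fin m → X → ENNReal}, (∀ i, Measurable (f i)) →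
      ∫⁻ x : Fin m → X, ∏ i, f i (x i) = ∏ i, ∫⁻ x, f i x
  | 0, f, _ => by simp [volume_pi]
  | m + 1, f, hf => by
    have h1 : Measurable fun x : Fin (m + 1) → X => ∏ i, f i (x i) :=
      Finset.measurable_fun_prod _ fun i _ => (hf i).comp (measurable_pi_apply i)
    have h2 : Measurable fun x : Fin m → X => ∏ i : Fin m, f i.succ (x i) :=
      Finset.measurable_fun_prod _ fun i _ => (hf i.succ).comp (measurable_pi_apply i)
    rw [lintegral_fin_cons _ h1, Fin.prod_univ_succ, ← lintegral_mul_const _ (hf 0)]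
    refine lintegral_congr fun z => ?_
    simp only [Fin.prod_univ_succ, Fin.cons_zero, Fin.cons_succ]
    rw [lintegral_const_mul _ h2, lintegral_fin_prod fun i => hf i.succ]

theorem pi_withDensity {X : Type*} [MeasureSpace X] [SigmaFinite (volume : Measure X)] {m : ℕ}
    {f : X → ENNReal} (hf : Measurable f)
    [SigmaFinite ((volume : Measure X).withDensity f)] :
    Measure.pi (fun _ : Fin m => (volume : Measure X).withDensity f) =
      volume.withDensity fun x => ∏ i, f (x i) := by
  refine Measure.pi_eq fun s hs => ?_
  rw [withDensity_apply _ (MeasurableSet.univ_pi hs),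
    ← lintegral_indicator (MeasurableSet.univ_pi hs)]
  have h : ∀ x : Fin m → X, (Set.univ.pi s).indicator (fun x => ∏ i, f (x i)) x =
      ∏ i, (s i).indicator f (x i) := by
    intro x
    by_cases hx : x ∈ Set.univ.pi s
    · rw [Set.indicator_of_mem hx]
      exact Finset.prod_congr rfl fun i _ =>
        (Set.indicator_of_mem (hx i (Set.mem_univ i)) f).symm
    · rw [Set.indicator_of_notMem hx]
      simp only [Set.mem_univ_pi, not_forall] at hx
      obtain ⟨i, hi⟩ := hx
      exact (Finset.prod_eq_zero (Finset.mem_univ i) (Set.indicator_of_notMem hi f)).symm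
  simp only [h]
  rw [lintegral_fin_prod fun i => hf.indicator (hs i)]
  refine Finset.prod_congr rfl fun i _ => ?_
  rw [lintegral_indicator (hs i), withDensity_apply _ (hs i)]

instance isFiniteMeasure_sphereArea (R : ℝ) : IsFiniteMeasure (sphereArea R) := by
  refine isFiniteMeasure_withDensity_ofReal (Integrable.hasFiniteIntegral ?_)
  have : ContinuousOn (fun p : ℝ × ℝ => R ^ 2 * Real.sin p.1)
      (Set.Icc 0 π ×ˢ Set.Icc 0 (2 * π)) := by fun_prop
  exact this.integrableOn_compact (isCompact_Icc.prod isCompact_Icc)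

theorem map_pi_sphereToPlane (R : ℝ) (m : ℕ) :
    (Measure.pi fun _ : Fin m => sphereArea R).map (fun p j => sphereToPlane (p j)) =
      volume.withDensity fun z => ∏ j, ENNReal.ofReal (planeDensity R (z j)) := by
  have hfin : IsFiniteMeasure ((sphereArea R).map sphereToPlane) :=
    Measure.isFiniteMeasure_map _ _
  rw [Measure.pi_map_pi fun _ => measurable_sphereToPlane.aemeasurable]
  rw [map_sphereToPlane] at hfin ⊢
  exact pi_withDensity (ENNReal.measurable_ofReal.comp (measurable_planeDensity R))

/-! ### The plasma weight in the stereographic plane -/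

/-- Away from the south pole, `v / u` is the conjugate of the stereographic coordinate, up to the
factor `-i`. -/
theorem ckV_eq {p : ℝ × ℝ} (hp : Real.cos (p.1 / 2) ≠ 0) :
    ckV p = -Complex.I * (starRingEnd ℂ) (sphereToPlane p) * ckU p := by
  have e1 : (starRingEnd ℂ) (Complex.exp (Complex.I * p.2)) =
      Complex.exp (-Complex.I * p.2) := by
    rw [← Complex.exp_conj, map_mul, Complex.conj_I, Complex.conj_ofReal]
  have e2 : Complex.exp (-Complex.I * p.2 / 2) =
      Complex.exp (-Complex.I * p.2) * Complex.exp (Complex.I * p.2 / 2) := by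
    rw [← Complex.exp_add]
    congr 1
    ring
  have hc : ((Real.cos (p.1 / 2) : ℝ) : ℂ) ≠ 0 := by exact_mod_cast hp
  rw [sphereToPlane, map_mul, e1, Complex.conj_ofReal, ckV, ckU, e2, Real.tan_eq_sin_div_cos,
    Complex.ofReal_div]
  field_simp

theorem norm_ckU_sq {p : ℝ × ℝ} (hp : Real.cos (p.1 / 2) ≠ 0) :
    ‖ckU p‖ ^ 2 = 1 / (1 + ‖sphereToPlane p‖ ^ 2) := by
  have h1 : Complex.I * p.2 / 2 = ((p.2 / 2 : ℝ) : ℂ) * Complex.I := by push_cast; ring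
  rw [ckU, sphereToPlane, norm_mul, norm_mul, h1, mul_comm Complex.I,
    Complex.norm_exp_ofReal_mul_I, Complex.norm_exp_ofReal_mul_I, mul_one, one_mul,
    Complex.norm_real, Complex.norm_real, Real.norm_eq_abs, Real.norm_eq_abs, sq_abs, sq_abs,
    one_div, Real.inv_one_add_tan_sq hp]

theorem prod_prod_Iio_mul {m : ℕ} (x : Fin m → ℝ) :
    ∏ k, ∏ j ∈ Finset.Iio k, x k * x j = ∏ k, x k ^ (m - 1) := by
  have h : ∏ k, ∏ j ∈ Finset.Iio k, x j = ∏ j, ∏ _k ∈ Finset.Ioi j, x j :=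
    Finset.prod_comm' fun k j => by simp
  simp only [Finset.prod_mul_distrib]
  rw [h, ← Finset.prod_mul_distrib]
  refine Finset.prod_congr rfl fun k _ => ?_
  rw [Finset.prod_const, Finset.prod_const, Fin.card_Iio, Fin.card_Ioi, ← pow_add]
  congr 1
  have := k.2
  omega

/-- The plasma weight in the stereographic coordinates. -/
theorem plasmaWeight_eq {M a b : ℕ} {Q q : ℝ} (hQ : Q * M = a) (hq : q * M = b)
    {p : Fin M → ℝ × ℝ} (hp : ∀ j, Real.cos ((p j).1 / 2) ≠ 0) :
    plasmaWeight 2 M Q q p =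
      (∏ j, ‖sphereToPlane (p j)‖ ^ (2 * a) /
        (1 + ‖sphereToPlane (p j)‖ ^ 2) ^ (a + b + (M - 1))) *
        vandermondeSq fun j => sphereToPlane (p j) := by
  have ha : 2 * Q * M = ((2 * a : ℕ) : ℝ) := by push_cast; rw [← hQ]; ring
  have hb : 2 * q * M = ((2 * b : ℕ) : ℝ) := by push_cast; rw [← hq]; ring
  have hpair : ∀ k j, ‖ckU (p k) * ckV (p j) - ckU (p j) * ckV (p k)‖ ^ (2 : ℝ) =
      (‖ckU (p k)‖ ^ 2 * ‖ckU (p j)‖ ^ 2) * ‖sphereToPlane (p k) - sphereToPlane (p j)‖ ^ 2 := by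
    intro k j
    have e : ckU (p k) * ckV (p j) - ckU (p j) * ckV (p k) = Complex.I * (ckU (p k) * ckU (p j)) *
        (starRingEnd ℂ) (sphereToPlane (p k) - sphereToPlane (p j)) := by
      rw [ckV_eq (hp k), ckV_eq (hp j), map_sub]
      ring
    rw [e, Real.rpow_two, norm_mul, norm_mul, norm_mul, Complex.norm_I, Complex.norm_conj]
    ring
  have hV : ∀ j, ‖ckV (p j)‖ = ‖sphereToPlane (p j)‖ * ‖ckU (p j)‖ := by
    intro j
    rw [ckV_eq (hp j), norm_mul, norm_mul, norm_neg, Complex.norm_I, Complex.norm_conj, one_mul]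
  have hprod : ∏ k, ∏ j ∈ Finset.Iio k, ‖ckU (p k) * ckV (p j) - ckU (p j) * ckV (p k)‖ ^ (2 : ℝ) =
      (∏ k, (‖ckU (p k)‖ ^ 2) ^ (M - 1)) * vandermondeSq fun j => sphereToPlane (p j) := by
    rw [← prod_prod_Iio_mul, vandermondeSq, ← Finset.prod_mul_distrib]
    refine Finset.prod_congr rfl fun k _ => ?_
    rw [← Finset.prod_mul_distrib]
    exact Finset.prod_congr rfl fun j _ => hpair k j
  rw [plasmaWeight, hprod, ← mul_assoc, ← Finset.prod_mul_distrib]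
  simp only [ha, hb, Real.rpow_natCast]
  congr 1
  refine Finset.prod_congr rfl fun j _ => ?_
  rw [hV, pow_mul ‖ckU (p j)‖, mul_pow, pow_mul ‖ckU (p j)‖ 2 a, norm_ckU_sq (hp j)]
  simp only [div_pow, one_pow, pow_add]
  field_simp

/-- The south pole, where the stereographic projection takes a default value, is a null set. -/
theorem ae_cos_ne_zero (R : ℝ) : ∀ᵐ p ∂(sphereArea R), Real.cos (p.1 / 2) ≠ 0 := by
  refine (withDensity_absolutelyContinuous _ _).ae_le ?_
  have h1 : ∀ᵐ p : ℝ × ℝ, p.1 ≠ π := by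
    have : ∀ᵐ x : ℝ, x ≠ π := Measure.ae_ne volume π
    exact Measure.quasiMeasurePreserving_fst.ae this
  filter_upwards [ae_restrict_mem (measurableSet_Icc.prod measurableSet_Icc),
    ae_restrict_of_ae h1] with p hp hne
  exact (Real.cos_pos_of_mem_Ioo ⟨by linarith [hp.1.1, Real.pi_pos],
    by linarith [lt_of_le_of_ne hp.1.2 hne]⟩).ne'

/-- The eigenvalue law is the stereographic image of the plasma weight on the sphere. -/
theorem withDensity_eigenvalueDensity_eq_map {M N n : ℕ} (hN : M ≤ N) (hn : M ≤ n) {R Q q : ℝ}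
    (hR : 0 < R) (hQ : Q * M = N - M) (hq : q * M = n - M) :
    (volume.withDensity fun z : Fin M → ℂ => ENNReal.ofReal (eigenvalueDensity M N n z)) =
      ((Measure.pi fun _ : Fin M => sphereArea R).withDensity fun p =>
        ENNReal.ofReal (1 / (eigenvalueNorm M N n * (4 * R ^ 2) ^ M) *
          plasmaWeight 2 M Q q p)).map fun p j => stereographic R (p j) / (2 * R) := by
  have hC := eigenvalueNorm_pos hN hn
  set W : (Fin M → ℂ) → ℝ := fun z => 1 / (eigenvalueNorm M N n * (4 * R ^ 2) ^ M) *
    ((∏ j, ‖z j‖ ^ (2 * (N - M)) / (1 + ‖z j‖ ^ 2) ^ (N - M + (n - M) + (M - 1))) *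
      vandermondeSq z) with hW
  have hWm : Measurable fun z => ENNReal.ofReal (W z) := by
    simp only [hW, vandermondeSq]
    fun_prop
  have hg : Measurable fun (p : Fin M → ℝ × ℝ) j => sphereToPlane (p j) :=
    measurable_pi_lambda _ fun j => measurable_sphereToPlane.comp (measurable_pi_apply j)
  have hae : (fun p => ENNReal.ofReal (1 / (eigenvalueNorm M N n * (4 * R ^ 2) ^ M) *
      plasmaWeight 2 M Q q p)) =ᵐ[Measure.pi fun _ : Fin M => sphereArea R]
      fun p => ENNReal.ofReal (W fun j => sphereToPlane (p j)) := by
    have : ∀ᵐ p ∂(Measure.pi fun _ : Fin M => sphereArea R),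
        ∀ j, Real.cos ((p j).1 / 2) ≠ 0 :=
      ae_all_iff.2 fun j => (Measure.quasiMeasurePreserving_eval (fun _ => sphereArea R) j).ae
        (ae_cos_ne_zero R)
    filter_upwards [this] with p hp
    rw [plasmaWeight_eq (by rw [hQ, Nat.cast_sub hN]) (by rw [hq, Nat.cast_sub hn]) hp]
  have hdens : ∀ z : Fin M → ℂ, ENNReal.ofReal (eigenvalueDensity M N n z) =
      (∏ j, ENNReal.ofReal (planeDensity R (z j))) * ENNReal.ofReal (W z) := by
    intro z
    have h0 : ∀ j, 0 ≤ planeDensity R (z j) := fun j => by unfold planeDensity; positivity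
    rw [← ENNReal.ofReal_prod_of_nonneg fun j _ => h0 j,
      ← ENNReal.ofReal_mul (Finset.prod_nonneg fun j _ => h0 j)]
    congr 1
    have e : ∀ j, ‖z j‖ ^ (2 * (N - M)) / (1 + ‖z j‖ ^ 2) ^ (n + N - M + 1) =
        planeDensity R (z j) * (‖z j‖ ^ (2 * (N - M)) /
          (1 + ‖z j‖ ^ 2) ^ (N - M + (n - M) + (M - 1))) / (4 * R ^ 2) := by
      intro j
      -- The area element contributes the exponent `2`; as there is a particle, `M - 1` is exact.
      have ht : n + N - M + 1 = 2 + (N - M + (n - M) + (M - 1)) := by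
        have := j.2
        omega
      rw [ht, pow_add, planeDensity]
      field_simp
    rw [eigenvalueDensity_eq, eigWeight, Finset.prod_congr rfl fun j _ => e j,
      Finset.prod_div_distrib, Finset.prod_mul_distrib, Finset.prod_const, Finset.card_univ,
      Fintype.card_fin, hW]
    field_simp
  have hD : Measurable fun z : Fin M → ℂ => ∏ j, ENNReal.ofReal (planeDensity R (z j)) :=
    Finset.measurable_fun_prod _ fun j _ => ENNReal.measurable_ofReal.comp
      ((measurable_planeDensity R).comp (measurable_pi_apply j))
  simp only [stereographic_div hR.ne']
  rw [withDensity_congr_ae hae]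
  refine Measure.ext_of_lintegral _ fun f hf => ?_
  have hWg : Measurable fun p : Fin M → ℝ × ℝ =>
    ENNReal.ofReal (W fun j => sphereToPlane (p j)) := hWm.comp hg
  have hfg : Measurable fun p : Fin M → ℝ × ℝ => f fun j => sphereToPlane (p j) := hf.comp hg
  have hWf : Measurable fun z => ENNReal.ofReal (W z) * f z := hWm.mul hf
  rw [lintegral_map hf hg, lintegral_withDensity_eq_lintegral_mul _ hWg hfg]
  have h1 := lintegral_map (μ := Measure.pi fun _ : Fin M => sphereArea R) hWf hg
  rw [map_pi_sphereToPlane, lintegral_withDensity_eq_lintegral_mul _ hD hWf] at h1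
  simp only [hdens]
  have hDW : Measurable fun z : Fin M → ℂ =>
    (∏ j, ENNReal.ofReal (planeDensity R (z j))) * ENNReal.ofReal (W z) := hD.mul hWm
  rw [lintegral_withDensity_eq_lintegral_mul _ hDW hf]
  refine Eq.trans (lintegral_congr fun z => ?_) h1
  exact mul_assoc _ _ _

end SphericalAnnulus

end

theorem mainTheorem1 (M N n : ℕ) (hN : M ≤ N) (hn : M ≤ n) :
    -- the element density is correctly normalized
    IsProbabilityMeasure (SphericalAnnulus.elementLaw M N n) ∧
    -- the eigenvalue density of a random matrix with this element density
    (∀ (Ω : Type*) [MeasurableSpace Ω] (P : Measure Ω) [IsProbabilityMeasure P]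
      (G : Ω → Matrix (Fin M) (Fin M) ℂ),
      HasLaw (fun ω i j => G ω i j) (SphericalAnnulus.elementLaw M N n) P →
        SphericalAnnulus.HasEigenvaluePDF G (SphericalAnnulus.eigenvalueDensity M N n) P) ∧
    -- the identification with the plasma of `M` particles at `β = 2`
    (∀ R Q q : ℝ, 0 < R → 0 ≤ Q → 0 ≤ q → Q * M = N - M → q * M = n - M →
      -- on the annulus, the weight is the Boltzmann factor of the plasma up to normalization
      (∃ K : ℝ, 0 < K ∧ ∀ p : Fin M → ℝ × ℝ,
        (∀ j, (p j).1 ∈ Set.Icc (SphericalAnnulus.thetaNorth Q q)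
          (SphericalAnnulus.thetaSouth Q q)) →
        (∀ j k, j ≠ k → SphericalAnnulus.chordalDist R (p j) (p k) ≠ 0) →
        SphericalAnnulus.plasmaWeight 2 M Q q p =
          K * SphericalAnnulus.boltzmannFactor 2 M R Q q p) ∧
      -- the eigenvalue law is the stereographic image of the weight on the sphere
      (volume.withDensity fun z : Fin M → ℂ =>
          ENNReal.ofReal (SphericalAnnulus.eigenvalueDensity M N n z)) =
        ((Measure.pi fun _ : Fin M => SphericalAnnulus.sphereArea R).withDensity fun p =>
          ENNReal.ofReal (1 / (SphericalAnnulus.eigenvalueNorm M N n * (4 * R ^ 2) ^ M) *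
            SphericalAnnulus.plasmaWeight 2 M Q q p)).map
          fun p j => SphericalAnnulus.stereographic R (p j) / (2 * R)) := by
  refine ⟨SphericalAnnulus.isProbabilityMeasure_elementLaw hN hn, fun Ω _ P _ G hG =>
    SphericalAnnulus.hasEigenvaluePDF_of_hasLaw hN hn hG, fun R Q q hR hQ hq hQM hqM =>
    ⟨SphericalAnnulus.exists_plasmaWeight_eq M hR hQ hq,
      SphericalAnnulus.withDensity_eigenvalueDensity_eq_map hN hn hR hQM hqM⟩⟩
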